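/- Let $M$ be a smooth $4$-manifold without boundary (Hausdorff and second countable), and let $F\colon M^4\to\mathbf R^5$ be a complete, two-sided, stable minimal immersion. That is: $F$ is a smooth immersion whose pullback metric $g=F^*g_{\mathrm{Euc}}$ is complete; there is a smooth unit normal field $\nu$ along $F$; the mean curvature $H=\operatorname{tr}_g A$ of $F$ vanishes, where $A(X,Y)=-\langle\nabla^{\mathbf R^5}_XY,\nu\rangle$ is the second fundamental form; and $$\int_M|A|^2\varphi^2\,d\mu\le\int_M|\nabla\varphi|^2\,d\mu\qquad\text{for all }\varphi\in C_c^\infty(M),$$ where $d\mu$ is the volume measure of $g$. Let $r=|F|$ be the Euclidean distance to the origin, let $N=M\setminus F^{-1}(\{0\})$, and equip $N$ with the conformal metric $\tilde g=r^{-2}g$; tildes denote quantities with respect to $\tilde g$. For a $\tilde g$-orthonormal pair $v,w\in T_xN$ put $$\widetilde{\mathrm{BiRic}}(v,w)=\widetilde{\mathrm{Ric}}(v,v)+\widetilde{\mathrm{Ric}}(w,w)-\tilde R(v,w,w,v),$$ with the sign convention in which $\tilde R(v,w,w,v)$ is the sectional curvature of the plane spanned by $v,w$, and let $\tilde\lambda_{\mathrm{BiRic}}(x)$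 be the infimum of $\widetilde{\mathrm{BiRic}}(v,w)$ over all $\tilde g$-orthonormal pairs $v,w\in T_xN$. Then there is a smooth function $V\colon N\to\mathbf R$ such that $$V\ge 1-\tilde\lambda_{\mathrm{BiRic}}\quad\text{on }N$$ and $$\int_N|\tilde\nabla\psi|_{\tilde g}^2\,d\tilde\mu\ \ge\ \int_N V\psi^2\,d\tilde\mu$$ for every compactly supported function $\psi\colon N\to\mathbf R$ that is Lipschitz with respect to $\tilde g$ (both integrals being finite). -/

import Mathlib

open scoped Manifold ContDiff ENNReal NNReal
open MeasureTheory

noncomputable section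

namespace StableMinimal

/-- The type of fields of real-valued functions of two tangent vectors on an `n`-manifold `M`; the
metrics and second fundamental forms below, which are fields of bilinear forms, are of this type. -/
abbrev TensorField (n : ℕ) (M : Type*) [TopologicalSpace M]
    [ChartedSpace (EuclideanSpace ℝ (Fin n)) M] : Type _ :=
  ∀ x : M, TangentSpace (𝓡 n) x → TangentSpace (𝓡 n) x → ℝ

section Intrinsic

variable {n : ℕ} {M : Type*} [TopologicalSpace M] [ChartedSpace (EuclideanSpace ℝ (Fin n)) M]

/-- The `i`-th standard basis vector of `ℝⁿ`. -/
def stdVec (i : Fin n) : EuclideanSpace ℝ (Fin n) := EuclideanSpace.single i 1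

/-- The `i`-th coordinate tangent vector `∂ᵢ` at `x`, for the preferred chart at `x`. -/
def coordVec (x : M) (i : Fin n) : TangentSpace (𝓡 n) x := (stdVec i : EuclideanSpace ℝ (Fin n))

/-- The vector in `ℝⁿ` that represents a tangent vector at `x` in the preferred chart at `x`. -/
def toVec {x : M} (v : TangentSpace (𝓡 n) x) : EuclideanSpace ℝ (Fin n) := v

/-- The `i`-th component of a tangent vector at `x`, for the preferred chart at `x`. -/
def comp {x : M} (v : TangentSpace (𝓡 n) x) (i : Fin n) : ℝ := toVec v i

/-- The matrix `g(∂ᵢ, ∂ⱼ)` at `x` in the preferred chart at `x`. -/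
def gram (g : TensorField n M) (x : M) : Matrix (Fin n) (Fin n) ℝ :=
  fun i j => g x (coordVec x i) (coordVec x j)

/-- The coefficients `gᵢⱼ(y)` of `g` in the chart `φ` around `p`, as functions of the coordinate
`y ∈ φ.target`. -/
def chartGram (g : TensorField n M) (p : M) (y : EuclideanSpace ℝ (Fin n)) :
    Matrix (Fin n) (Fin n) ℝ :=
  let φ := chartAt (EuclideanSpace ℝ (Fin n)) p
  fun i j => g (φ.symm y) (mfderiv (𝓡 n) (𝓡 n) φ.symm y (stdVec i))
    (mfderiv (𝓡 n) (𝓡 n) φ.symm y (stdVec j))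

/-- The partial derivative `∂ₖ f (y)`. -/
def partialD (k : Fin n) (f : EuclideanSpace ℝ (Fin n) → ℝ) (y : EuclideanSpace ℝ (Fin n)) : ℝ :=
  fderiv ℝ f y (stdVec k)

/-- The Christoffel symbols `Γᵏᵢⱼ(y)` of the Levi-Civita connection of `g` in the chart
around `p`. -/
def christoffel (g : TensorField n M) (p : M) (k i j : Fin n) (y : EuclideanSpace ℝ (Fin n)) : ℝ :=
  (1 / 2) * ∑ l, (chartGram g p y)⁻¹ k l *
    (partialD i (fun z => chartGram g p z j l) y + partialD j (fun z => chartGram g p z i l) y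
      - partialD l (fun z => chartGram g p z i j) y)

/-- The components `Rᵢⱼₖˡ` at `x` of the Riemann curvature tensor in the preferred chart at `x`:
`R(∂ᵢ, ∂ⱼ)∂ₖ = ∑ₗ Rᵢⱼₖˡ ∂ₗ`, with `R(X, Y)Z = ∇_X ∇_Y Z - ∇_Y ∇_X Z - ∇_[X,Y] Z`. -/
def riemannCoeff (g : TensorField n M) (x : M) (i j k l : Fin n) : ℝ :=
  let y := chartAt (EuclideanSpace ℝ (Fin n)) x x
  partialD i (christoffel g x l j k) y - partialD j (christoffel g x l i k) y
    + ∑ m, (christoffel g x m j k y * christoffel g x l i m y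
      - christoffel g x m i k y * christoffel g x l j m y)

/-- The curvature `R(u, v, w, z) = g(R(u, v)w, z)`; thus `R(v, w, w, v)` is the sectional curvature
of the plane spanned by an orthonormal pair `v, w`. -/
def riemann (g : TensorField n M) (x : M) (u v w z : TangentSpace (𝓡 n) x) : ℝ :=
  ∑ i, ∑ j, ∑ k, ∑ l, ∑ m,
    comp u i * comp v j * comp w k * comp z m * riemannCoeff g x i j k l * gram g x l m

/-- The Ricci curvature `Ric(v, w) = tr (u ↦ R(u, v)w)`. -/
def ricci (g : TensorField n M) (x : M) (v w : TangentSpace (𝓡 n) x) : ℝ :=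
  ∑ j, ∑ k, comp v j * comp w k * ∑ i, riemannCoeff g x i j k i

/-- The bi-Ricci curvature (of a `g`-orthonormal pair). -/
def biRic (g : TensorField n M) (x : M) (v w : TangentSpace (𝓡 n) x) : ℝ :=
  ricci g x v v + ricci g x w w - riemann g x v w w v

/-- The smallest bi-Ricci curvature `λ_BiRic(x)`: the infimum over all `g`-orthonormal pairs. -/
def minBiRic (g : TensorField n M) (x : M) : ℝ :=
  sInf {t : ℝ | ∃ v w : TangentSpace (𝓡 n) x,
    g x v v = 1 ∧ g x w w = 1 ∧ g x v w = 0 ∧ t = biRic g x v w}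

/-- `|∇ψ|²_g = ∑ gⁱʲ ∂ᵢψ ∂ⱼψ` at `x`. -/
def gradNormSq (g : TensorField n M) (ψ : M → ℝ) (x : M) : ℝ :=
  let dψ : TangentSpace (𝓡 n) x → ℝ := fun v => mfderiv (𝓡 n) 𝓘(ℝ, ℝ) ψ x v
  ∑ i, ∑ j, (gram g x)⁻¹ i j * dψ (coordVec x i) * dψ (coordVec x j)

/-- The distance of `g`: the infimum of the `g`-lengths of `C¹` paths (`∞` between different
components). -/
def riemDist (g : TensorField n M) (x y : M) : ℝ≥0∞ :=
  letI : ∀ z : M, ENorm (TangentSpace (𝓡 n) z) := fun z =>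
    ⟨fun v => ENNReal.ofReal (Real.sqrt (g z v v))⟩
  Manifold.riemannianEDist (𝓡 n) x y

/-- `(M, g)` is complete: every sequence that is Cauchy for the distance of `g` converges. -/
def IsCompleteMetric (g : TensorField n M) : Prop :=
  ∀ u : ℕ → M, (∀ ε : ℝ≥0∞, 0 < ε → ∃ k, ∀ i ≥ k, ∀ j ≥ k, riemDist g (u i) (u j) < ε) →
    ∃ x, Filter.Tendsto u Filter.atTop (nhds x)

/-- `ψ` is Lipschitz for the distance of `g`. -/
def IsLipschitz (g : TensorField n M) (ψ : M → ℝ) : Prop :=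
  ∃ K : ℝ≥0, ∀ x y, edist (ψ x) (ψ y) ≤ K * riemDist g x y

/-- The volume measure of `g` inside the chart `φ` around `p` (zero outside of its domain): the
image under `φ⁻¹` of the measure `√(det gᵢⱼ) dy` on `φ.target`. -/
def chartVolume [MeasurableSpace M] (g : TensorField n M) (p : M) : Measure M :=
  let φ := chartAt (EuclideanSpace ℝ (Fin n)) p
  Measure.map φ.symm ((volume.restrict φ.target).withDensity
    fun y => ENNReal.ofReal (Real.sqrt (chartGram g p y).det))

/-- The Riemannian volume measure of `g`. The measures `chartVolume g p` agree on overlaps of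
charts, so that their supremum is the measure on `M` that restricts to each of them. -/
def volumeMeasure [MeasurableSpace M] (g : TensorField n M) : Measure M :=
  ⨆ p : M, chartVolume g p

end Intrinsic

section Extrinsic

variable (n : ℕ) {M : Type*} [TopologicalSpace M] [ChartedSpace (EuclideanSpace ℝ (Fin n)) M]
  {W : Type*} [NormedAddCommGroup W] [InnerProductSpace ℝ W]

/-- The differential of `F` at `x`, with values in the vector space `W`. -/
def differential (F : M → W) (x : M) (v : TangentSpace (𝓡 n) x) : W :=
  mfderiv (𝓡 n) 𝓘(ℝ, W) F x v

/-- `F` is a smooth immersion: smooth with injective differentials. -/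
structure IsSmoothImmersion (F : M → W) : Prop where
  contMDiff : ContMDiff (𝓡 n) 𝓘(ℝ, W) ∞ F
  injective : ∀ x, Function.Injective (differential n F x)

/-- `ν` is a smooth unit normal vector field along `F`; the hypersurface `F` is two-sided if it has
such a field. -/
structure IsUnitNormal (F ν : M → W) : Prop where
  contMDiff : ContMDiff (𝓡 n) 𝓘(ℝ, W) ∞ ν
  norm_eq_one : ∀ x, ‖ν x‖ = 1
  orthogonal : ∀ x (v : TangentSpace (𝓡 n) x), inner ℝ (differential n F x v) (ν x) = 0

/-- The pullback metric `g = F^* g_Euc`. -/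
def inducedMetric (F : M → W) : TensorField n M :=
  fun x v w => inner ℝ (differential n F x v) (differential n F x w)

/-- The conformal metric `r⁻² g`, where `g` is the pullback metric and `r = |F|`. It is used
only where `F` does not vanish. -/
def conformalMetric (F : M → W) : TensorField n M :=
  fun x v w => (‖F x‖ ^ 2)⁻¹ * inducedMetric n F x v w

/-- The second fundamental form `A(v, w) = -⟨∇_v w, ν⟩`, where `∇` is the flat connection of `W` and
`w` is extended with constant coefficients in the preferred chart at `x`. -/
def secondFF (F ν : M → W) : TensorField n M :=
  fun x v w =>
    -inner ℝ (fderiv ℝ (fderiv ℝ (F ∘ (chartAt (EuclideanSpace ℝ (Fin n)) x).symm))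
      (chartAt (EuclideanSpace ℝ (Fin n)) x x) (toVec v) (toVec w)) (ν x)

/-- The mean curvature `H = tr_g A = ∑ gⁱʲ Aᵢⱼ`. -/
def meanCurvature (F ν : M → W) (x : M) : ℝ :=
  ∑ i, ∑ j, (gram (inducedMetric n F) x)⁻¹ i j * gram (secondFF n F ν) x i j

/-- `|A|² = ∑ gⁱᵏ gʲˡ Aᵢⱼ Aₖₗ`. -/
def normSqA (F ν : M → W) (x : M) : ℝ :=
  ∑ i, ∑ j, ∑ k, ∑ l, (gram (inducedMetric n F) x)⁻¹ i k * (gram (inducedMetric n F) x)⁻¹ j l *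
    gram (secondFF n F ν) x i j * gram (secondFF n F ν) x k l

/-- The immersion is minimal. -/
def IsMinimal (F ν : M → W) : Prop := ∀ x, meanCurvature n F ν x = 0

/-- The stability inequality `∫ |A|² φ² ≤ ∫ |∇φ|²` for all `φ ∈ C_c^∞(M)`. -/
def IsStable [MeasurableSpace M] (F ν : M → W) : Prop :=
  ∀ φ : M → ℝ, ContMDiff (𝓡 n) 𝓘(ℝ, ℝ) ∞ φ → HasCompactSupport φ →
    ∫ x, normSqA n F ν x * φ x ^ 2 ∂(volumeMeasure (inducedMetric n F)) ≤
      ∫ x, gradNormSq (inducedMetric n F) φ x ∂(volumeMeasure (inducedMetric n F))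

end Extrinsic

/-- The open subset `M \ F⁻¹(0)` of `M`. -/
def awayFromZero {M W : Type*} [TopologicalSpace M] [NormedAddCommGroup W]
    (F : M → W) (hF : Continuous F) : TopologicalSpace.Opens M :=
  ⟨{x | F x ≠ 0}, isOpen_ne_fun hF continuous_const⟩

end StableMinimal

end

open scoped Manifold ContDiff ENNReal NNReal
open MeasureTheory

noncomputable section

/-! Away from the origin the map `Φ = (F/|F|, log |F|)` sends the hypersurface into the cylinder `S⁴
× ℝ ⊂ ℝ⁵ × ℝ`. In polar coordinates the Euclidean metric is `r²` times the cylinder metric, so `r⁻²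
g` is exactly the metric induced by `Φ` (`conformalMetric_eq`). Hence no formula for the curvature
under a conformal change is needed: the curvature of `r⁻² g` comes from the Gauss equation of an
immersion into flat space of dimension six, with codimension two.

Let `ρ = d log r`, let `σ = ⟨F/|F|, ν⟩`, and let `α = r A` in an orthonormal frame of `g`. One
normal of `Φ` is the normal of the cylinder, with second fundamental form `-(δ - ρ ⊗ ρ)`; the other
is the normal inside the cylinder, with second fundamental form `-(α - σ δ)`. Moreover `|ρ|² + σ² =
1`, and `tr α = 0` by minimality. The algebraic inequality `biRic_algebra` then gives `BiRic ≥ 2 +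
3σ² - r²|A|²` (`biRic_lower_bound`). This dictates the potential `V = r²|A|² - 1 - 3σ²`.

For the integral inequality, insert `φ = ψ/r` into the stability inequality. The pointwise identity
`traceForm_div_norm` reads `|∇(ψ/r)|² = r⁻²|∇ψ|² - div Z + (1 + 3σ²) r⁻⁴ ψ²`, where `Z = r⁻⁴ ψ² F`
and `div Z = tr ⟨dF, dZ⟩`. The divergence integrates to zero by the first variation formula
(`integral_traceForm_eq_zero`), which rests on the harmonicity of the coordinate functions of a
minimal immersion. Since the conformal volume is `r⁻⁴ dμ` and the conformal gradient square is
`r²|∇ψ|²`, the result is the claim for smooth `ψ` (`conformal_stability`).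

A compactly supported Lipschitz `ψ` is a limit of smooth functions with uniformly bounded gradients
that converge almost everywhere (`exists_smoothApprox`: partition of unity, mollification in charts,
Rademacher's theorem). Dominated convergence finishes the proof. -/

namespace StableMinimal

/-! ### Frame independence of traces and norms; smoothness of determinants and inverses. -/

section Matrices

variable {ι : Type*} [Fintype ι]

lemma sum_sum_mul_eq_trace (X Y : Matrix ι ι ℝ) :
    ∑ i, ∑ j, X i j * Y i j = (X * Y.transpose).trace := by
  simp [Matrix.trace, Matrix.mul_apply]

/-- Written as the trace of a product, the norm becomes accessible to cyclicity of the trace, which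
is what makes it frame independent. -/
lemma sum_quad_eq_trace (X A : Matrix ι ι ℝ) :
    ∑ i, ∑ j, ∑ k, ∑ l, X i k * X j l * A i j * A k l
      = (X.transpose * A * (X * A.transpose)).trace := by
  have h : ∀ i j k l, X i k * X j l * A i j * A k l = (X i k * A i j) * (X j l * A k l) := by
    intros; ring
  simp only [Matrix.trace, Matrix.diag, Matrix.mul_apply, Matrix.transpose_apply,
    Finset.sum_mul, Finset.mul_sum, h]
  rw [Finset.sum_congr rfl (fun i _ => Finset.sum_comm), Finset.sum_comm]
  refine Finset.sum_congr rfl fun k _ => ?_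
  rw [Finset.sum_comm]
  refine Finset.sum_congr rfl fun j _ => ?_
  rw [Finset.sum_comm]

variable [DecidableEq ι]

/-- The metric trace of a bilinear form does not depend on the frame. -/
lemma sum_inv_conj (B G T : Matrix ι ι ℝ) (hB : IsUnit B.det) :
    ∑ i, ∑ j, (B.transpose * G * B)⁻¹ i j * (B.transpose * T * B) i j
      = ∑ i, ∑ j, G⁻¹ i j * T i j := by
  have hBt : IsUnit B.transpose.det := by rwa [Matrix.det_transpose]
  rw [sum_sum_mul_eq_trace, sum_sum_mul_eq_trace, Matrix.mul_inv_rev, Matrix.mul_inv_rev]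
  simp only [Matrix.transpose_mul, Matrix.transpose_transpose]
  calc (B⁻¹ * (G⁻¹ * B.transpose⁻¹) * (B.transpose * (T.transpose * B))).trace
      = (B⁻¹ * (G⁻¹ * (B.transpose⁻¹ * B.transpose) * T.transpose * B)).trace := by
        simp only [Matrix.mul_assoc]
    _ = (G⁻¹ * T.transpose * (B * B⁻¹)).trace := by
        rw [Matrix.nonsing_inv_mul _ hBt, Matrix.mul_one, Matrix.trace_mul_comm]
        simp only [Matrix.mul_assoc]
    _ = _ := by rw [Matrix.mul_nonsing_inv _ hB, Matrix.mul_one]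

/-- The metric square norm of a bilinear form does not depend on the frame. -/
lemma sum_quad_inv_conj (B G A : Matrix ι ι ℝ) (hB : IsUnit B.det) :
    ∑ i, ∑ j, ∑ k, ∑ l, (B.transpose * G * B)⁻¹ i k * (B.transpose * G * B)⁻¹ j l *
        (B.transpose * A * B) i j * (B.transpose * A * B) k l
      = ∑ i, ∑ j, ∑ k, ∑ l, G⁻¹ i k * G⁻¹ j l * A i j * A k l := by
  have hBt : IsUnit B.transpose.det := by rwa [Matrix.det_transpose]
  rw [sum_quad_eq_trace, sum_quad_eq_trace, Matrix.mul_inv_rev, Matrix.mul_inv_rev]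
  simp only [Matrix.transpose_mul, Matrix.transpose_transpose, Matrix.transpose_nonsing_inv]
  have e1 : ∀ C : Matrix ι ι ℝ, B.transpose⁻¹ * (B.transpose * C) = C := fun C => by
    rw [← Matrix.mul_assoc, Matrix.nonsing_inv_mul _ hBt, Matrix.one_mul]
  have e2 : ∀ C : Matrix ι ι ℝ, B * (B⁻¹ * C) = C := fun C => by
    rw [← Matrix.mul_assoc, Matrix.mul_nonsing_inv _ hB, Matrix.one_mul]
  simp only [Matrix.mul_assoc, e1, e2]
  rw [Matrix.trace_mul_comm]
  simp only [Matrix.mul_assoc]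
  rw [Matrix.mul_nonsing_inv _ hB, Matrix.mul_one]

variable {E : Type*} [NormedAddCommGroup E] [NormedSpace ℝ E]

lemma contDiffOn_det {m : WithTop ℕ∞} {s : Set E} {A : E → Matrix ι ι ℝ}
    (hA : ∀ i j, ContDiffOn ℝ m (fun x => A x i j) s) :
    ContDiffOn ℝ m (fun x => (A x).det) s := by
  simp only [Matrix.det_apply]
  refine ContDiffOn.sum fun σ _ => ?_
  refine ContDiffOn.const_smul _ ?_
  exact contDiffOn_prod fun i _ => hA _ _

lemma contDiffOn_inv {m : WithTop ℕ∞} {s : Set E} {A : E → Matrix ι ι ℝ}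
    (hA : ∀ i j, ContDiffOn ℝ m (fun x => A x i j) s) (h0 : ∀ x ∈ s, (A x).det ≠ 0) (i j : ι) :
    ContDiffOn ℝ m (fun x => (A x)⁻¹ i j) s := by
  simp only [Matrix.inv_def, Matrix.smul_apply, Ring.inverse_eq_inv, smul_eq_mul]
  refine ((contDiffOn_det hA).inv h0).mul ?_
  simp only [Matrix.adjugate_apply]
  refine contDiffOn_det fun k l => ?_
  by_cases hk : k = j
  · subst hk
    simp only [Matrix.updateRow_self]
    exact contDiffOn_const
  · simp only [Matrix.updateRow_ne hk]
    exact hA k l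

/-- Jacobi's formula for the derivative of a determinant. -/
lemma hasFDerivAt_det {A : E → Matrix ι ι ℝ} {A' : ι → ι → E →L[ℝ] ℝ} {x : E}
    (hA : ∀ i j, HasFDerivAt (fun x => A x i j) (A' i j) x) :
    HasFDerivAt (fun x => (A x).det) (∑ i, ∑ j, (A x).adjugate i j • A' j i) x := by
  have h1 : HasFDerivAt (fun x => (A x).det)
      (∑ σ : Equiv.Perm ι, Equiv.Perm.sign σ • ∑ i, (∏ j ∈ Finset.univ.erase i, A x (σ j) j) •
        A' (σ i) i) x := by
    simp only [Matrix.det_apply]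
    refine HasFDerivAt.fun_sum fun σ _ => ?_
    refine HasFDerivAt.const_smul ?_ _
    exact HasFDerivAt.finsetProd fun i _ => hA _ _
  convert h1 using 1
  ext v
  simp only [sum_apply, smul_apply, smul_eq_mul,
    Finset.smul_sum]
  rw [Finset.sum_comm (s := (Finset.univ : Finset (Equiv.Perm ι)))]
  refine Finset.sum_congr rfl fun i _ => ?_
  -- Cramer's rule: pairing with the adjugate gives the determinant in which one column is
  -- differentiated, and these are the terms of the product rule.
  have h2 : ∑ j, (A x).adjugate i j * A' j i v = ((A x).updateCol i fun j => A' j i v).det := by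
    rw [← Matrix.cramer_apply, Matrix.cramer_eq_adjugate_mulVec]
    rfl
  rw [h2, Matrix.det_apply]
  refine Finset.sum_congr rfl fun σ _ => ?_
  rw [← Finset.mul_prod_erase Finset.univ _ (Finset.mem_univ i)]
  simp only [Matrix.updateCol_self]
  rw [mul_comm]
  congr 2
  refine Finset.prod_congr rfl fun j hj => ?_
  rw [Matrix.updateCol_ne (Finset.ne_of_mem_erase hj)]

end Matrices

/-! ### Christoffel symbols and the Gauss equation of an immersed coordinate patch, in any
codimension. -/

section LocalImmersion

variable {n : ℕ} {W : Type*} [NormedAddCommGroup W] [InnerProductSpace ℝ W]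

lemma sum_smul_stdVec (v : EuclideanSpace ℝ (Fin n)) : ∑ i, v i • stdVec i = v := by
  ext j
  simp [stdVec, Finset.sum_apply, Pi.single_apply]

/-- The Gram matrix of the images of the standard basis vectors. -/
def gramOf (D : EuclideanSpace ℝ (Fin n) →L[ℝ] W) : Matrix (Fin n) (Fin n) ℝ :=
  Matrix.of fun i j => inner ℝ (D (stdVec i)) (D (stdVec j))

lemma gramOf_apply (D : EuclideanSpace ℝ (Fin n) →L[ℝ] W) (i j : Fin n) :
    gramOf D i j = inner ℝ (D (stdVec i)) (D (stdVec j)) := rfl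

lemma gramOf_isSymm (D : EuclideanSpace ℝ (Fin n) →L[ℝ] W) : (gramOf D).IsSymm := by
  ext i j
  simp [gramOf_apply, Matrix.transpose_apply, real_inner_comm]

lemma sum_gramOf (D : EuclideanSpace ℝ (Fin n) →L[ℝ] W) (v w : EuclideanSpace ℝ (Fin n)) :
    ∑ i, ∑ j, v i * w j * gramOf D i j = inner ℝ (D v) (D w) := by
  conv_rhs => rw [← sum_smul_stdVec v, ← sum_smul_stdVec w]
  simp only [map_sum, map_smul, sum_inner, real_inner_smul_left, gramOf_apply]
  simp only [inner_sum, real_inner_smul_right, Finset.mul_sum]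
  refine Finset.sum_congr rfl fun i _ => Finset.sum_congr rfl fun j _ => ?_
  ring

lemma gramOf_posDef {D : EuclideanSpace ℝ (Fin n) →L[ℝ] W} (hD : Function.Injective D) :
    (gramOf D).PosDef := by
  refine Matrix.PosDef.of_dotProduct_mulVec_pos ?_ fun v hv => ?_
  · rw [Matrix.IsHermitian, Matrix.conjTranspose_eq_transpose_of_trivial]
    exact gramOf_isSymm D
  · have h := sum_gramOf D (WithLp.toLp 2 v) (WithLp.toLp 2 v)
    have h2 : star v ⬝ᵥ (gramOf D).mulVec v
        = inner ℝ (D (WithLp.toLp 2 v)) (D (WithLp.toLp 2 v)) := by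
      rw [← h]
      simp only [dotProduct, Matrix.mulVec, Finset.mul_sum, Pi.star_apply, star_trivial]
      refine Finset.sum_congr rfl fun i _ => Finset.sum_congr rfl fun j _ => ?_
      ring
    rw [h2, real_inner_self_eq_norm_sq]
    have h3 : D (WithLp.toLp 2 v) ≠ 0 := by
      intro h0
      apply hv
      have := hD (h0.trans (map_zero D).symm)
      simpa using this
    positivity

lemma gramOf_det_pos {D : EuclideanSpace ℝ (Fin n) →L[ℝ] W} (hD : Function.Injective D) :
    0 < (gramOf D).det := (gramOf_posDef hD).det_pos

/-- The second partial derivative `∂ᵢ∂ⱼ G`. -/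
def sndD (G : EuclideanSpace ℝ (Fin n) → W) (y : EuclideanSpace ℝ (Fin n)) (i j : Fin n) : W :=
  fderiv ℝ (fderiv ℝ G) y (stdVec i) (stdVec j)

variable {G : EuclideanSpace ℝ (Fin n) → W} {U : Set (EuclideanSpace ℝ (Fin n))}
  {y : EuclideanSpace ℝ (Fin n)}

section Normed

variable {V : Type*} [NormedAddCommGroup V] [NormedSpace ℝ V]
  {f : EuclideanSpace ℝ (Fin n) → V}

lemma contDiffOn_fderiv (hU : IsOpen U) (hf : ContDiffOn ℝ ∞ f U) :
    ContDiffOn ℝ ∞ (fderiv ℝ f) U :=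
  hf.fderiv_of_isOpen hU (by simp)

lemma contDiffOn_fderiv_apply (hU : IsOpen U) (hf : ContDiffOn ℝ ∞ f U)
    (v : EuclideanSpace ℝ (Fin n)) : ContDiffOn ℝ ∞ (fun z => fderiv ℝ f z v) U :=
  (contDiffOn_fderiv hU hf).clm_apply contDiffOn_const

lemma differentiableAt_of_contDiffOn (hU : IsOpen U) (hf : ContDiffOn ℝ ∞ f U) (hy : y ∈ U) :
    DifferentiableAt ℝ f y :=
  (hf.contDiffAt (hU.mem_nhds hy)).differentiableAt (by simp)

lemma fderiv_fderiv_apply (hU : IsOpen U) (hf : ContDiffOn ℝ ∞ f U) (hy : y ∈ U)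
    (u v : EuclideanSpace ℝ (Fin n)) :
    fderiv ℝ (fun z => fderiv ℝ f z v) y u = fderiv ℝ (fderiv ℝ f) y u v := by
  have h := differentiableAt_of_contDiffOn hU (contDiffOn_fderiv hU hf) hy
  rw [fderiv_clm_apply h (differentiableAt_const v)]
  simp

lemma sndFDeriv_symm (hU : IsOpen U) (hf : ContDiffOn ℝ ∞ f U) (hy : y ∈ U)
    (u v : EuclideanSpace ℝ (Fin n)) :
    fderiv ℝ (fderiv ℝ f) y u v = fderiv ℝ (fderiv ℝ f) y v u := by
  have := (hf.contDiffAt (hU.mem_nhds hy)).isSymmSndFDerivAt (by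
    simpa using WithTop.coe_le_coe.2 (le_top : (2 : ℕ∞) ≤ ⊤))
  exact this u v

end Normed

lemma contDiffOn_sndD (hU : IsOpen U) (hG : ContDiffOn ℝ ∞ G U) (i j : Fin n) :
    ContDiffOn ℝ ∞ (fun z => sndD G z i j) U :=
  (contDiffOn_fderiv_apply hU (contDiffOn_fderiv hU hG) _).clm_apply contDiffOn_const

lemma contDiffOn_gramOf (hU : IsOpen U) (hG : ContDiffOn ℝ ∞ G U) (i j : Fin n) :
    ContDiffOn ℝ ∞ (fun z => gramOf (fderiv ℝ G z) i j) U :=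
  (contDiffOn_fderiv_apply hU hG _).inner ℝ (contDiffOn_fderiv_apply hU hG _)

lemma sndD_symm (hU : IsOpen U) (hG : ContDiffOn ℝ ∞ G U) (hy : y ∈ U) (i j : Fin n) :
    sndD G y i j = sndD G y j i := sndFDeriv_symm hU hG hy _ _

lemma fderiv_inner_apply' {V : Type*} [NormedAddCommGroup V] [InnerProductSpace ℝ V]
    {f g : EuclideanSpace ℝ (Fin n) → V} (hU : IsOpen U) (hf : ContDiffOn ℝ ∞ f U)
    (hg : ContDiffOn ℝ ∞ g U) (hy : y ∈ U) (v : EuclideanSpace ℝ (Fin n)) :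
    fderiv ℝ (fun z => inner ℝ (f z) (g z)) y v
      = inner ℝ (fderiv ℝ f y v) (g y) + inner ℝ (f y) (fderiv ℝ g y v) := by
  rw [fderiv_inner_apply ℝ (differentiableAt_of_contDiffOn hU hf hy)
    (differentiableAt_of_contDiffOn hU hg hy), add_comm]

lemma partialD_gramOf (hU : IsOpen U) (hG : ContDiffOn ℝ ∞ G U) (hy : y ∈ U) (k i j : Fin n) :
    partialD k (fun z => gramOf (fderiv ℝ G z) i j) y
      = inner ℝ (sndD G y k i) (fderiv ℝ G y (stdVec j))
        + inner ℝ (fderiv ℝ G y (stdVec i)) (sndD G y k j) := by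
  simp only [partialD, gramOf_apply]
  rw [fderiv_inner_apply' hU (contDiffOn_fderiv_apply hU hG _) (contDiffOn_fderiv_apply hU hG _) hy,
    fderiv_fderiv_apply hU hG hy, fderiv_fderiv_apply hU hG hy]
  rfl

/-- Christoffel symbols of a matrix-valued function. -/
def christoffelOf (h : EuclideanSpace ℝ (Fin n) → Matrix (Fin n) (Fin n) ℝ) (k i j : Fin n)
    (y : EuclideanSpace ℝ (Fin n)) : ℝ :=
  (1 / 2) * ∑ l, (h y)⁻¹ k l *
    (partialD i (fun z => h z j l) y + partialD j (fun z => h z i l) y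
      - partialD l (fun z => h z i j) y)

/-- Curvature coefficients of a matrix-valued function. -/
def riemannCoeffOf (h : EuclideanSpace ℝ (Fin n) → Matrix (Fin n) (Fin n) ℝ)
    (y : EuclideanSpace ℝ (Fin n)) (i j k l : Fin n) : ℝ :=
  partialD i (christoffelOf h l j k) y - partialD j (christoffelOf h l i k) y
    + ∑ m, (christoffelOf h m j k y * christoffelOf h l i m y
      - christoffelOf h m i k y * christoffelOf h l j m y)

variable {h : EuclideanSpace ℝ (Fin n) → Matrix (Fin n) (Fin n) ℝ}

lemma partialD_congr {f g : EuclideanSpace ℝ (Fin n) → ℝ} (hU : IsOpen U) (hy : y ∈ U)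
    (hfg : ∀ z ∈ U, f z = g z) (k : Fin n) : partialD k f y = partialD k g y := by
  unfold partialD
  rw [Filter.EventuallyEq.fderiv_eq (Filter.eventuallyEq_of_mem (hU.mem_nhds hy) hfg)]

/-- Each derivative of a metric coefficient is a sum of two products of a second with a first
derivative of `G`. In the Christoffel combination four of the six terms cancel and the remaining two
coincide. -/
lemma christoffelOf_eq (hU : IsOpen U) (hG : ContDiffOn ℝ ∞ G U)
    (hh : ∀ z ∈ U, h z = gramOf (fderiv ℝ G z)) (hy : y ∈ U) (k i j : Fin n) :
    christoffelOf h k i j y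
      = ∑ l, (h y)⁻¹ k l * inner ℝ (sndD G y i j) (fderiv ℝ G y (stdVec l)) := by
  unfold christoffelOf
  rw [Finset.mul_sum]
  refine Finset.sum_congr rfl fun l _ => ?_
  have e : ∀ a b c : Fin n, partialD a (fun z => h z b c) y
      = inner ℝ (sndD G y a b) (fderiv ℝ G y (stdVec c))
        + inner ℝ (fderiv ℝ G y (stdVec b)) (sndD G y a c) := fun a b c => by
    rw [← partialD_gramOf hU hG hy]
    exact partialD_congr hU hy (fun z hz => by rw [hh z hz]) a
  rw [e, e, e, sndD_symm hU hG hy j i, sndD_symm hU hG hy l i, sndD_symm hU hG hy l j,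
    real_inner_comm (fderiv ℝ G y (stdVec j)) (sndD G y i l)]
  ring

/-- With the index lowered the inverse metric disappears, so this identity can be differentiated
without differentiating an inverse matrix. -/
lemma sum_christoffelOf_mul (hU : IsOpen U) (hG : ContDiffOn ℝ ∞ G U)
    (hh : ∀ z ∈ U, h z = gramOf (fderiv ℝ G z))
    (hinj : ∀ z ∈ U, Function.Injective (fderiv ℝ G z)) (hy : y ∈ U) (i j l : Fin n) :
    ∑ k, christoffelOf h k i j y * h y k l
      = inner ℝ (sndD G y i j) (fderiv ℝ G y (stdVec l)) := by
  have hs : ∀ a b, h y a b = h y b a := fun a b => by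
    rw [hh y hy]; exact (gramOf_isSymm _).apply b a
  have hd : IsUnit (h y).det := by rw [hh y hy]; exact (gramOf_det_pos (hinj y hy)).ne'.isUnit
  simp only [christoffelOf_eq hU hG hh hy, Finset.sum_mul]
  rw [Finset.sum_comm]
  have : ∀ m k, (h y)⁻¹ k m * inner ℝ (sndD G y i j) (fderiv ℝ G y (stdVec m)) * h y k l
      = inner ℝ (sndD G y i j) (fderiv ℝ G y (stdVec m)) * (h y l k * (h y)⁻¹ k m) := fun m k => by
    rw [hs k l]; ring
  simp only [this, ← Finset.mul_sum, ← Matrix.mul_apply, Matrix.mul_nonsing_inv _ hd]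
  simp [Matrix.one_apply]

lemma contDiffOn_christoffelOf (hU : IsOpen U) (hG : ContDiffOn ℝ ∞ G U)
    (hh : ∀ z ∈ U, h z = gramOf (fderiv ℝ G z))
    (hinj : ∀ z ∈ U, Function.Injective (fderiv ℝ G z)) (k i j : Fin n) :
    ContDiffOn ℝ ∞ (christoffelOf h k i j) U := by
  have h1 : ContDiffOn ℝ ∞ (fun z => ∑ l, (gramOf (fderiv ℝ G z))⁻¹ k l *
      inner ℝ (sndD G z i j) (fderiv ℝ G z (stdVec l))) U := by
    refine ContDiffOn.sum fun l _ => ContDiffOn.mul ?_ ?_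
    · exact contDiffOn_inv (contDiffOn_gramOf hU hG)
        (fun z hz => (gramOf_det_pos (hinj z hz)).ne') _ _
    · exact (contDiffOn_sndD hU hG _ _).inner ℝ (contDiffOn_fderiv_apply hU hG _)
  refine h1.congr fun z hz => ?_
  rw [christoffelOf_eq hU hG hh hz, hh z hz]

/-- The normal part of the second derivative. -/
def normalPart (h : EuclideanSpace ℝ (Fin n) → Matrix (Fin n) (Fin n) ℝ)
    (G : EuclideanSpace ℝ (Fin n) → W) (y : EuclideanSpace ℝ (Fin n)) (i j : Fin n) : W :=
  sndD G y i j - ∑ q, christoffelOf h q i j y • fderiv ℝ G y (stdVec q)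

lemma inner_normalPart_tangent (hU : IsOpen U) (hG : ContDiffOn ℝ ∞ G U)
    (hh : ∀ z ∈ U, h z = gramOf (fderiv ℝ G z))
    (hinj : ∀ z ∈ U, Function.Injective (fderiv ℝ G z)) (hy : y ∈ U) (i j l : Fin n) :
    inner ℝ (normalPart h G y i j) (fderiv ℝ G y (stdVec l)) = 0 := by
  rw [normalPart, inner_sub_left, ← sum_christoffelOf_mul hU hG hh hinj hy, sum_inner]
  simp only [real_inner_smul_left, hh y hy, gramOf_apply, sub_self]

/-- The Gauss equation, with the normal part on one side only. -/
lemma gauss_aux (hU : IsOpen U) (hG : ContDiffOn ℝ ∞ G U)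
    (hh : ∀ z ∈ U, h z = gramOf (fderiv ℝ G z))
    (hinj : ∀ z ∈ U, Function.Injective (fderiv ℝ G z)) (hy : y ∈ U) (i j k p : Fin n) :
    ∑ l, riemannCoeffOf h y i j k l * h y l p
      = inner ℝ (normalPart h G y j k) (sndD G y i p)
        - inner ℝ (normalPart h G y i k) (sndD G y j p) := by
  -- Differentiate the lowered Christoffel identity in direction `m`. The terms containing
  -- derivatives of the metric are rewritten by the same identity and turn the second derivative of
  -- `G` into its normal part.
  have key : ∀ m i j : Fin n, ∑ l, (partialD m (christoffelOf h l i j) y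
        + ∑ q, christoffelOf h q i j y * christoffelOf h l m q y) * h y l p
      = inner ℝ (fderiv ℝ (fderiv ℝ (fderiv ℝ G)) y (stdVec m) (stdVec i) (stdVec j))
          (fderiv ℝ G y (stdVec p)) + inner ℝ (normalPart h G y i j) (sndD G y m p) := by
    intro m i j
    have hΓ := fun l : Fin n => differentiableAt_of_contDiffOn hU
      (contDiffOn_christoffelOf hU hG hh hinj l i j) hy
    have hg := fun l : Fin n => differentiableAt_of_contDiffOn hU
      (contDiffOn_gramOf hU hG l p) hy
    have e1 : partialD m (fun z => ∑ l, christoffelOf h l i j z * gramOf (fderiv ℝ G z) l p) y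
        = partialD m (fun z => inner ℝ (sndD G z i j) (fderiv ℝ G z (stdVec p))) y := by
      refine partialD_congr hU hy (fun z hz => ?_) m
      rw [← sum_christoffelOf_mul hU hG hh hinj hz, hh z hz]
    have e2 : partialD m (fun z => inner ℝ (sndD G z i j) (fderiv ℝ G z (stdVec p))) y
        = inner ℝ (fderiv ℝ (fderiv ℝ (fderiv ℝ G)) y (stdVec m) (stdVec i) (stdVec j))
          (fderiv ℝ G y (stdVec p)) + inner ℝ (sndD G y i j) (sndD G y m p) := by
      unfold partialD
      rw [fderiv_inner_apply' hU (contDiffOn_sndD hU hG i j) (contDiffOn_fderiv_apply hU hG _) hy,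
        fderiv_fderiv_apply hU hG hy]
      congr 2
      unfold sndD
      have := differentiableAt_of_contDiffOn hU
        (contDiffOn_fderiv_apply hU (contDiffOn_fderiv hU hG) (stdVec i)) hy
      rw [fderiv_clm_apply this (differentiableAt_const _)]
      simp [fderiv_fderiv_apply hU (contDiffOn_fderiv hU hG) hy]
    have e3 : partialD m (fun z => ∑ l, christoffelOf h l i j z * gramOf (fderiv ℝ G z) l p) y
        = ∑ l, (partialD m (christoffelOf h l i j) y * h y l p
          + christoffelOf h l i j y * (inner ℝ (sndD G y m l) (fderiv ℝ G y (stdVec p))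
            + inner ℝ (fderiv ℝ G y (stdVec l)) (sndD G y m p))) := by
      unfold partialD
      rw [fderiv_fun_sum fun l _ => (hΓ l).fun_mul (hg l), sum_apply]
      refine Finset.sum_congr rfl fun l _ => ?_
      rw [fderiv_fun_mul (hΓ l) (hg l)]
      have := partialD_gramOf hU hG hy m l p
      unfold partialD at this
      simp only [add_apply, smul_apply, smul_eq_mul, this, hh y hy]
      ring
    rw [e2, e3] at e1
    simp only [← sum_christoffelOf_mul hU hG hh hinj hy m _ p] at e1
    rw [normalPart, inner_sub_left, sum_inner]
    simp only [real_inner_smul_left]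
    simp only [mul_add, Finset.sum_add_distrib, Finset.mul_sum] at e1
    simp only [add_mul, Finset.sum_add_distrib, Finset.sum_mul]
    rw [Finset.sum_comm (f := fun l q => christoffelOf h q i j y * christoffelOf h l m q y *
      h y l p)]
    have e4 : ∑ q, ∑ l, christoffelOf h q i j y * christoffelOf h l m q y * h y l p
       = ∑ l, ∑ q, christoffelOf h l i j y * (christoffelOf h q m l y * h y q p) := by
      refine Finset.sum_congr rfl fun l _ => Finset.sum_congr rfl fun q _ => by ring
    rw [e4]
    linarith
  have h1 := key i j k
  have h2 := key j i k
  -- The third derivatives of `G` cancel upon antisymmetrising in `i` and `j`; only the products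
  -- with normal parts survive.
  have h3 : fderiv ℝ (fderiv ℝ (fderiv ℝ G)) y (stdVec i) (stdVec j)
      = fderiv ℝ (fderiv ℝ (fderiv ℝ G)) y (stdVec j) (stdVec i) :=
    sndFDeriv_symm hU (contDiffOn_fderiv hU hG) hy _ _
  rw [h3] at h1
  have h4 : ∑ l, riemannCoeffOf h y i j k l * h y l p
      = ∑ l, (partialD i (christoffelOf h l j k) y
        + ∑ q, christoffelOf h q j k y * christoffelOf h l i q y) * h y l p
      - ∑ l, (partialD j (christoffelOf h l i k) y
        + ∑ q, christoffelOf h q i k y * christoffelOf h l j q y) * h y l p := by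
    rw [← Finset.sum_sub_distrib]
    refine Finset.sum_congr rfl fun l _ => ?_
    rw [riemannCoeffOf, Finset.sum_sub_distrib]
    ring
  rw [h4, h1, h2]
  ring

/-- The Gauss equation. -/
lemma gauss (hU : IsOpen U) (hG : ContDiffOn ℝ ∞ G U)
    (hh : ∀ z ∈ U, h z = gramOf (fderiv ℝ G z))
    (hinj : ∀ z ∈ U, Function.Injective (fderiv ℝ G z)) (hy : y ∈ U) (i j k p : Fin n) :
    ∑ l, riemannCoeffOf h y i j k l * h y l p
      = inner ℝ (normalPart h G y j k) (normalPart h G y i p)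
        - inner ℝ (normalPart h G y i k) (normalPart h G y j p) := by
  rw [gauss_aux hU hG hh hinj hy]
  have : ∀ a b c d, inner ℝ (normalPart h G y a b) (normalPart h G y c d)
      = inner ℝ (normalPart h G y a b) (sndD G y c d) := fun a b c d => by
    conv_lhs => rw [normalPart.eq_1 h G y c d]
    rw [inner_sub_right, inner_sum]
    simp [inner_smul_right, inner_normalPart_tangent hU hG hh hinj hy]
  rw [this, this]

end LocalImmersion

/-! ### Curvature and Ricci forms expressed by the normal part of the second derivative. -/

section Contractions

variable {n : ℕ} {W : Type*} [NormedAddCommGroup W] [InnerProductSpace ℝ W]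

/-- The bilinear map with given values on the standard basis. -/
def bilin (T : Fin n → Fin n → W) (u v : EuclideanSpace ℝ (Fin n)) : W :=
  ∑ i, ∑ j, (u i * v j) • T i j

lemma inner_bilin_right (T : Fin n → Fin n → W) (u v : EuclideanSpace ℝ (Fin n)) (x : W) :
    inner ℝ x (bilin T u v) = ∑ i, ∑ j, u i * v j * inner ℝ x (T i j) := by
  simp only [bilin, inner_sum, real_inner_smul_right]

lemma inner_bilin_left (T : Fin n → Fin n → W) (u v : EuclideanSpace ℝ (Fin n)) (x : W) :
    inner ℝ (bilin T u v) x = ∑ i, ∑ j, u i * v j * inner ℝ (T i j) x := by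
  simp only [bilin, sum_inner, real_inner_smul_left]

lemma inner_bilin_bilin (T : Fin n → Fin n → W) (u v w z : EuclideanSpace ℝ (Fin n)) :
    inner ℝ (bilin T u v) (bilin T w z)
      = ∑ i, ∑ j, ∑ k, ∑ m, u i * v j * (w k * z m) * inner ℝ (T i j) (T k m) := by
  rw [inner_bilin_left]
  refine Finset.sum_congr rfl fun i _ => Finset.sum_congr rfl fun j _ => ?_
  rw [inner_bilin_right]
  simp only [Finset.mul_sum]
  refine Finset.sum_congr rfl fun k _ => Finset.sum_congr rfl fun m _ => ?_
  ring

lemma bilin_clm (L : EuclideanSpace ℝ (Fin n) →L[ℝ] EuclideanSpace ℝ (Fin n) →L[ℝ] W)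
    (u v : EuclideanSpace ℝ (Fin n)) :
    bilin (fun i j => L (stdVec i) (stdVec j)) u v = L u v := by
  conv_rhs => rw [← sum_smul_stdVec u, ← sum_smul_stdVec v]
  simp only [bilin, map_sum, map_smul, sum_apply, smul_apply, Finset.smul_sum, smul_smul]
  rw [Finset.sum_comm]
  exact Finset.sum_congr rfl fun i _ => Finset.sum_congr rfl fun j _ => by rw [mul_comm]

variable {G : EuclideanSpace ℝ (Fin n) → W} {U : Set (EuclideanSpace ℝ (Fin n))}
  {y : EuclideanSpace ℝ (Fin n)} {h : EuclideanSpace ℝ (Fin n) → Matrix (Fin n) (Fin n) ℝ}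

/-- The curvature form with the coefficients `riemannCoeffOf h y`. -/
def riemannOf (h : EuclideanSpace ℝ (Fin n) → Matrix (Fin n) (Fin n) ℝ)
    (y u v w z : EuclideanSpace ℝ (Fin n)) : ℝ :=
  ∑ i, ∑ j, ∑ k, ∑ l, ∑ m, u i * v j * w k * z m * riemannCoeffOf h y i j k l * h y l m

/-- The Ricci form with the coefficients `riemannCoeffOf h y`. -/
def ricciOf (h : EuclideanSpace ℝ (Fin n) → Matrix (Fin n) (Fin n) ℝ)
    (y v w : EuclideanSpace ℝ (Fin n)) : ℝ :=
  ∑ j, ∑ k, v j * w k * ∑ i, riemannCoeffOf h y i j k i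

lemma riemannOf_eq (hU : IsOpen U) (hG : ContDiffOn ℝ ∞ G U)
    (hh : ∀ z ∈ U, h z = gramOf (fderiv ℝ G z))
    (hinj : ∀ z ∈ U, Function.Injective (fderiv ℝ G z)) (hy : y ∈ U)
    (u v w z : EuclideanSpace ℝ (Fin n)) :
    riemannOf h y u v w z
      = inner ℝ (bilin (normalPart h G y) v w) (bilin (normalPart h G y) u z)
        - inner ℝ (bilin (normalPart h G y) u w) (bilin (normalPart h G y) v z) := by
  have e1 : riemannOf h y u v w z = ∑ i, ∑ j, ∑ k, ∑ m, u i * v j * w k * z m *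
      (inner ℝ (normalPart h G y j k) (normalPart h G y i m)
        - inner ℝ (normalPart h G y i k) (normalPart h G y j m)) := by
    unfold riemannOf
    refine Finset.sum_congr rfl fun i _ => Finset.sum_congr rfl fun j _ =>
      Finset.sum_congr rfl fun k _ => ?_
    rw [Finset.sum_comm]
    refine Finset.sum_congr rfl fun m _ => ?_
    rw [← gauss hU hG hh hinj hy, Finset.mul_sum]
    exact Finset.sum_congr rfl fun l _ => by ring
  rw [e1, inner_bilin_bilin, inner_bilin_bilin]
  generalize normalPart h G y = T
  simp only [mul_sub, Finset.sum_sub_distrib]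
  refine congrArg₂ (· - ·) ?_ ?_
  · calc ∑ i, ∑ j, ∑ k, ∑ m, u i * v j * w k * z m *
          inner ℝ (T j k) (T i m)
        = ∑ j, ∑ i, ∑ k, ∑ m, u i * v j * w k * z m *
          inner ℝ (T j k) (T i m) := Finset.sum_comm
      _ = ∑ j, ∑ k, ∑ i, ∑ m, u i * v j * w k * z m *
          inner ℝ (T j k) (T i m) :=
        Finset.sum_congr rfl fun j _ => Finset.sum_comm
      _ = _ := Finset.sum_congr rfl fun j _ => Finset.sum_congr rfl fun k _ =>
        Finset.sum_congr rfl fun i _ => Finset.sum_congr rfl fun m _ => by ring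
  · calc ∑ i, ∑ j, ∑ k, ∑ m, u i * v j * w k * z m *
          inner ℝ (T i k) (T j m)
        = ∑ i, ∑ k, ∑ j, ∑ m, u i * v j * w k * z m *
          inner ℝ (T i k) (T j m) :=
        Finset.sum_congr rfl fun j _ => Finset.sum_comm
      _ = _ := Finset.sum_congr rfl fun j _ => Finset.sum_congr rfl fun k _ =>
        Finset.sum_congr rfl fun i _ => Finset.sum_congr rfl fun m _ => by ring

/-- The matrix whose columns are the vectors of a frame. -/
def frameMatrix (e : Fin n → EuclideanSpace ℝ (Fin n)) : Matrix (Fin n) (Fin n) ℝ :=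
  Matrix.of fun i a => e a i

lemma frameMatrix_conj (e : Fin n → EuclideanSpace ℝ (Fin n)) (T : Matrix (Fin n) (Fin n) ℝ)
    (a b : Fin n) : ((frameMatrix e).transpose * T * frameMatrix e) a b
      = ∑ i, ∑ j, e a i * e b j * T i j := by
  simp only [Matrix.mul_apply, Matrix.transpose_apply, frameMatrix, Matrix.of_apply,
    Finset.sum_mul]
  rw [Finset.sum_comm]
  exact Finset.sum_congr rfl fun i _ => Finset.sum_congr rfl fun j _ => by ring

lemma frameMatrix_isUnit {e : Fin n → EuclideanSpace ℝ (Fin n)} {T : Matrix (Fin n) (Fin n) ℝ}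
    (he : (frameMatrix e).transpose * T * frameMatrix e = 1) : IsUnit (frameMatrix e).det := by
  have := congrArg Matrix.det he
  rw [Matrix.det_mul, Matrix.det_one] at this
  exact IsUnit.of_mul_eq_one_right _ this

lemma frameMatrix_inv {e : Fin n → EuclideanSpace ℝ (Fin n)} {T : Matrix (Fin n) (Fin n) ℝ}
    (he : (frameMatrix e).transpose * T * frameMatrix e = 1) :
    T * (frameMatrix e * (frameMatrix e).transpose) = 1 := by
  have h1 : frameMatrix e * ((frameMatrix e).transpose * T) = 1 := mul_eq_one_comm.1 he
  rw [← Matrix.mul_assoc] at h1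
  exact mul_eq_one_comm.1 h1

/-- For an orthonormal frame with matrix `E`, `E Eᵀ` is the inverse metric. Inserting `h · E Eᵀ = 1`
into the coordinate trace turns it into a sum over the frame. -/
lemma ricciOf_eq {e : Fin n → EuclideanSpace ℝ (Fin n)}
    (he : (frameMatrix e).transpose * h y * frameMatrix e = 1)
    (v w : EuclideanSpace ℝ (Fin n)) :
    ricciOf h y v w = ∑ a, riemannOf h y (e a) v w (e a) := by
  have e1 : ∀ l i, ∑ m, h y l m * ∑ a, e a m * e a i = if l = i then 1 else 0 := fun l i => by
    have := congrFun (congrFun (frameMatrix_inv he) l) i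
    rw [Matrix.mul_apply] at this
    simpa only [Matrix.mul_apply, Matrix.transpose_apply, frameMatrix, Matrix.of_apply,
      Matrix.one_apply] using this
  have e2 : ∀ i j k, riemannCoeffOf h y i j k i
      = ∑ a, ∑ l, ∑ m, e a i * e a m * riemannCoeffOf h y i j k l * h y l m := fun i j k => by
    calc riemannCoeffOf h y i j k i
        = ∑ l, riemannCoeffOf h y i j k l * ∑ m, h y l m * ∑ a, e a m * e a i := by simp [e1]
      _ = ∑ l, ∑ m, ∑ a, e a i * e a m * riemannCoeffOf h y i j k l * h y l m := by
        simp only [Finset.mul_sum]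
        exact Finset.sum_congr rfl fun i _ => Finset.sum_congr rfl fun j _ =>
          Finset.sum_congr rfl fun k _ => by ring
      _ = ∑ l, ∑ a, ∑ m, e a i * e a m * riemannCoeffOf h y i j k l * h y l m :=
        Finset.sum_congr rfl fun i _ => Finset.sum_comm
      _ = _ := Finset.sum_comm
  unfold ricciOf riemannOf
  simp only [e2, Finset.mul_sum]
  calc ∑ j, ∑ k, ∑ i, ∑ a, ∑ l, ∑ m,
        v j * w k * (e a i * e a m * riemannCoeffOf h y i j k l * h y l m)
      = ∑ j, ∑ k, ∑ a, ∑ i, ∑ l, ∑ m,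
        v j * w k * (e a i * e a m * riemannCoeffOf h y i j k l * h y l m) :=
        Finset.sum_congr rfl fun j _ => Finset.sum_congr rfl fun k _ => Finset.sum_comm
    _ = ∑ j, ∑ a, ∑ k, ∑ i, ∑ l, ∑ m,
        v j * w k * (e a i * e a m * riemannCoeffOf h y i j k l * h y l m) :=
        Finset.sum_congr rfl fun j _ => Finset.sum_comm
    _ = ∑ a, ∑ j, ∑ k, ∑ i, ∑ l, ∑ m,
        v j * w k * (e a i * e a m * riemannCoeffOf h y i j k l * h y l m) := Finset.sum_comm
    _ = ∑ a, ∑ j, ∑ i, ∑ k, ∑ l, ∑ m,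
        v j * w k * (e a i * e a m * riemannCoeffOf h y i j k l * h y l m) :=
        Finset.sum_congr rfl fun a _ => Finset.sum_congr rfl fun j _ => Finset.sum_comm
    _ = ∑ a, ∑ i, ∑ j, ∑ k, ∑ l, ∑ m,
        v j * w k * (e a i * e a m * riemannCoeffOf h y i j k l * h y l m) :=
        Finset.sum_congr rfl fun a _ => Finset.sum_comm
    _ = _ := Finset.sum_congr rfl fun a _ => Finset.sum_congr rfl fun i _ =>
        Finset.sum_congr rfl fun j _ => Finset.sum_congr rfl fun k _ =>
        Finset.sum_congr rfl fun l _ => Finset.sum_congr rfl fun m _ => by ring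

lemma inner_bilin_normalPart_tangent (hU : IsOpen U) (hG : ContDiffOn ℝ ∞ G U)
    (hh : ∀ z ∈ U, h z = gramOf (fderiv ℝ G z))
    (hinj : ∀ z ∈ U, Function.Injective (fderiv ℝ G z)) (hy : y ∈ U)
    (u v w : EuclideanSpace ℝ (Fin n)) :
    inner ℝ (bilin (normalPart h G y) u v) (fderiv ℝ G y w) = 0 := by
  rw [inner_bilin_left]
  refine Finset.sum_eq_zero fun i _ => Finset.sum_eq_zero fun j _ => ?_
  rw [← sum_smul_stdVec w, map_sum, inner_sum]
  simp [real_inner_smul_right, inner_normalPart_tangent hU hG hh hinj hy]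

/-- The Christoffel correction is tangential, hence invisible to a normal vector. -/
lemma inner_bilin_normalPart_normal {N : W}
    (hN : ∀ v, inner ℝ (fderiv ℝ G y v) N = 0) (u v : EuclideanSpace ℝ (Fin n)) :
    inner ℝ (bilin (normalPart h G y) u v) N = inner ℝ (fderiv ℝ (fderiv ℝ G) y u v) N := by
  rw [inner_bilin_left, ← bilin_clm (fderiv ℝ (fderiv ℝ G) y) u v, inner_bilin_left]
  refine Finset.sum_congr rfl fun i _ => Finset.sum_congr rfl fun j _ => ?_
  rw [normalPart, inner_sub_left, sum_inner]
  simp [real_inner_smul_left, hN, sndD]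

/-- The second derivative against a normal field. -/
lemma inner_sndFDeriv_normal {N : EuclideanSpace ℝ (Fin n) → W} (hU : IsOpen U)
    (hG : ContDiffOn ℝ ∞ G U) (hN : ContDiffOn ℝ ∞ N U) (hy : y ∈ U)
    (hGN : ∀ z ∈ U, ∀ v, inner ℝ (fderiv ℝ G z v) (N z) = 0) (u v : EuclideanSpace ℝ (Fin n)) :
    inner ℝ (fderiv ℝ (fderiv ℝ G) y u v) (N y) = -inner ℝ (fderiv ℝ G y v) (fderiv ℝ N y u) := by
  have h1 := fderiv_inner_apply' hU (contDiffOn_fderiv_apply hU hG v) hN hy u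
  have h2 : fderiv ℝ (fun z => inner ℝ (fderiv ℝ G z v) (N z)) y u = 0 := by
    rw [Filter.EventuallyEq.fderiv_eq (f := fun _ => (0 : ℝ))
      (Filter.eventuallyEq_of_mem (hU.mem_nhds hy) fun z hz => hGN z hz v)]
    simp
  rw [h2, fderiv_fderiv_apply hU hG hy] at h1
  linarith

end Contractions

/-! ### Orthonormal frames and Parseval's identity. -/

section Frames

variable {n : ℕ} {W : Type*} [NormedAddCommGroup W] [InnerProductSpace ℝ W]

/-- A partial orthonormal frame for the pullback of the inner product extends to a full one. -/
lemma exists_frame_extension {D : EuclideanSpace ℝ (Fin n) →L[ℝ] W} (hD : Function.Injective D)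
    (s : Set (Fin n)) (f : Fin n → EuclideanSpace ℝ (Fin n))
    (hf : ∀ a ∈ s, ∀ b ∈ s, inner ℝ (D (f a)) (D (f b)) = if a = b then (1 : ℝ) else 0) :
    ∃ e : Fin n → EuclideanSpace ℝ (Fin n), (∀ a ∈ s, e a = f a) ∧
      Orthonormal ℝ (fun a => D (e a)) := by
  let R := LinearMap.range (D : EuclideanSpace ℝ (Fin n) →ₗ[ℝ] W)
  have hfin : Module.finrank ℝ R = Fintype.card (Fin n) := by
    rw [LinearMap.finrank_range_of_inj (f := (D : EuclideanSpace ℝ (Fin n) →ₗ[ℝ] W)) hD]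
    simp
  let c : Fin n → R := fun a => ⟨D (f a), LinearMap.mem_range_self _ (f a)⟩
  have hc : Orthonormal ℝ (s.domRestrict c) := by
    rw [orthonormal_iff_ite]
    rintro ⟨a, ha⟩ ⟨b, hb⟩
    simpa [c, Set.domRestrict] using hf a ha b hb
  obtain ⟨b, hb⟩ := hc.exists_orthonormalBasis_extension_of_card_eq hfin
  choose e he using fun a => LinearMap.mem_range.1 (b a).2
  refine ⟨e, fun a ha => hD ?_, ?_⟩
  · have := he a
    rw [hb a ha] at this
    exact this
  · have : (fun a => D (e a)) = fun a => ((b a : R) : W) := funext he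
    rw [this]
    exact b.orthonormal.comp_linearIsometry R.subtypeₗᵢ

/-- Parseval's identity for an orthonormal family of full size. -/
lemma parseval {ι : Type*} [Fintype ι] {b : ι → W} (hb : Orthonormal ℝ b) [FiniteDimensional ℝ W]
    (hcard : Fintype.card ι = Module.finrank ℝ W) (x z : W) :
    inner ℝ x z = ∑ i, inner ℝ x (b i) * inner ℝ z (b i) := by
  have hs : ⊤ ≤ Submodule.span ℝ (Set.range b) := by
    rw [hb.linearIndependent.span_eq_top_of_card_eq_finrank' hcard]
  have := (OrthonormalBasis.mk hb hs).sum_inner_mul_inner x z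
  rw [← this]
  refine Finset.sum_congr rfl fun i _ => ?_
  simp [real_inner_comm]

/-- Four tangent vectors together with two normal ones. -/
lemma orthonormal_sum {κ ι : Type*} {t : κ → W} {N : ι → W} (ht : Orthonormal ℝ t)
    (hN : Orthonormal ℝ N) (htN : ∀ a i, inner ℝ (t a) (N i) = 0) :
    Orthonormal ℝ (Sum.elim t N) := by
  classical
  rw [orthonormal_iff_ite] at *
  rintro (a | a) (b | b)
  · simp [ht]
  · simp [htN]
  · simp [real_inner_comm, htN]
  · simp [hN]

end Frames

/-- The algebraic estimate behind the bound on the bi-Ricci curvature. -/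
lemma biRic_algebra (α : Fin 4 → Fin 4 → ℝ) (ρ : Fin 4 → ℝ) (σ : ℝ)
    (hα : ∀ a b, α a b = α b a) (htr : ∑ a, α a a = 0) (hρ : ∑ a, ρ a ^ 2 + σ ^ 2 = 1)
    (β₁ β₂ : Fin 4 → Fin 4 → ℝ)
    (h₁ : ∀ a b, β₁ a b = -((if a = b then 1 else 0) - ρ a * ρ b))
    (h₂ : ∀ a b, β₂ a b = -(α a b - σ * (if a = b then 1 else 0))) :
    2 + 3 * σ ^ 2 - ∑ a, ∑ b, α a b ^ 2 ≤
      ∑ a, ((β₁ 0 0 * β₁ a a + β₂ 0 0 * β₂ a a) - (β₁ a 0 * β₁ 0 a + β₂ a 0 * β₂ 0 a))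
      + ∑ a, ((β₁ 1 1 * β₁ a a + β₂ 1 1 * β₂ a a) - (β₁ a 1 * β₁ 1 a + β₂ a 1 * β₂ 1 a))
      - ((β₁ 1 1 * β₁ 0 0 + β₂ 1 1 * β₂ 0 0) - (β₁ 0 1 * β₁ 1 0 + β₂ 0 1 * β₂ 1 0)) := by
  simp only [h₁, h₂, Fin.sum_univ_four] at *
  simp only [hα 1 0, hα 2 0, hα 3 0, hα 2 1, hα 3 1, hα 3 2]
  simp
  have h33 : α 3 3 = -(α 0 0 + α 1 1 + α 2 2) := by linarith
  rw [h33]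
  have hr : ρ 0 ^ 2 = 1 - σ ^ 2 - ρ 1 ^ 2 - ρ 2 ^ 2 - ρ 3 ^ 2 := by linarith
  -- BiRic sums the sectional curvatures of all coordinate planes except (2,3). The `β₁` part is `3
  -- + 2σ² - ρ₀² - ρ₁²`, and `ρ₀² + ρ₁² ≤ 1 - σ²` makes it at least `2 + 3σ²`. With `s = α₀₀ + α₁₁`,
  -- the `β₂` part plus `|α|²` is at least `(s - 2σ)²/4 + 4σ² + (α₂₂ - α₃₃)²/2 ≥ 0`, where `α₂₂ -
  -- α₃₃ = s + 2α₂₂`.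
  nlinarith [sq_nonneg (α 0 0 + α 1 1 - 2 * σ), sq_nonneg σ, sq_nonneg (α 0 0 - α 1 1),
    sq_nonneg (α 0 0 + α 1 1 + 2 * α 2 2), sq_nonneg (α 0 2), sq_nonneg (α 0 3),
    sq_nonneg (α 1 2), sq_nonneg (α 1 3), sq_nonneg (α 2 3), sq_nonneg (α 0 1),
    sq_nonneg (ρ 2), sq_nonneg (ρ 3)]

/-! ### Polar coordinates as a conformal map to the cylinder over the sphere. -/

section Cylinder

variable {W : Type*} [NormedAddCommGroup W] [InnerProductSpace ℝ W]

lemma hasFDerivAt_toLp {E V : Type*} [NormedAddCommGroup E] [NormedSpace ℝ E]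
    [NormedAddCommGroup V] [NormedSpace ℝ V] {f : E → V} {g : E → ℝ} {f' : E →L[ℝ] V}
    {g' : E →L[ℝ] ℝ} {y : E} (hf : HasFDerivAt f f' y) (hg : HasFDerivAt g g' y) :
    HasFDerivAt (fun z => WithLp.toLp 2 (f z, g z))
      ((WithLp.prodContinuousLinearEquiv 2 ℝ V ℝ).symm.toContinuousLinearMap ∘L (f'.prod g')) y :=
  ((WithLp.prodContinuousLinearEquiv 2 ℝ V ℝ).symm.toContinuousLinearMap.hasFDerivAt).comp y
    (hf.prodMk hg)

lemma contDiffOn_toLp {E V : Type*} [NormedAddCommGroup E] [NormedSpace ℝ E]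
    [NormedAddCommGroup V] [NormedSpace ℝ V] {f : E → V} {g : E → ℝ} {s : Set E}
    (hf : ContDiffOn ℝ ∞ f s) (hg : ContDiffOn ℝ ∞ g s) :
    ContDiffOn ℝ ∞ (fun z => WithLp.toLp 2 (f z, g z)) s :=
  (WithLp.prodContinuousLinearEquiv 2 ℝ V ℝ).symm.contDiff.comp_contDiffOn (hf.prodMk hg)

lemma inner_toLp (a b : W) (s t : ℝ) :
    inner ℝ (WithLp.toLp 2 (a, s)) (WithLp.toLp 2 (b, t)) = inner ℝ a b + s * t := by
  rw [WithLp.prod_inner_apply]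
  simp [mul_comm]

/-- The radial projection to the unit sphere. -/
def radial (w : W) : W := ‖w‖⁻¹ • w

/-- The map `w ↦ (w / |w|, log |w|)` to the cylinder over the unit sphere. -/
def cylinderMap (w : W) : WithLp 2 (W × ℝ) := WithLp.toLp 2 (radial w, Real.log ‖w‖)

lemma hasFDerivAt_norm {w : W} (hw : w ≠ 0) :
    HasFDerivAt (fun w : W => ‖w‖) (‖w‖⁻¹ • innerSL ℝ w) w := by
  have h1 : HasFDerivAt (fun w : W => ‖w‖ ^ 2) (2 • innerSL ℝ w) w :=
    (hasStrictFDerivAt_norm_sq w).hasFDerivAt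
  have h2 := h1.sqrt (by positivity)
  simp only [Real.sqrt_sq (norm_nonneg _)] at h2
  convert h2 using 1
  ext v
  simp only [smul_apply, innerSL_apply_apply, smul_eq_mul, nsmul_eq_mul]
  have : ‖w‖ ≠ 0 := norm_ne_zero_iff.2 hw
  push_cast
  field_simp

lemma hasFDerivAt_radial {w : W} (hw : w ≠ 0) :
    HasFDerivAt (radial : W → W) (‖w‖⁻¹ • ContinuousLinearMap.id ℝ W
      - (innerSL ℝ w).smulRight ((‖w‖ ^ 3)⁻¹ • w)) w := by
  have hn : ‖w‖ ≠ 0 := norm_ne_zero_iff.2 hw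
  have h1 := (hasDerivAt_inv hn).comp_hasFDerivAt w (hasFDerivAt_norm hw)
  have h2 := h1.smul (hasFDerivAt_id w)
  refine h2.congr_fderiv ?_
  ext v
  simp only [add_apply, smul_apply, neg_apply, ContinuousLinearMap.smulRight_apply,
    innerSL_apply_apply, ContinuousLinearMap.id_apply, smul_eq_mul, id, sub_eq_add_neg, ← neg_smul,
    smul_smul]
  congr 2
  field_simp

lemma fderiv_radial {w : W} (hw : w ≠ 0) (a : W) :
    fderiv ℝ (radial : W → W) w a = ‖w‖⁻¹ • a - ((‖w‖ ^ 3)⁻¹ * inner ℝ w a) • w := by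
  rw [(hasFDerivAt_radial hw).fderiv]
  simp [smul_smul, mul_comm]

lemma hasFDerivAt_log_norm {w : W} (hw : w ≠ 0) :
    HasFDerivAt (fun w : W => Real.log ‖w‖) ((‖w‖ ^ 2)⁻¹ • innerSL ℝ w) w := by
  have hn : ‖w‖ ≠ 0 := norm_ne_zero_iff.2 hw
  have h1 := (hasFDerivAt_norm hw).log hn
  refine h1.congr_fderiv ?_
  rw [smul_smul]
  congr 1
  field_simp

lemma hasFDerivAt_cylinderMap {w : W} (hw : w ≠ 0) :
    HasFDerivAt (cylinderMap : W → WithLp 2 (W × ℝ)) (fderiv ℝ (cylinderMap : W → _) w) w :=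
  (hasFDerivAt_toLp (hasFDerivAt_radial hw)
    (hasFDerivAt_log_norm hw)).differentiableAt.hasFDerivAt

lemma fderiv_cylinderMap {w : W} (hw : w ≠ 0) (a : W) :
    fderiv ℝ (cylinderMap : W → WithLp 2 (W × ℝ)) w a
      = WithLp.toLp 2 (fderiv ℝ (radial : W → W) w a, (‖w‖ ^ 2)⁻¹ * inner ℝ w a) := by
  have h1 := hasFDerivAt_toLp (hasFDerivAt_radial hw) (hasFDerivAt_log_norm hw)
  have h2 : fderiv ℝ (cylinderMap : W → WithLp 2 (W × ℝ)) w = _ := h1.fderiv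
  rw [h2, (hasFDerivAt_radial hw).fderiv]
  simp

lemma inner_radial_fderiv_radial {w : W} (hw : w ≠ 0) (a : W) :
    inner ℝ (fderiv ℝ (radial : W → W) w a) (radial w) = 0 := by
  have hn : ‖w‖ ≠ 0 := norm_ne_zero_iff.2 hw
  rw [fderiv_radial hw, radial, inner_sub_left]
  simp only [real_inner_smul_left, real_inner_smul_right, real_inner_self_eq_norm_sq,
    real_inner_comm w a]
  field_simp
  ring

lemma inner_fderiv_radial {w : W} (hw : w ≠ 0) (a b : W) :
    inner ℝ (fderiv ℝ (radial : W → W) w a) (fderiv ℝ (radial : W → W) w b)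
      = (‖w‖ ^ 2)⁻¹ * inner ℝ a b
        - ((‖w‖ ^ 2)⁻¹ * inner ℝ w a) * ((‖w‖ ^ 2)⁻¹ * inner ℝ w b) := by
  have hn : ‖w‖ ≠ 0 := norm_ne_zero_iff.2 hw
  rw [fderiv_radial hw, fderiv_radial hw, inner_sub_left, inner_sub_right, inner_sub_right]
  simp only [real_inner_smul_left, real_inner_smul_right, real_inner_self_eq_norm_sq,
    real_inner_comm w a]
  field_simp
  ring

/-- The radial projection contributes the sphere metric, which lacks exactly the square of `d log
r`; the logarithmic coordinate supplies it. -/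
lemma inner_fderiv_cylinderMap {w : W} (hw : w ≠ 0) (a b : W) :
    inner ℝ (fderiv ℝ (cylinderMap : W → WithLp 2 (W × ℝ)) w a)
      (fderiv ℝ (cylinderMap : W → WithLp 2 (W × ℝ)) w b) = (‖w‖ ^ 2)⁻¹ * inner ℝ a b := by
  rw [fderiv_cylinderMap hw, fderiv_cylinderMap hw, inner_toLp, inner_fderiv_radial hw]
  ring

lemma fderiv_cylinderMap_injective {w : W} (hw : w ≠ 0) :
    Function.Injective (fderiv ℝ (cylinderMap : W → WithLp 2 (W × ℝ)) w) := by
  rw [injective_iff_map_eq_zero]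
  intro a ha
  have h1 := inner_fderiv_cylinderMap hw a a
  rw [ha, inner_zero_left, real_inner_self_eq_norm_sq] at h1
  have hn : ‖w‖ ≠ 0 := norm_ne_zero_iff.2 hw
  have : ‖a‖ ^ 2 = 0 := by
    rcases mul_eq_zero.1 h1.symm with h | h
    · exact absurd h (by positivity)
    · exact h
  simpa using this

lemma contDiffOn_radial : ContDiffOn ℝ ∞ (radial : W → W) {w | w ≠ 0} := by
  intro w hw
  exact (((contDiffAt_norm ℝ hw).inv (norm_ne_zero_iff.2 hw)).smul contDiffAt_id).contDiffWithinAt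

lemma contDiffOn_cylinderMap :
    ContDiffOn ℝ ∞ (cylinderMap : W → WithLp 2 (W × ℝ)) {w | w ≠ 0} := by
  refine contDiffOn_toLp contDiffOn_radial fun w hw => ?_
  exact ((contDiffAt_norm ℝ hw).log (norm_ne_zero_iff.2 hw)).contDiffWithinAt

end Cylinder

/-! ### The two second fundamental forms of the cylinder immersion. -/

section ConformalCurvature

variable {n : ℕ} {W : Type*} [NormedAddCommGroup W] [InnerProductSpace ℝ W]

lemma sum_inner_clm (D D' : EuclideanSpace ℝ (Fin n) →L[ℝ] W) (v w : EuclideanSpace ℝ (Fin n)) :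
    ∑ i, ∑ j, v i * w j * inner ℝ (D (stdVec i)) (D' (stdVec j)) = inner ℝ (D v) (D' w) := by
  conv_rhs => rw [← sum_smul_stdVec v, ← sum_smul_stdVec w]
  simp only [map_sum, map_smul, sum_inner, real_inner_smul_left]
  simp only [inner_sum, real_inner_smul_right, Finset.mul_sum]
  refine Finset.sum_congr rfl fun i _ => Finset.sum_congr rfl fun j _ => ?_
  ring

variable {G ν : EuclideanSpace ℝ (Fin n) → W} {U : Set (EuclideanSpace ℝ (Fin n))}
  {y : EuclideanSpace ℝ (Fin n)}

lemma fderiv_comp_of_contDiffOn {V₁ V₂ : Type*} [NormedAddCommGroup V₁] [NormedSpace ℝ V₁]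
    [NormedAddCommGroup V₂] [NormedSpace ℝ V₂] {f : EuclideanSpace ℝ (Fin n) → V₁} {c : V₁ → V₂}
    (hU : IsOpen U) (hf : ContDiffOn ℝ ∞ f U) (hy : y ∈ U) (hc : DifferentiableAt ℝ c (f y))
    (v : EuclideanSpace ℝ (Fin n)) :
    fderiv ℝ (fun z => c (f z)) y v = fderiv ℝ c (f y) (fderiv ℝ f y v) := by
  rw [fderiv_fun_comp y hc (differentiableAt_of_contDiffOn hU hf hy)]
  rfl

/-- The second unit normal of the cylinder immersion, besides the radial direction. -/
def cylinderNormal (G ν : EuclideanSpace ℝ (Fin n) → W) (z : EuclideanSpace ℝ (Fin n)) :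
    WithLp 2 (W × ℝ) :=
  WithLp.toLp 2 (ν z - inner ℝ (radial (G z)) (ν z) • radial (G z), inner ℝ (radial (G z)) (ν z))

lemma norm_radial {w : W} (hw : w ≠ 0) : ‖radial w‖ = 1 := by
  rw [radial, norm_smul, norm_inv, norm_norm, inv_mul_cancel₀ (norm_ne_zero_iff.2 hw)]

lemma contDiffOn_radial_comp
    (hG : ContDiffOn ℝ ∞ G U) (h0 : ∀ z ∈ U, G z ≠ 0) : ContDiffOn ℝ ∞ (fun z => radial (G z)) U :=
  contDiffOn_radial.comp hG h0

lemma contDiffOn_cylinderMap_comp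
    (hG : ContDiffOn ℝ ∞ G U) (h0 : ∀ z ∈ U, G z ≠ 0) : ContDiffOn ℝ ∞ (fun z => cylinderMap (G z)) U :=
  contDiffOn_cylinderMap.comp hG h0

lemma fderiv_cylinderMap_comp
    (hU : IsOpen U) (hG : ContDiffOn ℝ ∞ G U) (h0 : ∀ z ∈ U, G z ≠ 0)
    (hy : y ∈ U) (v : EuclideanSpace ℝ (Fin n)) :
    fderiv ℝ (fun z => cylinderMap (G z)) y v
      = WithLp.toLp 2 (fderiv ℝ (fun z => radial (G z)) y v,
          (‖G y‖ ^ 2)⁻¹ * inner ℝ (G y) (fderiv ℝ G y v)) := by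
  rw [fderiv_comp_of_contDiffOn hU hG hy (hasFDerivAt_cylinderMap (h0 y hy)).differentiableAt,
    fderiv_comp_of_contDiffOn hU hG hy (hasFDerivAt_radial (h0 y hy)).differentiableAt,
    fderiv_cylinderMap (h0 y hy)]

lemma contDiffOn_cylinderNormal
    (hG : ContDiffOn ℝ ∞ G U) (h0 : ∀ z ∈ U, G z ≠ 0) (hν : ContDiffOn ℝ ∞ ν U) :
    ContDiffOn ℝ ∞ (cylinderNormal G ν) U := by
  have h1 := contDiffOn_radial_comp hG h0
  exact contDiffOn_toLp (hν.sub ((h1.inner ℝ hν).smul h1)) (h1.inner ℝ hν)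

lemma inner_fderiv_radial_normal
    (hU : IsOpen U) (hG : ContDiffOn ℝ ∞ G U) (h0 : ∀ z ∈ U, G z ≠ 0)
    (hGν : ∀ z ∈ U, ∀ v, inner ℝ (fderiv ℝ G z v) (ν z) = 0)
    (hy : y ∈ U) (v : EuclideanSpace ℝ (Fin n)) :
    inner ℝ (fderiv ℝ (fun z => radial (G z)) y v) (ν y)
      = -((‖G y‖ ^ 2)⁻¹ * inner ℝ (G y) (fderiv ℝ G y v)) * inner ℝ (radial (G y)) (ν y) := by
  have hn : ‖G y‖ ≠ 0 := norm_ne_zero_iff.2 (h0 y hy)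
  rw [fderiv_comp_of_contDiffOn hU hG hy (hasFDerivAt_radial (h0 y hy)).differentiableAt,
    fderiv_radial (h0 y hy), inner_sub_left, real_inner_smul_left, real_inner_smul_left,
    hGν y hy, radial, real_inner_smul_left]
  field_simp
  ring

lemma inner_fderiv_radial_radial
    (hU : IsOpen U) (hG : ContDiffOn ℝ ∞ G U) (h0 : ∀ z ∈ U, G z ≠ 0)
    (hy : y ∈ U) (v : EuclideanSpace ℝ (Fin n)) :
    inner ℝ (fderiv ℝ (fun z => radial (G z)) y v) (radial (G y)) = 0 := by
  rw [fderiv_comp_of_contDiffOn hU hG hy (hasFDerivAt_radial (h0 y hy)).differentiableAt,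
    inner_radial_fderiv_radial (h0 y hy)]

/-- `cylinderNormal` is `r` times the image of `ν` under the differential of the cylinder map. That
map is conformal, so orthogonality to the hypersurface is preserved. -/
lemma inner_fderiv_cylinderMap_normal
    (hU : IsOpen U) (hG : ContDiffOn ℝ ∞ G U) (h0 : ∀ z ∈ U, G z ≠ 0)
    (hGν : ∀ z ∈ U, ∀ v, inner ℝ (fderiv ℝ G z v) (ν z) = 0)
    (hy : y ∈ U) (v : EuclideanSpace ℝ (Fin n)) :
    inner ℝ (fderiv ℝ (fun z => cylinderMap (G z)) y v) (cylinderNormal G ν y) = 0 := by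
  rw [fderiv_cylinderMap_comp hU hG h0 hy, cylinderNormal, inner_toLp, inner_sub_right,
    real_inner_smul_right, inner_fderiv_radial_radial hU hG h0 hy,
    inner_fderiv_radial_normal hU hG h0 hGν hy]
  ring

lemma inner_fderiv_cylinderMap_radial
    (hU : IsOpen U) (hG : ContDiffOn ℝ ∞ G U) (h0 : ∀ z ∈ U, G z ≠ 0)
    (hy : y ∈ U) (v : EuclideanSpace ℝ (Fin n)) :
    inner ℝ (fderiv ℝ (fun z => cylinderMap (G z)) y v)
      (WithLp.toLp 2 (radial (G y), (0 : ℝ))) = 0 := by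
  rw [fderiv_cylinderMap_comp hU hG h0 hy, inner_toLp, inner_fderiv_radial_radial hU hG h0 hy]
  ring

lemma inner_fderiv_cylinderMap_comp
    (hU : IsOpen U) (hG : ContDiffOn ℝ ∞ G U) (h0 : ∀ z ∈ U, G z ≠ 0)
    (hy : y ∈ U) (u v : EuclideanSpace ℝ (Fin n)) :
    inner ℝ (fderiv ℝ (fun z => cylinderMap (G z)) y u)
      (fderiv ℝ (fun z => cylinderMap (G z)) y v)
      = (‖G y‖ ^ 2)⁻¹ * inner ℝ (fderiv ℝ G y u) (fderiv ℝ G y v) := by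
  rw [fderiv_comp_of_contDiffOn hU hG hy (hasFDerivAt_cylinderMap (h0 y hy)).differentiableAt,
    fderiv_comp_of_contDiffOn hU hG hy (hasFDerivAt_cylinderMap (h0 y hy)).differentiableAt,
    inner_fderiv_cylinderMap (h0 y hy)]

/-- The normal of the cylinder has derivative `d(F/|F|)`, so its second fundamental form is minus
the sphere part of the metric, `-(r⁻² g - d log r ⊗ d log r)`. -/
lemma sndFDeriv_cylinderMap_radial
    (hU : IsOpen U) (hG : ContDiffOn ℝ ∞ G U) (h0 : ∀ z ∈ U, G z ≠ 0)
    (hy : y ∈ U) (u v : EuclideanSpace ℝ (Fin n)) :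
    inner ℝ (fderiv ℝ (fderiv ℝ (fun z => cylinderMap (G z))) y u v)
      (WithLp.toLp 2 (radial (G y), (0 : ℝ)))
      = -((‖G y‖ ^ 2)⁻¹ * inner ℝ (fderiv ℝ G y u) (fderiv ℝ G y v)
        - (‖G y‖ ^ 2)⁻¹ * inner ℝ (G y) (fderiv ℝ G y u) *
          ((‖G y‖ ^ 2)⁻¹ * inner ℝ (G y) (fderiv ℝ G y v))) := by
  have hr := contDiffOn_radial_comp hG h0
  rw [inner_sndFDeriv_normal (N := fun z => WithLp.toLp 2 (radial (G z), (0 : ℝ))) hU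
    (contDiffOn_cylinderMap_comp hG h0) (contDiffOn_toLp hr contDiffOn_const) hy
    (fun z hz v => inner_fderiv_cylinderMap_radial hU hG h0 hz v)]
  have h1 : fderiv ℝ (fun z => WithLp.toLp 2 (radial (G z), (0 : ℝ))) y u
      = WithLp.toLp 2 (fderiv ℝ (fun z => radial (G z)) y u, (0 : ℝ)) := by
    have := hasFDerivAt_toLp (differentiableAt_of_contDiffOn hU hr hy).hasFDerivAt
      (hasFDerivAt_const (0 : ℝ) y)
    rw [this.fderiv]
    simp
  rw [h1, fderiv_cylinderMap_comp hU hG h0 hy, inner_toLp,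
    fderiv_comp_of_contDiffOn hU hG hy (hasFDerivAt_radial (h0 y hy)).differentiableAt,
    fderiv_comp_of_contDiffOn hU hG hy (hasFDerivAt_radial (h0 y hy)).differentiableAt,
    inner_fderiv_radial (h0 y hy), real_inner_comm (fderiv ℝ G y u)]
  ring

/-- The second fundamental form in the direction inside the cylinder is the original one, rescaled
by `r⁻¹`, and corrected by `σ` times the conformal metric. The derivatives of `σ` cancel between the
two components of the normal. -/
lemma sndFDeriv_cylinderMap_normal
    (hU : IsOpen U) (hG : ContDiffOn ℝ ∞ G U) (h0 : ∀ z ∈ U, G z ≠ 0) (hν : ContDiffOn ℝ ∞ ν U)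
    (hGν : ∀ z ∈ U, ∀ v, inner ℝ (fderiv ℝ G z v) (ν z) = 0)
    (hy : y ∈ U) (u v : EuclideanSpace ℝ (Fin n)) :
    inner ℝ (fderiv ℝ (fderiv ℝ (fun z => cylinderMap (G z))) y u v) (cylinderNormal G ν y)
      = -(‖G y‖⁻¹ * inner ℝ (fderiv ℝ G y v) (fderiv ℝ ν y u)
        - inner ℝ (radial (G y)) (ν y) *
          ((‖G y‖ ^ 2)⁻¹ * inner ℝ (fderiv ℝ G y u) (fderiv ℝ G y v))) := by
  have hr := contDiffOn_radial_comp hG h0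
  have hn : ‖G y‖ ≠ 0 := norm_ne_zero_iff.2 (h0 y hy)
  rw [inner_sndFDeriv_normal hU (contDiffOn_cylinderMap_comp hG h0)
    (contDiffOn_cylinderNormal hG h0 hν) hy
    (fun z hz v => inner_fderiv_cylinderMap_normal hU hG h0 hGν hz v)]
  have dr := differentiableAt_of_contDiffOn hU hr hy
  have dν := differentiableAt_of_contDiffOn hU hν hy
  have ds := differentiableAt_of_contDiffOn hU (hr.inner ℝ hν) hy
  have h1 : fderiv ℝ (cylinderNormal G ν) y u
      = WithLp.toLp 2 (fderiv ℝ ν y u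
          - (inner ℝ (radial (G y)) (ν y) • fderiv ℝ (fun z => radial (G z)) y u
            + fderiv ℝ (fun z => inner ℝ (radial (G z)) (ν z)) y u • radial (G y)),
          fderiv ℝ (fun z => inner ℝ (radial (G z)) (ν z)) y u) := by
    have := hasFDerivAt_toLp (dν.hasFDerivAt.sub (ds.hasFDerivAt.smul dr.hasFDerivAt))
      ds.hasFDerivAt
    have h2 : fderiv ℝ (cylinderNormal G ν) y = _ := this.fderiv
    rw [h2]
    simp
  have h3 := fderiv_inner_apply' hU hr hν hy u
  rw [inner_fderiv_radial_normal hU hG h0 hGν hy] at h3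
  rw [h1, fderiv_cylinderMap_comp hU hG h0 hy, inner_toLp, inner_sub_right, inner_add_right,
    real_inner_smul_right, real_inner_smul_right, inner_fderiv_radial_radial hU hG h0 hy, h3,
    fderiv_comp_of_contDiffOn hU hG hy (hasFDerivAt_radial (h0 y hy)).differentiableAt,
    fderiv_comp_of_contDiffOn hU hG hy (hasFDerivAt_radial (h0 y hy)).differentiableAt,
    inner_fderiv_radial (h0 y hy), fderiv_radial (h0 y hy), inner_sub_left, real_inner_smul_left,
    real_inner_smul_left, real_inner_comm (fderiv ℝ G y u), radial, real_inner_smul_left,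
    real_inner_smul_left]
  field_simp
  ring

end ConformalCurvature

/-! ### The lower bound on the bi-Ricci curvature of the conformal metric. -/

section BiRicci

variable {W : Type*} [NormedAddCommGroup W] [InnerProductSpace ℝ W]

lemma inv_smul_one {ι : Type*} [Fintype ι] [DecidableEq ι] {c : ℝ} (hc : c ≠ 0) :
    (c • (1 : Matrix ι ι ℝ))⁻¹ = c⁻¹ • (1 : Matrix ι ι ℝ) := by
  apply Matrix.inv_eq_right_inv
  simp [smul_smul, inv_mul_cancel₀ hc]

/-- The matrix of the second fundamental form, as the derivative of the normal field. -/
def shapeMatrix {n : ℕ} (D D' : EuclideanSpace ℝ (Fin n) →L[ℝ] W) : Matrix (Fin n) (Fin n) ℝ :=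
  Matrix.of fun i j => inner ℝ (D (stdVec i)) (D' (stdVec j))

variable {G ν : EuclideanSpace ℝ (Fin 4) → W} {U : Set (EuclideanSpace ℝ (Fin 4))}
  {y : EuclideanSpace ℝ (Fin 4)} {h : EuclideanSpace ℝ (Fin 4) → Matrix (Fin 4) (Fin 4) ℝ}

/-- The bi-Ricci curvature of the conformal metric `|G|⁻² G^* g_Euc` of a minimal hypersurface. -/
lemma biRic_lower_bound [FiniteDimensional ℝ W] (hW : Module.finrank ℝ W = 5)
    (hU : IsOpen U) (hG : ContDiffOn ℝ ∞ G U) (h0 : ∀ z ∈ U, G z ≠ 0)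
    (hinj : ∀ z ∈ U, Function.Injective (fderiv ℝ G z)) (hν : ContDiffOn ℝ ∞ ν U)
    (hν1 : ‖ν y‖ = 1) (hGν : ∀ z ∈ U, ∀ v, inner ℝ (fderiv ℝ G z v) (ν z) = 0)
    (hh : ∀ z ∈ U, h z = (‖G z‖ ^ 2)⁻¹ • gramOf (fderiv ℝ G z)) (hy : y ∈ U)
    (hmin : ∑ i, ∑ j, (gramOf (fderiv ℝ G y))⁻¹ i j *
      shapeMatrix (fderiv ℝ G y) (fderiv ℝ ν y) i j = 0)
    (v w : EuclideanSpace ℝ (Fin 4))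
    (hvv : (‖G y‖ ^ 2)⁻¹ * inner ℝ (fderiv ℝ G y v) (fderiv ℝ G y v) = 1)
    (hww : (‖G y‖ ^ 2)⁻¹ * inner ℝ (fderiv ℝ G y w) (fderiv ℝ G y w) = 1)
    (hvw : (‖G y‖ ^ 2)⁻¹ * inner ℝ (fderiv ℝ G y v) (fderiv ℝ G y w) = 0) :
    2 + 3 * inner ℝ (radial (G y)) (ν y) ^ 2
      - ‖G y‖ ^ 2 * ∑ i, ∑ j, ∑ k, ∑ l, (gramOf (fderiv ℝ G y))⁻¹ i k *
        (gramOf (fderiv ℝ G y))⁻¹ j l * shapeMatrix (fderiv ℝ G y) (fderiv ℝ ν y) i j *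
        shapeMatrix (fderiv ℝ G y) (fderiv ℝ ν y) k l
      ≤ ricciOf h y v v + ricciOf h y w w - riemannOf h y v w w v := by
  have hn : ‖G y‖ ≠ 0 := norm_ne_zero_iff.2 (h0 y hy)
  set Φ : EuclideanSpace ℝ (Fin 4) → WithLp 2 (W × ℝ) := fun z => cylinderMap (G z) with hΦ
  have hΦs : ContDiffOn ℝ ∞ Φ U := contDiffOn_cylinderMap_comp hG h0
  have hmet : ∀ z ∈ U, ∀ a b, inner ℝ (fderiv ℝ Φ z a) (fderiv ℝ Φ z b)
      = (‖G z‖ ^ 2)⁻¹ * inner ℝ (fderiv ℝ G z a) (fderiv ℝ G z b) :=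
    fun z hz a b => inner_fderiv_cylinderMap_comp hU hG h0 hz a b
  have hΦinj : ∀ z ∈ U, Function.Injective (fderiv ℝ Φ z) := fun z hz => by
    have : ⇑(fderiv ℝ Φ z) = fderiv ℝ (cylinderMap : W → WithLp 2 (W × ℝ)) (G z) ∘
        fderiv ℝ G z := by
      ext1 a
      exact fderiv_comp_of_contDiffOn hU hG hz
        (hasFDerivAt_cylinderMap (h0 z hz)).differentiableAt a
    rw [this]
    exact (fderiv_cylinderMap_injective (h0 z hz)).comp (hinj z hz)
  have hhΦ : ∀ z ∈ U, h z = gramOf (fderiv ℝ Φ z) := fun z hz => by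
    ext i j
    rw [hh z hz, gramOf_apply, hmet z hz]
    rfl
  -- the orthonormal frame
  obtain ⟨e, he, heo⟩ := exists_frame_extension (hΦinj y hy) {0, 1} ![v, w, 0, 0] (by
    rintro a (rfl | rfl) b (rfl | rfl) <;> rw [hmet y hy]
    · exact hvv
    · exact hvw
    · rw [real_inner_comm]
      exact hvw
    · exact hww)
  have e0 : e 0 = v := he 0 (by simp)
  have e1 : e 1 = w := he 1 (by simp)
  have heo' := orthonormal_iff_ite.1 heo
  have hE : (frameMatrix e).transpose * h y * frameMatrix e = 1 := by
    ext a b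
    rw [frameMatrix_conj, hhΦ y hy, sum_gramOf, heo', Matrix.one_apply]
  have hEu := frameMatrix_isUnit hE
  -- The frame is orthonormal for the conformal metric, so its vectors have length `r` for the
  -- original one.
  have hEg : (frameMatrix e).transpose * gramOf (fderiv ℝ G y) * frameMatrix e
      = (‖G y‖ ^ 2) • (1 : Matrix (Fin 4) (Fin 4) ℝ) := by
    rw [← hE, hh y hy, Matrix.mul_smul, Matrix.smul_mul, smul_smul,
      mul_inv_cancel₀ (by positivity), one_smul]
  have hEA : ∀ a b, ((frameMatrix e).transpose * shapeMatrix (fderiv ℝ G y) (fderiv ℝ ν y) *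
      frameMatrix e) a b = inner ℝ (fderiv ℝ G y (e a)) (fderiv ℝ ν y (e b)) := fun a b => by
    rw [frameMatrix_conj]
    exact sum_inner_clm _ _ _ _
  -- the normal frame
  have hr1 : ‖radial (G y)‖ = 1 := norm_radial (h0 y hy)
  let N : Fin 2 → WithLp 2 (W × ℝ) :=
    ![WithLp.toLp 2 (radial (G y), (0 : ℝ)), cylinderNormal G ν y]
  have hN : Orthonormal ℝ N := by
    rw [orthonormal_iff_ite]
    intro a b
    have hrr : inner ℝ (radial (G y)) (radial (G y)) = 1 := by
      rw [real_inner_self_eq_norm_sq, hr1, one_pow]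
    have hνν : inner ℝ (ν y) (ν y) = 1 := by rw [real_inner_self_eq_norm_sq, hν1, one_pow]
    fin_cases a <;> fin_cases b <;>
    simp only [N, cylinderNormal, Fin.zero_eta, Fin.mk_one, Matrix.cons_val_zero,
      Matrix.cons_val_one, inner_toLp, inner_sub_left, inner_sub_right, real_inner_smul_left,
      real_inner_smul_right, hrr, hνν, real_inner_comm (radial (G y)) (ν y)] <;> simp
  have hTN : ∀ a i, inner ℝ (fderiv ℝ Φ y (e a)) (N i) = 0 := by
    intro a i
    fin_cases i
    · exact inner_fderiv_cylinderMap_radial hU hG h0 hy _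
    · exact inner_fderiv_cylinderMap_normal hU hG h0 hGν hy _
  -- Four tangent and two normal vectors fill the space of dimension six, so products of normal
  -- parts reduce to their components along the two normals.
  have hfull := parseval (orthonormal_sum heo hN hTN) (by
    have : Module.finrank ℝ (WithLp 2 (W × ℝ)) = 6 := by
      rw [(WithLp.linearEquiv 2 ℝ (W × ℝ)).finrank_eq, Module.finrank_prod, hW]
      simp
    rw [this]
    simp)
  simp only [Fintype.sum_sum_type, Sum.elim_inl, Sum.elim_inr, Fin.sum_univ_two] at hfull
  set B := bilin (normalPart h Φ y) with hB
  have hBB : ∀ a b c d, inner ℝ (B (e a) (e b)) (B (e c) (e d))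
      = inner ℝ (B (e a) (e b)) (N 0) * inner ℝ (B (e c) (e d)) (N 0)
        + inner ℝ (B (e a) (e b)) (N 1) * inner ℝ (B (e c) (e d)) (N 1) := fun a b c d => by
    rw [hfull]
    have := fun u v w => inner_bilin_normalPart_tangent hU hΦs hhΦ hΦinj hy u v w
    simp [B, this]
  set ρ : Fin 4 → ℝ := fun a => (‖G y‖ ^ 2)⁻¹ * inner ℝ (G y) (fderiv ℝ G y (e a)) with hρ
  set σ : ℝ := inner ℝ (radial (G y)) (ν y) with hσ
  -- Since the frame vectors have original length `r`, the factor `r⁻¹` leaves `r A` in the rescaled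
  -- unit frame; therefore `|α|² = r²|A|²`.
  set α : Fin 4 → Fin 4 → ℝ :=
    fun a b => ‖G y‖⁻¹ * inner ℝ (fderiv ℝ G y (e b)) (fderiv ℝ ν y (e a)) with hα
  have hδ : ∀ a b, (‖G y‖ ^ 2)⁻¹ * inner ℝ (fderiv ℝ G y (e a)) (fderiv ℝ G y (e b))
      = if a = b then 1 else 0 := fun a b => by rw [← hmet y hy, heo']
  have hβ₁ : ∀ a b, inner ℝ (B (e a) (e b)) (N 0)
      = -((if a = b then 1 else 0) - ρ a * ρ b) := fun a b => by
    refine (inner_bilin_normalPart_normal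
      (fun v => inner_fderiv_cylinderMap_radial hU hG h0 hy v) _ _).trans ?_
    exact (sndFDeriv_cylinderMap_radial hU hG h0 hy _ _).trans (by rw [hδ])
  have hβ₂ : ∀ a b, inner ℝ (B (e a) (e b)) (N 1)
      = -(α a b - σ * (if a = b then 1 else 0)) := fun a b => by
    refine (inner_bilin_normalPart_normal
      (fun v => inner_fderiv_cylinderMap_normal hU hG h0 hGν hy v) _ _).trans ?_
    exact (sndFDeriv_cylinderMap_normal hU hG h0 hν hGν hy _ _).trans (by rw [hδ])
  have hαs : ∀ a b, α a b = α b a := fun a b => by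
    have h1 := inner_sndFDeriv_normal hU hG hν hy hGν (e a) (e b)
    have h2 := inner_sndFDeriv_normal hU hG hν hy hGν (e b) (e a)
    rw [sndFDeriv_symm hU hG hy, h2] at h1
    simp only [hα]
    rw [neg_inj.1 h1]
  have hc : (‖G y‖ ^ 2) ≠ 0 := by positivity
  have htr : ∑ a, α a a = 0 := by
    rw [← sum_inv_conj (frameMatrix e) _ _ hEu, hEg, inv_smul_one hc] at hmin
    simp only [hEA, Matrix.smul_apply, Matrix.one_apply, smul_eq_mul, mul_ite, mul_one, mul_zero,
      ite_mul, zero_mul, Finset.sum_ite_eq, Finset.mem_univ, if_true, ← Finset.mul_sum] at hmin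
    have h3 := (mul_eq_zero.1 hmin).resolve_left (inv_ne_zero hc)
    simp only [hα, ← Finset.mul_sum, h3, mul_zero]
  have hsq : ‖G y‖ ^ 2 * ∑ i, ∑ j, ∑ k, ∑ l, (gramOf (fderiv ℝ G y))⁻¹ i k *
        (gramOf (fderiv ℝ G y))⁻¹ j l * shapeMatrix (fderiv ℝ G y) (fderiv ℝ ν y) i j *
        shapeMatrix (fderiv ℝ G y) (fderiv ℝ ν y) k l = ∑ a, ∑ b, α a b ^ 2 := by
    rw [← sum_quad_inv_conj (frameMatrix e) _ _ hEu, hEg, inv_smul_one hc]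
    simp only [hEA, Matrix.smul_apply, Matrix.one_apply, smul_eq_mul, mul_ite, mul_one, mul_zero,
      ite_mul, zero_mul, Finset.sum_ite_eq, Finset.mem_univ, if_true, Finset.mul_sum]
    rw [Finset.sum_comm]
    refine Finset.sum_congr rfl fun a _ => Finset.sum_congr rfl fun b _ => ?_
    simp only [hα]
    field_simp
  have hρσ : ∑ a, ρ a ^ 2 + σ ^ 2 = 1 := by
    -- Parseval for the unit vector along the axis of the cylinder: its components are the `ρ a`,
    -- then zero and `σ`.
    have h1 := hfull (WithLp.toLp 2 ((0 : W), (1 : ℝ))) (WithLp.toLp 2 ((0 : W), (1 : ℝ)))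
    have h2 : ∀ a, inner ℝ (WithLp.toLp 2 ((0 : W), (1 : ℝ))) (fderiv ℝ Φ y (e a)) = ρ a :=
      fun a => by
        rw [hΦ, fderiv_cylinderMap_comp hU hG h0 hy, inner_toLp]
        simp [hρ]
    simp only [h2, N, Matrix.cons_val_zero, Matrix.cons_val_one, cylinderNormal, inner_toLp,
      inner_zero_left] at h1
    simp only [mul_one, mul_zero, zero_add, one_mul, add_zero] at h1
    rw [h1]
    simp only [sq]
    rfl
  rw [hsq, ricciOf_eq hE, ricciOf_eq hE, ← e0, ← e1]
  simp only [riemannOf_eq hU hΦs hhΦ hΦinj hy]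
  rw [← hB]
  simp only [hBB]
  have := biRic_algebra α ρ σ hαs htr hρσ (fun a b => inner ℝ (B (e a) (e b)) (N 0))
    (fun a b => inner ℝ (B (e a) (e b)) (N 1)) hβ₁ hβ₂
  exact this

end BiRicci

/-! ### Differentials in the preferred chart at a point versus a fixed chart. -/

section Charts

variable {n : ℕ} {M : Type*} [TopologicalSpace M] [ChartedSpace (EuclideanSpace ℝ (Fin n)) M]
  {V : Type*} [NormedAddCommGroup V] [NormedSpace ℝ V]

/-- The differential of a map to a vector space, read in the preferred chart. -/
def dAt (f : M → V) (x : M) : EuclideanSpace ℝ (Fin n) →L[ℝ] V := mfderiv (𝓡 n) 𝓘(ℝ, V) f x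

/-- The differential of the inverse chart, read in the preferred chart. -/
def dChartSymm (p : M) (y : EuclideanSpace ℝ (Fin n)) :
    EuclideanSpace ℝ (Fin n) →L[ℝ] EuclideanSpace ℝ (Fin n) :=
  mfderiv (𝓡 n) (𝓡 n) (chartAt (EuclideanSpace ℝ (Fin n)) p).symm y

/-- A function read in the chart at `p`. -/
def inChart {V : Type*} (f : M → V) (p : M) : EuclideanSpace ℝ (Fin n) → V :=
  f ∘ (chartAt (EuclideanSpace ℝ (Fin n)) p).symm

lemma dAt_eq_fderiv {f : M → V} {x : M} (hf : MDifferentiableAt (𝓡 n) 𝓘(ℝ, V) f x) :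
    dAt f x = fderiv ℝ (inChart f x) (chartAt (EuclideanSpace ℝ (Fin n)) x x) := by
  have h := hf.mfderiv
  simp only [mfld_simps, fderivWithin_univ, writtenInExtChartAt] at h
  exact h

/-- The Jacobian matrix of the inverse chart. -/
def jac (p : M) (y : EuclideanSpace ℝ (Fin n)) : Matrix (Fin n) (Fin n) ℝ :=
  frameMatrix fun i => dChartSymm p y (stdVec i)

lemma jac_eq_toMatrix (p : M) (y : EuclideanSpace ℝ (Fin n)) :
    jac p y = LinearMap.toMatrix (EuclideanSpace.basisFun (Fin n) ℝ).toBasis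
      (EuclideanSpace.basisFun (Fin n) ℝ).toBasis
      (dChartSymm p y : EuclideanSpace ℝ (Fin n) →ₗ[ℝ] EuclideanSpace ℝ (Fin n)) := by
  ext i j
  simp [jac, frameMatrix, LinearMap.toMatrix_apply, stdVec]

variable [IsManifold (𝓡 n) ∞ M]

/-- The differential at a point is read in the chart preferred at that point, which varies from
point to point. The chain rule passes to the fixed chart at `p`, where smoothness in the point can
be discussed. -/
lemma dAt_comp_dChartSymm {f : M → V} {p : M} {y : EuclideanSpace ℝ (Fin n)}
    (hy : y ∈ (chartAt (EuclideanSpace ℝ (Fin n)) p).target)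
    (hf : MDifferentiableAt (𝓡 n) 𝓘(ℝ, V) f ((chartAt (EuclideanSpace ℝ (Fin n)) p).symm y))
    (v : EuclideanSpace ℝ (Fin n)) :
    dAt f ((chartAt (EuclideanSpace ℝ (Fin n)) p).symm y) (dChartSymm p y v)
      = fderiv ℝ (inChart f p) y v := by
  have : IsManifold (𝓡 n) 1 M := IsManifold.of_le (n := ∞) (by simp)
  have h1 := mdifferentiableAt_atlas_symm (I := 𝓡 n)
    (chart_mem_atlas (EuclideanSpace ℝ (Fin n)) p) hy
  have h2 := mfderiv_comp y hf h1
  have h3 : fderiv ℝ (inChart f p) y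
      = mfderiv (𝓡 n) 𝓘(ℝ, V) (f ∘ (chartAt (EuclideanSpace ℝ (Fin n)) p).symm) y :=
    mfderiv_eq_fderiv.symm
  rw [h3, h2]
  rfl

lemma mdifferentiableAt_of_inChart {f : M → V} {p x : M}
    (hx : x ∈ (chartAt (EuclideanSpace ℝ (Fin n)) p).source)
    (hf : DifferentiableAt ℝ (inChart f p) (chartAt (EuclideanSpace ℝ (Fin n)) p x)) :
    MDifferentiableAt (𝓡 n) 𝓘(ℝ, V) f x := by
  have : IsManifold (𝓡 n) 1 M := IsManifold.of_le (n := ∞) (by simp)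
  have h1 := mdifferentiableAt_atlas (I := 𝓡 n)
    (chart_mem_atlas (EuclideanSpace ℝ (Fin n)) p) hx
  have h2 : MDifferentiableAt (𝓡 n) 𝓘(ℝ, V)
      (inChart f p ∘ chartAt (EuclideanSpace ℝ (Fin n)) p) x :=
    MDifferentiableAt.comp x hf.mdifferentiableAt h1
  refine h2.congr_of_eventuallyEq ?_
  filter_upwards [(chartAt (EuclideanSpace ℝ (Fin n)) p).open_source.mem_nhds hx] with z hz
  simp [inChart, (chartAt (EuclideanSpace ℝ (Fin n)) p).left_inv hz]

lemma dChartSymm_bijective {p : M} {y : EuclideanSpace ℝ (Fin n)}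
    (hy : y ∈ (chartAt (EuclideanSpace ℝ (Fin n)) p).target) :
    Function.Bijective (dChartSymm p y) := by
  have : IsManifold (𝓡 n) 1 M := IsManifold.of_le (n := ∞) (by simp)
  exact (mdifferentiable_chart (I := 𝓡 n) p).symm.mfderiv_bijective hy

lemma contDiffOn_inChart {f : M → V} (hf : ContMDiff (𝓡 n) 𝓘(ℝ, V) ∞ f) (p : M) :
    ContDiffOn ℝ ∞ (inChart f p) (chartAt (EuclideanSpace ℝ (Fin n)) p).target := by
  have h1 : ContMDiffOn (𝓡 n) (𝓡 n) ∞ (chartAt (EuclideanSpace ℝ (Fin n)) p).symm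
      (chartAt (EuclideanSpace ℝ (Fin n)) p).target := contMDiffOn_chart_symm
  exact (hf.comp_contMDiffOn h1).contDiffOn

lemma contMDiffAt_of_inChart {f : M → V} {p x : M}
    (hx : x ∈ (chartAt (EuclideanSpace ℝ (Fin n)) p).source)
    (hf : ContDiffOn ℝ ∞ (inChart f p) (chartAt (EuclideanSpace ℝ (Fin n)) p).target) :
    ContMDiffAt (𝓡 n) 𝓘(ℝ, V) ∞ f x := by
  have h1 : ContMDiffOn (𝓡 n) (𝓡 n) ∞ (chartAt (EuclideanSpace ℝ (Fin n)) p)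
      (chartAt (EuclideanSpace ℝ (Fin n)) p).source := contMDiffOn_chart
  have h2 := hf.contMDiffOn.comp h1 (fun z hz =>
    (chartAt (EuclideanSpace ℝ (Fin n)) p).map_source hz)
  refine (h2.contMDiffAt
    ((chartAt (EuclideanSpace ℝ (Fin n)) p).open_source.mem_nhds hx)).congr_of_eventuallyEq ?_
  filter_upwards [(chartAt (EuclideanSpace ℝ (Fin n)) p).open_source.mem_nhds hx] with z hz
  simp [inChart, (chartAt (EuclideanSpace ℝ (Fin n)) p).left_inv hz]

lemma isUnit_jac_det {p : M} {y : EuclideanSpace ℝ (Fin n)}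
    (hy : y ∈ (chartAt (EuclideanSpace ℝ (Fin n)) p).target) : IsUnit (jac p y).det := by
  rw [jac_eq_toMatrix, LinearMap.det_toMatrix]
  exact (LinearEquiv.ofBijective (dChartSymm p y :
    EuclideanSpace ℝ (Fin n) →ₗ[ℝ] EuclideanSpace ℝ (Fin n)) (dChartSymm_bijective hy)).isUnit_det'

end Charts

/-! ### Traces and the second fundamental form as chart-independent quantities. -/

section Tensors

variable {n : ℕ} {M : Type*} [TopologicalSpace M] [ChartedSpace (EuclideanSpace ℝ (Fin n)) M]
  {W : Type*} [NormedAddCommGroup W] [InnerProductSpace ℝ W]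

/-- Products of first derivatives transform by congruence with the Jacobian matrix, so the
frame-independent traces may be computed in any chart. -/
lemma shapeMatrix_jac [IsManifold (𝓡 n) ∞ M] {F F' : M → W} {p x : M}
    (hx : x ∈ (chartAt (EuclideanSpace ℝ (Fin n)) p).source)
    (hF : MDifferentiableAt (𝓡 n) 𝓘(ℝ, W) F x) (hF' : MDifferentiableAt (𝓡 n) 𝓘(ℝ, W) F' x) :
    (jac p (chartAt (EuclideanSpace ℝ (Fin n)) p x)).transpose * shapeMatrix (dAt F x) (dAt F' x) *
        jac p (chartAt (EuclideanSpace ℝ (Fin n)) p x)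
      = shapeMatrix (fderiv ℝ (inChart F p) (chartAt (EuclideanSpace ℝ (Fin n)) p x))
        (fderiv ℝ (inChart F' p) (chartAt (EuclideanSpace ℝ (Fin n)) p x)) := by
  set φ := chartAt (EuclideanSpace ℝ (Fin n)) p
  have hy : φ x ∈ φ.target := φ.map_source hx
  have hxy : φ.symm (φ x) = x := φ.left_inv hx
  ext a b
  rw [jac, frameMatrix_conj]
  refine (sum_inner_clm _ _ _ _).trans ?_
  have h1 := dAt_comp_dChartSymm (f := F) hy (by rwa [hxy]) (stdVec a)
  have h2 := dAt_comp_dChartSymm (f := F') hy (by rwa [hxy]) (stdVec b)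
  rw [hxy] at h1 h2
  rw [h1, h2]
  rfl

lemma gramOf_eq_shapeMatrix (D : EuclideanSpace ℝ (Fin n) →L[ℝ] W) :
    gramOf D = shapeMatrix D D := rfl

lemma chartGram_inducedMetric [IsManifold (𝓡 n) ∞ M] {F : M → W} {p : M}
    {y : EuclideanSpace ℝ (Fin n)} (hy : y ∈ (chartAt (EuclideanSpace ℝ (Fin n)) p).target)
    (hF : MDifferentiable (𝓡 n) 𝓘(ℝ, W) F) :
    chartGram (inducedMetric n F) p y = gramOf (fderiv ℝ (inChart F p) y) := by
  ext i j
  rw [gramOf_apply, ← dAt_comp_dChartSymm hy (hF _), ← dAt_comp_dChartSymm hy (hF _)]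
  rfl

/-- The trace, with respect to the metric induced by `F`, of the form `⟨dF₁ ·, dF₂ ·⟩`. -/
def traceForm {W' : Type*} [NormedAddCommGroup W'] [InnerProductSpace ℝ W'] (F : M → W)
    (F₁ F₂ : M → W') (x : M) : ℝ :=
  ∑ i, ∑ j, (gramOf (dAt (n := n) F x))⁻¹ i j * shapeMatrix (dAt F₁ x) (dAt F₂ x) i j

lemma gradNormSq_eq (F : M → W) (ψ : M → ℝ) (x : M) :
    gradNormSq (inducedMetric n F) ψ x = traceForm (n := n) F ψ ψ x := by
  unfold gradNormSq traceForm
  refine Finset.sum_congr rfl fun i _ => Finset.sum_congr rfl fun j _ => ?_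
  change (gramOf (dAt F x))⁻¹ i j * dAt ψ x (stdVec i) * dAt ψ x (stdVec j)
    = (gramOf (dAt F x))⁻¹ i j * inner ℝ (dAt ψ x (stdVec i)) (dAt ψ x (stdVec j))
  rw [mul_assoc]
  congr 1
  exact mul_comm _ _

/-- The local expression of `traceForm`. -/
def traceFormLoc {W' : Type*} [NormedAddCommGroup W'] [InnerProductSpace ℝ W']
    (G : EuclideanSpace ℝ (Fin n) → W)
    (G₁ G₂ : EuclideanSpace ℝ (Fin n) → W') (y : EuclideanSpace ℝ (Fin n)) : ℝ :=
  ∑ i, ∑ j, (gramOf (fderiv ℝ G y))⁻¹ i j * shapeMatrix (fderiv ℝ G₁ y) (fderiv ℝ G₂ y) i j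

variable [IsManifold (𝓡 n) ∞ M]

lemma traceForm_eq {W' : Type*} [NormedAddCommGroup W'] [InnerProductSpace ℝ W'] {F : M → W}
    {F₁ F₂ : M → W'} {p x : M}
    (hx : x ∈ (chartAt (EuclideanSpace ℝ (Fin n)) p).source)
    (hF : MDifferentiableAt (𝓡 n) 𝓘(ℝ, W) F x) (hF₁ : MDifferentiableAt (𝓡 n) 𝓘(ℝ, W') F₁ x)
    (hF₂ : MDifferentiableAt (𝓡 n) 𝓘(ℝ, W') F₂ x) :
    traceForm (n := n) F F₁ F₂ x = traceFormLoc (inChart F p) (inChart F₁ p) (inChart F₂ p)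
      (chartAt (EuclideanSpace ℝ (Fin n)) p x) := by
  have hy := (chartAt (EuclideanSpace ℝ (Fin n)) p).map_source hx
  rw [traceForm, traceFormLoc, ← sum_inv_conj _ _ _ (isUnit_jac_det hy), gramOf_eq_shapeMatrix,
    gramOf_eq_shapeMatrix, shapeMatrix_jac hx hF hF, shapeMatrix_jac hx hF₁ hF₂]

lemma contDiffOn_traceFormLoc {W' : Type*} [NormedAddCommGroup W'] [InnerProductSpace ℝ W']
    {G : EuclideanSpace ℝ (Fin n) → W} {G₁ G₂ : EuclideanSpace ℝ (Fin n) → W'}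
    {U : Set (EuclideanSpace ℝ (Fin n))} (hU : IsOpen U) (hG : ContDiffOn ℝ ∞ G U)
    (hinj : ∀ z ∈ U, Function.Injective (fderiv ℝ G z))
    (hG₁ : ContDiffOn ℝ ∞ G₁ U) (hG₂ : ContDiffOn ℝ ∞ G₂ U) :
    ContDiffOn ℝ ∞ (traceFormLoc G G₁ G₂) U := by
  refine ContDiffOn.sum fun i _ => ContDiffOn.sum fun j _ => ContDiffOn.mul ?_ ?_
  · exact contDiffOn_inv (contDiffOn_gramOf hU hG) (fun z hz => (gramOf_det_pos (hinj z hz)).ne') _ _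
  · exact (contDiffOn_fderiv_apply hU hG₁ _).inner ℝ (contDiffOn_fderiv_apply hU hG₂ _)

lemma injective_fderiv_inChart {F : M → W} (hF : IsSmoothImmersion n F) (p : M) :
    ∀ z ∈ (chartAt (EuclideanSpace ℝ (Fin n)) p).target,
      Function.Injective (fderiv ℝ (inChart F p) z) := by
  intro z hz
  have : ⇑(fderiv ℝ (inChart F p) z)
      = dAt F ((chartAt (EuclideanSpace ℝ (Fin n)) p).symm z) ∘ dChartSymm p z := by
    ext1 v
    exact (dAt_comp_dChartSymm hz (hF.contMDiff.mdifferentiable (by simp) _) v).symm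
  rw [this]
  exact (hF.injective _).comp (dChartSymm_bijective hz).injective

lemma contMDiff_traceForm {W' : Type*} [NormedAddCommGroup W'] [InnerProductSpace ℝ W'] {F : M → W}
    {F₁ F₂ : M → W'} (hF : IsSmoothImmersion n F) (hF₁ : ContMDiff (𝓡 n) 𝓘(ℝ, W') ∞ F₁)
    (hF₂ : ContMDiff (𝓡 n) 𝓘(ℝ, W') ∞ F₂) :
    ContMDiff (𝓡 n) 𝓘(ℝ, ℝ) ∞ (traceForm (n := n) F F₁ F₂) := by
  intro x
  set φ := chartAt (EuclideanSpace ℝ (Fin n)) x with hφ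
  refine contMDiffAt_of_inChart (p := x) (mem_chart_source _ x) ?_
  refine (contDiffOn_traceFormLoc φ.open_target (contDiffOn_inChart hF.contMDiff x)
    (injective_fderiv_inChart hF x) (contDiffOn_inChart hF₁ x) (contDiffOn_inChart hF₂ x)).congr ?_
  intro y hy
  have hy' : φ.symm y ∈ φ.source := φ.map_target hy
  rw [inChart, Function.comp_apply, traceForm_eq (p := x) hy'
    (hF.contMDiff.mdifferentiable (by simp) _)
    (hF₁.mdifferentiable (by simp) _) (hF₂.mdifferentiable (by simp) _), ← hφ, φ.right_inv hy]

/-- The square norm of the second fundamental form, through the derivative of the normal field. -/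
def shapeNormSq (F ν : M → W) (x : M) : ℝ :=
  ∑ i, ∑ j, ∑ k, ∑ l, (gramOf (dAt (n := n) F x))⁻¹ i k * (gramOf (dAt F x))⁻¹ j l *
    shapeMatrix (dAt F x) (dAt ν x) i j * shapeMatrix (dAt F x) (dAt ν x) k l

lemma contMDiff_shapeNormSq {F ν : M → W} (hF : IsSmoothImmersion n F)
    (hν : ContMDiff (𝓡 n) 𝓘(ℝ, W) ∞ ν) :
    ContMDiff (𝓡 n) 𝓘(ℝ, ℝ) ∞ (shapeNormSq (n := n) F ν) := by
  intro x
  set φ := chartAt (EuclideanSpace ℝ (Fin n)) x with hφ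
  refine contMDiffAt_of_inChart (p := x) (mem_chart_source _ x) ?_
  have hG := contDiffOn_inChart hF.contMDiff x
  have hG' := contDiffOn_inChart hν x
  have hi := injective_fderiv_inChart hF x
  have key : ContDiffOn ℝ ∞ (fun y => ∑ i, ∑ j, ∑ k, ∑ l,
      (gramOf (fderiv ℝ (inChart F x) y))⁻¹ i k * (gramOf (fderiv ℝ (inChart F x) y))⁻¹ j l *
      shapeMatrix (fderiv ℝ (inChart F x) y) (fderiv ℝ (inChart ν x) y) i j *
      shapeMatrix (fderiv ℝ (inChart F x) y) (fderiv ℝ (inChart ν x) y) k l) φ.target := by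
    have h1 := fun i j => contDiffOn_inv (contDiffOn_gramOf φ.open_target hG)
      (fun z hz => (gramOf_det_pos (hi z hz)).ne') i j
    have h2 : ∀ i j, ContDiffOn ℝ ∞ (fun y => shapeMatrix (fderiv ℝ (inChart F x) y)
        (fderiv ℝ (inChart ν x) y) i j) φ.target := fun i j =>
      (contDiffOn_fderiv_apply φ.open_target hG _).inner ℝ
        (contDiffOn_fderiv_apply φ.open_target hG' _)
    exact ContDiffOn.sum fun i _ => ContDiffOn.sum fun j _ => ContDiffOn.sum fun k _ =>
      ContDiffOn.sum fun l _ => (((h1 i k).mul (h1 j l)).mul (h2 i j)).mul (h2 k l)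
  refine key.congr ?_
  intro y hy
  have hy' : φ.symm y ∈ φ.source := φ.map_target hy
  have dF := hF.contMDiff.mdifferentiable (by simp) (φ.symm y)
  have dν := hν.mdifferentiable (by simp) (φ.symm y)
  have e1 := shapeMatrix_jac hy' dF dF
  have e2 := shapeMatrix_jac hy' dF dν
  rw [← hφ, φ.right_inv hy] at e1 e2
  rw [inChart, Function.comp_apply, shapeNormSq, ← sum_quad_inv_conj _ _ _ (isUnit_jac_det hy)]
  simp only [gramOf_eq_shapeMatrix]
  rw [← hφ, e1, e2]

lemma inner_fderiv_inChart_normal {F ν : M → W} (hF : ContMDiff (𝓡 n) 𝓘(ℝ, W) ∞ F)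
    (hν : IsUnitNormal n F ν) (p : M) :
    ∀ z ∈ (chartAt (EuclideanSpace ℝ (Fin n)) p).target, ∀ v,
      inner ℝ (fderiv ℝ (inChart F p) z v) (inChart ν p z) = 0 := by
  intro z hz v
  rw [← dAt_comp_dChartSymm hz (hF.mdifferentiable (by simp) _)]
  exact hν.orthogonal _ _

/-- Differentiating `⟨dF, ν⟩ = 0` trades the second derivative of `F` for a first derivative of `ν`.
In this form the second fundamental form visibly transforms as a tensor. -/
lemma gram_secondFF {F ν : M → W} (hF : ContMDiff (𝓡 n) 𝓘(ℝ, W) ∞ F) (hν : IsUnitNormal n F ν)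
    (x : M) : gram (secondFF n F ν) x = (shapeMatrix (dAt F x) (dAt ν x)).transpose := by
  ext i j
  set φ := chartAt (EuclideanSpace ℝ (Fin n)) x with hφ
  have hy : φ x ∈ φ.target := φ.map_source (mem_chart_source _ x)
  have h1 := inner_sndFDeriv_normal φ.open_target (contDiffOn_inChart hF x)
    (contDiffOn_inChart hν.contMDiff x) hy (inner_fderiv_inChart_normal hF hν x)
    (stdVec i) (stdVec j)
  have h2 : inChart ν x (φ x) = ν x := by
    simp only [inChart, Function.comp_apply]
    rw [← hφ, φ.left_inv (mem_chart_source _ x)]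
  have h3 : gram (secondFF n F ν) x i j = -inner ℝ (fderiv ℝ (fderiv ℝ (inChart F x)) (φ x)
    (stdVec i) (stdVec j)) (ν x) := rfl
  rw [h2] at h1
  rw [h3, h1, neg_neg, dAt_eq_fderiv (hF.mdifferentiable (by simp) x),
    dAt_eq_fderiv (hν.contMDiff.mdifferentiable (by simp) x)]
  rfl

lemma shapeMatrix_isSymm {F ν : M → W} (hF : ContMDiff (𝓡 n) 𝓘(ℝ, W) ∞ F)
    (hν : IsUnitNormal n F ν) (x : M) : (shapeMatrix (dAt (n := n) F x) (dAt ν x)).IsSymm := by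
  set φ := chartAt (EuclideanSpace ℝ (Fin n)) x with hφ
  have hy : φ x ∈ φ.target := φ.map_source (mem_chart_source _ x)
  rw [dAt_eq_fderiv (hF.mdifferentiable (by simp) x),
    dAt_eq_fderiv (hν.contMDiff.mdifferentiable (by simp) x)]
  ext i j
  have h1 := fun i j : Fin n => inner_sndFDeriv_normal φ.open_target (contDiffOn_inChart hF x)
    (contDiffOn_inChart hν.contMDiff x) hy (inner_fderiv_inChart_normal hF hν x)
    (stdVec i) (stdVec j)
  have h2 := h1 i j
  rw [sndFDeriv_symm φ.open_target (contDiffOn_inChart hF x) hy, h1 j i] at h2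
  exact (neg_inj.1 h2).symm

lemma meanCurvature_eq {F ν : M → W} (hF : ContMDiff (𝓡 n) 𝓘(ℝ, W) ∞ F) (hν : IsUnitNormal n F ν)
    (x : M) : meanCurvature n F ν x = traceForm (n := n) F F ν x := by
  rw [meanCurvature, gram_secondFF hF hν, (shapeMatrix_isSymm hF hν x).eq]
  rfl

lemma normSqA_eq {F ν : M → W} (hF : ContMDiff (𝓡 n) 𝓘(ℝ, W) ∞ F) (hν : IsUnitNormal n F ν)
    (x : M) : normSqA n F ν x = shapeNormSq (n := n) F ν x := by
  rw [normSqA, gram_secondFF hF hν, (shapeMatrix_isSymm hF hν x).eq]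
  rfl

end Tensors

/-! ### Measurability of charts on their domains. -/

section Measurability

variable {n : ℕ} {M : Type*} [TopologicalSpace M] [MeasurableSpace M] [BorelSpace M]

lemma measurableSet_target_inter_preimage (φ : OpenPartialHomeomorph M (EuclideanSpace ℝ (Fin n)))
    {S : Set M} (hS : MeasurableSet S) : MeasurableSet (φ.target ∩ φ.symm ⁻¹' S) := by
  have h1 : Measurable (φ.target.domRestrict φ.symm) :=
    (continuousOn_iff_continuous_domRestrict.1 φ.continuousOn_symm).measurable
  have h2 := φ.open_target.measurableSet.subtype_image (h1 hS)
  convert h2 using 1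
  ext y
  simp [Set.domRestrict, and_comm]

lemma measurableSet_source_inter_preimage (φ : OpenPartialHomeomorph M (EuclideanSpace ℝ (Fin n)))
    {S : Set (EuclideanSpace ℝ (Fin n))} (hS : MeasurableSet S) :
    MeasurableSet (φ.source ∩ φ ⁻¹' S) := by
  have h1 : Measurable (φ.source.domRestrict φ) :=
    (continuousOn_iff_continuous_domRestrict.1 φ.continuousOn).measurable
  have h2 := φ.open_source.measurableSet.subtype_image (h1 hS)
  convert h2 using 1
  ext y
  simp [Set.domRestrict, and_comm]

lemma aemeasurable_chart_symm (φ : OpenPartialHomeomorph M (EuclideanSpace ℝ (Fin n)))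
    (f : EuclideanSpace ℝ (Fin n) → ℝ≥0∞) :
    AEMeasurable φ.symm ((volume.restrict φ.target).withDensity f) :=
  (φ.continuousOn_symm.aemeasurable φ.open_target.measurableSet).mono_ac
    (withDensity_absolutelyContinuous _ _)

end Measurability

/-! ### The volume measure and its restriction to charts. -/

section Volume

variable {n : ℕ} {M : Type*} [TopologicalSpace M] [ChartedSpace (EuclideanSpace ℝ (Fin n)) M]
  {W : Type*} [NormedAddCommGroup W] [InnerProductSpace ℝ W]

/-- The volume density of the metric induced by `G`. -/
def density (G : EuclideanSpace ℝ (Fin n) → W) (y : EuclideanSpace ℝ (Fin n)) : ℝ :=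
  Real.sqrt (gramOf (fderiv ℝ G y)).det

lemma density_nonneg (G : EuclideanSpace ℝ (Fin n) → W) (y : EuclideanSpace ℝ (Fin n)) :
    0 ≤ density G y := Real.sqrt_nonneg _

lemma contDiffOn_density {G : EuclideanSpace ℝ (Fin n) → W} {U : Set (EuclideanSpace ℝ (Fin n))}
    (hU : IsOpen U) (hG : ContDiffOn ℝ ∞ G U)
    (hinj : ∀ z ∈ U, Function.Injective (fderiv ℝ G z)) : ContDiffOn ℝ ∞ (density G) U :=
  (contDiffOn_det (contDiffOn_gramOf hU hG)).sqrt fun z hz => (gramOf_det_pos (hinj z hz)).ne'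

lemma gramOf_comp (D : EuclideanSpace ℝ (Fin n) →L[ℝ] W)
    (L : EuclideanSpace ℝ (Fin n) →L[ℝ] EuclideanSpace ℝ (Fin n)) :
    (gramOf (D ∘L L)).det = L.det ^ 2 * (gramOf D).det := by
  have h1 : gramOf (D ∘L L) = (frameMatrix fun i => L (stdVec i)).transpose * gramOf D *
      frameMatrix fun i => L (stdVec i) := by
    ext a b
    rw [frameMatrix_conj, sum_gramOf]
    rfl
  have h2 : (frameMatrix fun i => L (stdVec i)).det = L.det := by
    have : (frameMatrix fun i => L (stdVec i))
        = LinearMap.toMatrix (EuclideanSpace.basisFun (Fin n) ℝ).toBasis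
          (EuclideanSpace.basisFun (Fin n) ℝ).toBasis
          (L : EuclideanSpace ℝ (Fin n) →ₗ[ℝ] EuclideanSpace ℝ (Fin n)) := by
      ext i j
      simp [frameMatrix, LinearMap.toMatrix_apply, stdVec]
    rw [this, LinearMap.det_toMatrix]
  rw [h1, Matrix.det_mul, Matrix.det_mul, Matrix.det_transpose, h2]
  ring

variable [MeasurableSpace M] [BorelSpace M]

variable [IsManifold (𝓡 n) ∞ M]

lemma chartVolume_apply {F : M → W} (hF : ContMDiff (𝓡 n) 𝓘(ℝ, W) ∞ F) (p : M) {S : Set M}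
    (hS : MeasurableSet S) :
    chartVolume (inducedMetric n F) p S
      = ∫⁻ y in (chartAt (EuclideanSpace ℝ (Fin n)) p).target ∩
        (chartAt (EuclideanSpace ℝ (Fin n)) p).symm ⁻¹' S,
          ENNReal.ofReal (density (inChart F p) y) := by
  set φ := chartAt (EuclideanSpace ℝ (Fin n)) p with hφ
  unfold chartVolume
  simp only
  rw [Measure.map_apply_of_aemeasurable (aemeasurable_chart_symm _ _) hS, withDensity_apply',
    Measure.restrict_restrict' φ.open_target.measurableSet, Set.inter_comm, ← hφ]
  refine setLIntegral_congr_fun (measurableSet_target_inter_preimage φ hS) fun y hy => ?_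
  rw [chartGram_inducedMetric hy.1 (hF.mdifferentiable (by simp))]
  rfl

lemma chartVolume_source_compl {F : M → W} (hF : ContMDiff (𝓡 n) 𝓘(ℝ, W) ∞ F) (p : M) :
    chartVolume (inducedMetric n F) p (chartAt (EuclideanSpace ℝ (Fin n)) p).sourceᶜ = 0 := by
  set φ := chartAt (EuclideanSpace ℝ (Fin n)) p with hφ
  rw [chartVolume_apply hF p φ.open_source.measurableSet.compl, ← hφ]
  have : φ.target ∩ φ.symm ⁻¹' φ.sourceᶜ = ∅ := by
    ext y
    simp only [Set.mem_inter_iff, Set.mem_preimage, Set.mem_compl_iff, Set.mem_empty_iff_false,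
      iff_false, not_and, not_not]
    exact fun hy => φ.map_target hy
  rw [this]
  simp

/-- The chart volumes agree on overlaps. -/
lemma chartVolume_le {F : M → W} (hF : ContMDiff (𝓡 n) 𝓘(ℝ, W) ∞ F) (p q : M) {S : Set M}
    (hS : MeasurableSet S) (hSp : S ⊆ (chartAt (EuclideanSpace ℝ (Fin n)) p).source) :
    chartVolume (inducedMetric n F) q S ≤ chartVolume (inducedMetric n F) p S := by
  have : IsManifold (𝓡 n) 1 M := IsManifold.of_le (n := ∞) (by simp)
  set φ := chartAt (EuclideanSpace ℝ (Fin n)) p with hφ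
  set χ := chartAt (EuclideanSpace ℝ (Fin n)) q with hχ
  rw [chartVolume_apply hF p hS, chartVolume_apply hF q hS, ← hφ, ← hχ]
  set A := χ.target ∩ χ.symm ⁻¹' S
  have hA : MeasurableSet A := measurableSet_target_inter_preimage χ hS
  let τ : EuclideanSpace ℝ (Fin n) → EuclideanSpace ℝ (Fin n) := fun y => φ (χ.symm y)
  have hτ : ∀ y ∈ A, DifferentiableAt ℝ τ y := fun y hy => by
    have h1 := mdifferentiableAt_atlas_symm (I := 𝓡 n)
      (chart_mem_atlas (EuclideanSpace ℝ (Fin n)) q) hy.1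
    have h2 := mdifferentiableAt_atlas (I := 𝓡 n)
      (chart_mem_atlas (EuclideanSpace ℝ (Fin n)) p) (hSp hy.2)
    exact mdifferentiableAt_iff_differentiableAt.1 (MDifferentiableAt.comp y h2 h1)
  have hinj : Set.InjOn τ A := fun y hy z hz hyz =>
    χ.symm.injOn hy.1 hz.1 (φ.injOn (hSp hy.2) (hSp hz.2) hyz)
  -- Change of variables along the transition map; the Jacobian determinant is absorbed by the
  -- transformation of the density. An inequality suffices, so only an inclusion of the image is
  -- needed.
  have hcv := lintegral_image_eq_lintegral_abs_det_fderiv_mul volume hA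
    (fun y hy => (hτ y hy).hasFDerivAt.hasFDerivWithinAt) hinj
    (fun y => ENNReal.ofReal (density (inChart F p) y))
  have hsub : τ '' A ⊆ φ.target ∩ φ.symm ⁻¹' S := by
    rintro _ ⟨y, hy, rfl⟩
    exact ⟨φ.map_source (hSp hy.2), by simpa [τ, φ.left_inv (hSp hy.2)] using hy.2⟩
  refine le_trans (le_of_eq ?_) (lintegral_mono_set hsub)
  rw [hcv]
  refine setLIntegral_congr_fun hA fun y hy => ?_
  rw [← ENNReal.ofReal_mul (abs_nonneg _)]
  congr 1
  have h1 : inChart F q =ᶠ[nhds y] fun z => inChart F p (τ z) := by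
    have hc : ContinuousAt χ.symm y := χ.symm.continuousAt hy.1
    filter_upwards [hc.preimage_mem_nhds (φ.open_source.mem_nhds (hSp hy.2))] with z hz
    simp only [inChart, Function.comp_apply, τ]
    rw [← hφ, φ.left_inv hz]
  have h2 : fderiv ℝ (inChart F q) y = fderiv ℝ (inChart F p) (τ y) ∘L fderiv ℝ τ y := by
    rw [h1.fderiv_eq, fderiv_fun_comp y _ (hτ y hy)]
    exact differentiableAt_of_contDiffOn φ.open_target (contDiffOn_inChart hF p)
      (φ.map_source (hSp hy.2))
  rw [density, h2, gramOf_comp, Real.sqrt_mul (sq_nonneg _), Real.sqrt_sq_eq_abs, density]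

/-- Consistency of the chart volumes makes the supremum over all charts no larger than a single
chart volume on that chart's domain. -/
lemma volumeMeasure_restrict {F : M → W} (hF : ContMDiff (𝓡 n) 𝓘(ℝ, W) ∞ F) (p : M) :
    (volumeMeasure (inducedMetric n F)).restrict (chartAt (EuclideanSpace ℝ (Fin n)) p).source
      = chartVolume (inducedMetric n F) p := by
  set φ := chartAt (EuclideanSpace ℝ (Fin n)) p with hφ
  have hsrc : MeasurableSet φ.source := φ.open_source.measurableSet
  refine le_antisymm ?_ ?_
  -- A common upper bound for all chart volumes: sharp on the chart domain, and the largest measure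
  -- outside of it, where nothing is claimed.
  · set ρ : Measure M := chartVolume (inducedMetric n F) p + (⊤ : Measure M).restrict φ.sourceᶜ
    have hle : volumeMeasure (inducedMetric n F) ≤ ρ := by
      refine iSup_le fun q => Measure.le_iff.2 fun S hS => ?_
      rw [← measure_inter_add_sdiff S hsrc, Measure.add_apply, Measure.restrict_apply hS,
        ← Set.sdiff_eq]
      refine add_le_add ?_ (Measure.le_iff'.1 le_top _)
      exact (chartVolume_le hF p q (hS.inter hsrc) Set.inter_subset_right).trans
        (measure_mono Set.inter_subset_left)
    refine Measure.le_iff.2 fun S hS => ?_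
    rw [Measure.restrict_apply hS]
    refine (Measure.le_iff'.1 hle _).trans ?_
    rw [Measure.add_apply, Measure.restrict_apply (hS.inter hsrc)]
    have : S ∩ φ.source ∩ φ.sourceᶜ = ∅ := by
      rw [Set.inter_assoc, Set.inter_compl_self, Set.inter_empty]
    rw [this, measure_empty, add_zero]
    exact measure_mono Set.inter_subset_left
  · refine Measure.le_iff.2 fun S hS => ?_
    rw [Measure.restrict_apply hS, ← measure_inter_add_sdiff S hsrc]
    have h0 : chartVolume (inducedMetric n F) p (S \ φ.source) = 0 :=
      measure_mono_null (fun x hx => hx.2) (chartVolume_source_compl hF p)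
    rw [h0, add_zero]
    exact Measure.le_iff'.1 (le_iSup (fun q => chartVolume (inducedMetric n F) q) p) _

/-- Countably many chart domains cover `M`, so a measure is determined by its restrictions to them.
The volume measures of an open subset and of the conformal metric are identified in this way. -/
lemma eq_volumeMeasure [SecondCountableTopology M] {F : M → W}
    (hF : ContMDiff (𝓡 n) 𝓘(ℝ, W) ∞ F) {μ : Measure M}
    (hμ : ∀ p, μ.restrict (chartAt (EuclideanSpace ℝ (Fin n)) p).source
      = chartVolume (inducedMetric n F) p) : μ = volumeMeasure (inducedMetric n F) := by
  obtain ⟨s, hs, hcov⟩ := TopologicalSpace.countable_cover_nhds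
    (fun x : M => (chartAt (EuclideanSpace ℝ (Fin n)) x).open_source.mem_nhds (mem_chart_source _ x))
  refine (Measure.ext_iff_of_biUnion_eq_univ hs hcov).2 fun p _ => ?_
  rw [hμ, volumeMeasure_restrict hF]

lemma volumeMeasure_apply {F : M → W} (hF : ContMDiff (𝓡 n) 𝓘(ℝ, W) ∞ F) (p : M) {S : Set M}
    (hS : MeasurableSet S) (hSp : S ⊆ (chartAt (EuclideanSpace ℝ (Fin n)) p).source) :
    volumeMeasure (inducedMetric n F) S
      = ∫⁻ y in (chartAt (EuclideanSpace ℝ (Fin n)) p).target ∩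
        (chartAt (EuclideanSpace ℝ (Fin n)) p).symm ⁻¹' S,
          ENNReal.ofReal (density (inChart F p) y) := by
  rw [← chartVolume_apply hF p hS, ← volumeMeasure_restrict hF, Measure.restrict_apply hS,
    Set.inter_eq_left.2 hSp]

/-- A property that holds almost everywhere in a chart. -/
lemma ae_of_ae_chart {F : M → W} (hF : ContMDiff (𝓡 n) 𝓘(ℝ, W) ∞ F) (p : M) {P : M → Prop}
    (hP : ∀ᵐ y ∂(volume : Measure (EuclideanSpace ℝ (Fin n))),
      y ∈ (chartAt (EuclideanSpace ℝ (Fin n)) p).target →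
        P ((chartAt (EuclideanSpace ℝ (Fin n)) p).symm y)) :
    ∀ᵐ x ∂(volumeMeasure (inducedMetric n F)),
      x ∈ (chartAt (EuclideanSpace ℝ (Fin n)) p).source → P x := by
  set φ := chartAt (EuclideanSpace ℝ (Fin n)) p with hφ
  obtain ⟨Z, hZ, hZm, hZ0⟩ := exists_measurable_superset_of_null (ae_iff.1 hP)
  have hS := measurableSet_source_inter_preimage φ hZm
  rw [ae_iff]
  refine measure_mono_null (t := φ.source ∩ φ ⁻¹' Z) ?_ ?_
  · intro x hx
    simp only [Set.mem_ofPred_eq, Classical.not_imp] at hx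
    refine ⟨hx.1, hZ ?_⟩
    simp only [Set.mem_ofPred_eq, Classical.not_imp, φ.left_inv hx.1]
    exact ⟨φ.map_source hx.1, hx.2⟩
  · rw [volumeMeasure_apply hF p hS Set.inter_subset_left, ← hφ]
    refine setLIntegral_measure_zero _ _ (measure_mono_null (t := Z) ?_ hZ0)
    rintro y ⟨hy, hy'⟩
    have := hy'.2
    rwa [Set.mem_preimage, φ.right_inv hy] at this

lemma isLocallyFiniteMeasure_volumeMeasure {F : M → W} (hF : IsSmoothImmersion n F) :
    IsLocallyFiniteMeasure (volumeMeasure (inducedMetric n F)) := by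
  refine ⟨fun x => ?_⟩
  set φ := chartAt (EuclideanSpace ℝ (Fin n)) x with hφ
  have hx : x ∈ φ.source := mem_chart_source _ x
  obtain ⟨ε, hε, hball⟩ := Metric.nhds_basis_closedBall.mem_iff.1
    (φ.open_target.mem_nhds (φ.map_source hx))
  refine ⟨φ.source ∩ φ ⁻¹' Metric.closedBall (φ x) ε, ?_, ?_⟩
  · exact Filter.inter_mem (φ.open_source.mem_nhds hx)
      ((φ.continuousAt hx).preimage_mem_nhds (Metric.closedBall_mem_nhds _ hε))
  · rw [volumeMeasure_apply hF.contMDiff x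
      (measurableSet_source_inter_preimage φ measurableSet_closedBall) Set.inter_subset_left]
    have hsub : φ.target ∩ φ.symm ⁻¹' (φ.source ∩ φ ⁻¹' Metric.closedBall (φ x) ε)
        ⊆ Metric.closedBall (φ x) ε := by
      rintro y ⟨hy, hy'⟩
      have := hy'.2
      rwa [Set.mem_preimage, φ.right_inv hy] at this
    refine (lintegral_mono_set hsub).trans_lt ?_
    have hc : ContinuousOn (density (inChart F x)) (Metric.closedBall (φ x) ε) :=
      (contDiffOn_density φ.open_target (contDiffOn_inChart hF.contMDiff x)
        (injective_fderiv_inChart hF x)).continuousOn.mono hball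
    have hi := hc.integrableOn_compact (μ := volume) (isCompact_closedBall _ _)
    exact hi.lintegral_lt_top

lemma integral_eq_chart {F : M → W} (hF : IsSmoothImmersion n F) (p : M) {f : M → ℝ}
    (hf : Continuous f) (hfp : Function.support f ⊆ (chartAt (EuclideanSpace ℝ (Fin n)) p).source) :
    ∫ x, f x ∂(volumeMeasure (inducedMetric n F))
      = ∫ y in (chartAt (EuclideanSpace ℝ (Fin n)) p).target,
        density (inChart F p) y * inChart f p y := by
  set φ := chartAt (EuclideanSpace ℝ (Fin n)) p with hφ
  have h1 : ∫ x in φ.source, f x ∂(volumeMeasure (inducedMetric n F))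
      = ∫ x, f x ∂(volumeMeasure (inducedMetric n F)) :=
    setIntegral_eq_integral_of_forall_compl_eq_zero fun x hx => by
      by_contra h
      exact hx (hfp h)
  have hd : Set.EqOn (fun y => ENNReal.ofReal (Real.sqrt (chartGram (inducedMetric n F) p y).det))
      (fun y => ENNReal.ofReal (density (inChart F p) y)) φ.target := fun y hy => by
    simp only
    rw [chartGram_inducedMetric hy (hF.contMDiff.mdifferentiable (by simp))]
    rfl
  have hae : (fun y => ENNReal.ofReal (Real.sqrt (chartGram (inducedMetric n F) p y).det))
      =ᵐ[volume.restrict φ.target] (fun y => ENNReal.ofReal (density (inChart F p) y)) :=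
    (ae_restrict_iff' φ.open_target.measurableSet).2 (Filter.Eventually.of_forall hd)
  have hdm : AEMeasurable (fun y => (density (inChart F p) y)) (volume.restrict φ.target) :=
    (contDiffOn_density φ.open_target (contDiffOn_inChart hF.contMDiff p)
        (injective_fderiv_inChart hF p)).continuousOn.aemeasurable φ.open_target.measurableSet
  rw [← h1, volumeMeasure_restrict hF.contMDiff, chartVolume]
  rw [integral_map (aemeasurable_chart_symm _ _) hf.aestronglyMeasurable, ← hφ,
    withDensity_congr_ae hae, integral_withDensity_eq_integral_toReal_smul₀ hdm.ennreal_ofReal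
      (Filter.Eventually.of_forall fun _ => ENNReal.ofReal_lt_top)]
  refine integral_congr_ae (Filter.Eventually.of_forall fun y => ?_)
  simp only [ENNReal.toReal_ofReal (density_nonneg _ _), smul_eq_mul]
  rfl

end Volume

/-! ### Harmonic coordinates and the first variation formula in a chart. -/

section LocalFirstVariation

variable {n : ℕ} {W : Type*} [NormedAddCommGroup W] [InnerProductSpace ℝ W]
  {G ν Z : EuclideanSpace ℝ (Fin n) → W} {U K : Set (EuclideanSpace ℝ (Fin n))}
  {y : EuclideanSpace ℝ (Fin n)}

/-- The vector `√g ∑ᵢ gⁱʲ ∂ᵢG`. -/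
def coDiff (G : EuclideanSpace ℝ (Fin n) → W) (j : Fin n) (z : EuclideanSpace ℝ (Fin n)) : W :=
  ∑ i, (density G z * (gramOf (fderiv ℝ G z))⁻¹ i j) • fderiv ℝ G z (stdVec i)

lemma contDiffOn_coDiff (hU : IsOpen U) (hG : ContDiffOn ℝ ∞ G U)
    (hinj : ∀ z ∈ U, Function.Injective (fderiv ℝ G z)) (j : Fin n) :
    ContDiffOn ℝ ∞ (coDiff G j) U :=
  ContDiffOn.sum fun _ _ => ((contDiffOn_density hU hG hinj).mul
    (contDiffOn_inv (contDiffOn_gramOf hU hG) (fun z hz => (gramOf_det_pos (hinj z hz)).ne') _ _)).smul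
      (contDiffOn_fderiv_apply hU hG _)

lemma inner_coDiff (G : EuclideanSpace ℝ (Fin n) → W) (j : Fin n) (z : EuclideanSpace ℝ (Fin n))
    (w : W) : inner ℝ (coDiff G j z) w
      = density G z * ∑ i, (gramOf (fderiv ℝ G z))⁻¹ i j * inner ℝ (fderiv ℝ G z (stdVec i)) w := by
  simp only [coDiff, sum_inner, real_inner_smul_left, Finset.mul_sum, mul_assoc]

lemma sum_inner_coDiff (G Z : EuclideanSpace ℝ (Fin n) → W) (z : EuclideanSpace ℝ (Fin n)) :
    ∑ j, inner ℝ (coDiff G j z) (fderiv ℝ Z z (stdVec j)) = density G z * traceFormLoc G G Z z := by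
  simp only [inner_coDiff, ← Finset.mul_sum]
  rw [Finset.sum_comm]
  rfl

lemma inner_coDiff_tangent (hinj : Function.Injective (fderiv ℝ G y)) (j k : Fin n) :
    inner ℝ (coDiff G j y) (fderiv ℝ G y (stdVec k)) = if j = k then density G y else 0 := by
  have hd : IsUnit (gramOf (fderiv ℝ G y)).det := (gramOf_det_pos hinj).ne'.isUnit
  have h1 : ∑ i, (gramOf (fderiv ℝ G y))⁻¹ i j *
      inner ℝ (fderiv ℝ G y (stdVec i)) (fderiv ℝ G y (stdVec k))
      = (gramOf (fderiv ℝ G y) * (gramOf (fderiv ℝ G y))⁻¹) k j := by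
    rw [Matrix.mul_apply]
    refine Finset.sum_congr rfl fun i _ => ?_
    rw [gramOf_apply, real_inner_comm, mul_comm]
  rw [inner_coDiff, h1, Matrix.mul_nonsing_inv _ hd, Matrix.one_apply]
  by_cases h : j = k
  · simp [h]
  · simp [h, Ne.symm h]

/-- Jacobi's formula for the determinant of the Gram matrix; its symmetry makes the two terms of
each metric derivative contribute equally, which cancels the `1/2` of the square root. -/
lemma partialD_density (hU : IsOpen U) (hG : ContDiffOn ℝ ∞ G U)
    (hinj : ∀ z ∈ U, Function.Injective (fderiv ℝ G z)) (hy : y ∈ U) (k : Fin n) :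
    partialD k (density G) y = density G y * ∑ j, ∑ i, (gramOf (fderiv ℝ G y))⁻¹ i j *
      inner ℝ (fderiv ℝ G y (stdVec i)) (sndD G y k j) := by
  have hpos := gramOf_det_pos (hinj y hy)
  have h1 := hasFDerivAt_det (A := fun z => gramOf (fderiv ℝ G z)) (x := y)
    (fun i j => (differentiableAt_of_contDiffOn hU (contDiffOn_gramOf hU hG i j) hy).hasFDerivAt)
  have h2 := h1.sqrt hpos.ne'
  have h3 : fderiv ℝ (density G) y = _ := h2.fderiv
  have hinv : ∀ i j, (gramOf (fderiv ℝ G y))⁻¹ i j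
      = (gramOf (fderiv ℝ G y)).det⁻¹ * (gramOf (fderiv ℝ G y)).adjugate i j := fun i j => by
    rw [Matrix.inv_def, Ring.inverse_eq_inv]
    rfl
  have hsymm : ∀ i j, (gramOf (fderiv ℝ G y))⁻¹ i j = (gramOf (fderiv ℝ G y))⁻¹ j i := fun i j => by
    have := (gramOf_isSymm (fderiv ℝ G y)).eq
    conv_rhs => rw [← this, ← Matrix.transpose_nonsing_inv]
    rfl
  have hk : ∀ i j, (fderiv ℝ (fun z => gramOf (fderiv ℝ G z) i j) y) (stdVec k) =
      inner ℝ (sndD G y k i) (fderiv ℝ G y (stdVec j))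
        + inner ℝ (fderiv ℝ G y (stdVec i)) (sndD G y k j) :=
    fun i j => partialD_gramOf hU hG hy k i j
  have hs : density G y ^ 2 = (gramOf (fderiv ℝ G y)).det := Real.sq_sqrt hpos.le
  have hs0 : density G y ≠ 0 := (Real.sqrt_pos.2 hpos).ne'
  have e1 : ∑ i, ∑ j, (gramOf (fderiv ℝ G y)).adjugate i j *
      (inner ℝ (sndD G y k j) (fderiv ℝ G y (stdVec i))
        + inner ℝ (fderiv ℝ G y (stdVec j)) (sndD G y k i))
      = density G y ^ 2 * (2 * ∑ j, ∑ i, (gramOf (fderiv ℝ G y))⁻¹ i j *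
        inner ℝ (fderiv ℝ G y (stdVec i)) (sndD G y k j)) := by
    have e2 : ∀ i j, (gramOf (fderiv ℝ G y)).adjugate i j
        = density G y ^ 2 * (gramOf (fderiv ℝ G y))⁻¹ i j := fun i j => by
      rw [hinv, hs, mul_inv_cancel_left₀ hpos.ne']
    simp only [e2, mul_assoc, ← Finset.mul_sum]
    congr 1
    simp only [mul_add, Finset.sum_add_distrib]
    rw [two_mul]
    congr 1
    · rw [Finset.sum_comm]
      refine Finset.sum_congr rfl fun i _ => Finset.sum_congr rfl fun j _ => ?_
      rw [real_inner_comm]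
    · refine Finset.sum_congr rfl fun i _ => Finset.sum_congr rfl fun j _ => ?_
      rw [hsymm]
  unfold partialD
  rw [h3]
  simp only [smul_apply, sum_apply, smul_eq_mul, hk]
  rw [e1]
  change 1 / (2 * density G y) * _ = _
  field_simp

/-- The coordinate vector fields of a minimal immersion are harmonic. -/
lemma sum_fderiv_coDiff_eq_zero [FiniteDimensional ℝ W] (hW : Module.finrank ℝ W = n + 1)
    (hU : IsOpen U) (hG : ContDiffOn ℝ ∞ G U)
    (hinj : ∀ z ∈ U, Function.Injective (fderiv ℝ G z)) (hν : ContDiffOn ℝ ∞ ν U)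
    (hν1 : ∀ z ∈ U, ‖ν z‖ = 1) (hGν : ∀ z ∈ U, ∀ v, inner ℝ (fderiv ℝ G z v) (ν z) = 0)
    (hmin : ∀ z ∈ U, traceFormLoc G G ν z = 0) (hy : y ∈ U) :
    ∑ j, fderiv ℝ (coDiff G j) y (stdVec j) = 0 := by
  set Y := ∑ j, fderiv ℝ (coDiff G j) y (stdVec j) with hY
  have hX := contDiffOn_coDiff hU hG hinj
  -- Normal component: differentiating `⟨X_j, ν⟩ = 0` leaves minus the density times the mean
  -- curvature.
  have hYν : inner ℝ Y (ν y) = 0 := by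
    have h1 : ∀ j, inner ℝ (fderiv ℝ (coDiff G j) y (stdVec j)) (ν y)
        = -inner ℝ (coDiff G j y) (fderiv ℝ ν y (stdVec j)) := fun j => by
      have h2 := fderiv_inner_apply' hU (hX j) hν hy (stdVec j)
      have h3 : fderiv ℝ (fun z => inner ℝ (coDiff G j z) (ν z)) y (stdVec j) = 0 := by
        rw [Filter.EventuallyEq.fderiv_eq (f := fun _ => (0 : ℝ))
          (Filter.eventuallyEq_of_mem (hU.mem_nhds hy) fun z hz => ?_)]
        · simp
        · rw [inner_coDiff]
          simp [hGν z hz]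
      rw [h3] at h2
      linarith
    rw [hY, sum_inner]
    simp only [h1, Finset.sum_neg_distrib]
    rw [sum_inner_coDiff, hmin y hy, mul_zero, neg_zero]
  -- Tangential component: differentiating `⟨X_j, ∂_k G⟩ = δ_jk √g` leaves `∂_k √g` minus exactly
  -- the expression found in `partialD_density`.
  have hYT : ∀ k, inner ℝ Y (fderiv ℝ G y (stdVec k)) = 0 := fun k => by
    have h1 : ∀ j, inner ℝ (fderiv ℝ (coDiff G j) y (stdVec j)) (fderiv ℝ G y (stdVec k))
        = (if j = k then partialD k (density G) y else 0)
          - inner ℝ (coDiff G j y) (sndD G y j k) := fun j => by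
      have h2 := fderiv_inner_apply' hU (hX j) (contDiffOn_fderiv_apply hU hG (stdVec k)) hy
        (stdVec j)
      have h3 : fderiv ℝ (fun z => inner ℝ (coDiff G j z) (fderiv ℝ G z (stdVec k))) y (stdVec j)
          = if j = k then partialD k (density G) y else 0 := by
        rw [Filter.EventuallyEq.fderiv_eq (f := fun z => if j = k then density G z else 0)
          (Filter.eventuallyEq_of_mem (hU.mem_nhds hy) fun z hz =>
            inner_coDiff_tangent (hinj z hz) j k)]
        by_cases h : j = k
        · simp [h, partialD]
        · simp [h]
      rw [h3, fderiv_fderiv_apply hU hG hy] at h2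
      have h4 : fderiv ℝ (fderiv ℝ G) y (stdVec j) (stdVec k) = sndD G y j k := rfl
      rw [h4] at h2
      linarith
    rw [hY, sum_inner]
    simp only [h1, Finset.sum_sub_distrib, Finset.sum_ite_eq', Finset.mem_univ, if_true]
    rw [partialD_density hU hG hinj hy, Finset.mul_sum]
    refine sub_eq_zero.2 (Finset.sum_congr rfl fun j _ => ?_)
    rw [inner_coDiff, sndD_symm hU hG hy j k]
  have hYD : ∀ v, inner ℝ Y (fderiv ℝ G y v) = 0 := fun v => by
    rw [← sum_smul_stdVec v, map_sum, inner_sum]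
    simp [real_inner_smul_right, hYT]
  obtain ⟨e, -, he⟩ := exists_frame_extension (hinj y hy) ∅ (fun _ => 0) (by simp)
  have hN : Orthonormal ℝ (fun _ : Unit => ν y) := by
    rw [orthonormal_iff_ite]
    simp [hν1 y hy]
  have := parseval (orthonormal_sum he hN fun a _ => hGν y hy _) (by simp [hW]) Y Y
  simp only [Fintype.sum_sum_type, Sum.elim_inl, Sum.elim_inr, hYD, hYν, mul_zero,
    Finset.sum_const_zero, add_zero] at this
  exact inner_self_eq_zero.1 this

lemma integral_fderiv_eq_zero {f : EuclideanSpace ℝ (Fin n) → ℝ} (hf : ContDiff ℝ 1 f)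
    (hfc : HasCompactSupport f) (v : EuclideanSpace ℝ (Fin n)) : ∫ z, fderiv ℝ f z v = 0 := by
  have h := integral_mul_fderiv_eq_neg_fderiv_mul_of_integrable (μ := volume) (v := v)
    (f := fun _ : EuclideanSpace ℝ (Fin n) => (1 : ℝ)) (g := f) (𝕜 := ℝ)
    (by simp) ?_ ?_ (by fun_prop) (fun x _ => hf.differentiable (by simp) x)
  · simpa using h
  · simp only [one_mul]
    exact ((hf.continuous_fderiv (by simp)).clm_apply continuous_const).integrable_of_hasCompactSupport
      (hfc.fderiv_apply ℝ v)
  · simp only [one_mul]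
    exact hf.continuous.integrable_of_hasCompactSupport hfc

lemma indicator_eventuallyEq {f : EuclideanSpace ℝ (Fin n) → ℝ} (hU : IsOpen U) (hy : y ∈ U) :
    U.indicator f =ᶠ[nhds y] f :=
  Filter.eventuallyEq_of_mem (hU.mem_nhds hy) fun _ hz => Set.indicator_of_mem hz f

lemma indicator_eventuallyEq_zero {f : EuclideanSpace ℝ (Fin n) → ℝ} (hK : IsClosed K)
    (hf : ∀ z ∈ U, z ∉ K → f z = 0) (hy : y ∉ K) :
    U.indicator f =ᶠ[nhds y] fun _ => 0 := by
  filter_upwards [hK.isOpen_compl.mem_nhds hy] with z hz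
  by_cases h : z ∈ U
  · rw [Set.indicator_of_mem h, hf z h hz]
  · exact Set.indicator_of_notMem h _

lemma contDiff_indicator {f : EuclideanSpace ℝ (Fin n) → ℝ} (hU : IsOpen U) (hK : IsClosed K)
    (hKU : K ⊆ U) (hfs : ContDiffOn ℝ ∞ f U) (hf : ∀ z ∈ U, z ∉ K → f z = 0) :
    ContDiff ℝ ∞ (U.indicator f) := by
  rw [contDiff_iff_contDiffAt]
  intro z
  by_cases hz : z ∈ K
  · exact (hfs.contDiffAt (hU.mem_nhds (hKU hz))).congr_of_eventuallyEq
      (indicator_eventuallyEq hU (hKU hz))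
  · exact contDiffAt_const.congr_of_eventuallyEq (indicator_eventuallyEq_zero hK hf hz)

/-- The first variation formula in a chart. -/
lemma integral_density_mul_traceFormLoc [FiniteDimensional ℝ W] (hW : Module.finrank ℝ W = n + 1)
    (hU : IsOpen U) (hG : ContDiffOn ℝ ∞ G U)
    (hinj : ∀ z ∈ U, Function.Injective (fderiv ℝ G z)) (hν : ContDiffOn ℝ ∞ ν U)
    (hν1 : ∀ z ∈ U, ‖ν z‖ = 1) (hGν : ∀ z ∈ U, ∀ v, inner ℝ (fderiv ℝ G z v) (ν z) = 0)
    (hmin : ∀ z ∈ U, traceFormLoc G G ν z = 0) (hK : IsCompact K) (hKU : K ⊆ U)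
    (hZ : ContDiffOn ℝ ∞ Z U) (hZK : ∀ z ∈ U, z ∉ K → Z z = 0) :
    ∫ z in U, density G z * traceFormLoc G G Z z = 0 := by
  have hX := contDiffOn_coDiff hU hG hinj
  -- The components of a compactly supported vector field whose divergence is the integrand, because
  -- the `coDiff G j` are jointly divergence free.
  let b : Fin n → EuclideanSpace ℝ (Fin n) → ℝ :=
    fun j => U.indicator fun z => inner ℝ (coDiff G j z) (Z z)
  have hb0 : ∀ j, ∀ z ∈ U, z ∉ K → inner ℝ (coDiff G j z) (Z z) = 0 := fun j z hz hzK => by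
    rw [hZK z hz hzK, inner_zero_right]
  have hb : ∀ j, ContDiff ℝ ∞ (b j) := fun j =>
    contDiff_indicator hU hK.isClosed hKU ((hX j).inner ℝ hZ) (hb0 j)
  have hbc : ∀ j, HasCompactSupport (b j) := fun j =>
    HasCompactSupport.intro hK fun z hz =>
      (indicator_eventuallyEq_zero hK.isClosed (hb0 j) hz).self_of_nhds
  have hb1 : ∀ j, ∀ z ∈ U, fderiv ℝ (b j) z (stdVec j)
      = inner ℝ (fderiv ℝ (coDiff G j) z (stdVec j)) (Z z)
        + inner ℝ (coDiff G j z) (fderiv ℝ Z z (stdVec j)) := fun j z hz => by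
    rw [(indicator_eventuallyEq hU hz).fderiv_eq, fderiv_inner_apply' hU (hX j) hZ hz]
  have hint : ∀ z ∈ U, density G z * traceFormLoc G G Z z
      = ∑ j, fderiv ℝ (b j) z (stdVec j) := fun z hz => by
    rw [Finset.sum_congr rfl fun j _ => hb1 j z hz, Finset.sum_add_distrib, sum_inner_coDiff,
      ← sum_inner, sum_fderiv_coDiff_eq_zero hW hU hG hinj hν hν1 hGν hmin hz, inner_zero_left,
      zero_add]
  rw [setIntegral_congr_fun hU.measurableSet hint,
    setIntegral_eq_integral_of_forall_compl_eq_zero, integral_finsetSum]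
  · exact Finset.sum_eq_zero fun j _ =>
      integral_fderiv_eq_zero ((hb j).of_le (by simp)) (hbc j) _
  · intro j _
    exact (((hb j).continuous_fderiv (by simp)).clm_apply
      continuous_const).integrable_of_hasCompactSupport ((hbc j).fderiv_apply ℝ _)
  · intro z hz
    refine Finset.sum_eq_zero fun j _ => ?_
    rw [(indicator_eventuallyEq_zero hK.isClosed (hb0 j) fun h => hz (hKU h)).fderiv_eq]
    simp

end LocalFirstVariation

/-! ### Rules of differentiation for the differential on the manifold. -/

section Calculus

variable {n : ℕ} {M : Type*} [TopologicalSpace M] [ChartedSpace (EuclideanSpace ℝ (Fin n)) M]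

lemma inChart_self {V : Type*} (f : M → V) (x : M) :
    inChart (n := n) f x (chartAt (EuclideanSpace ℝ (Fin n)) x x) = f x := by
  simp [inChart, (chartAt (EuclideanSpace ℝ (Fin n)) x).left_inv (mem_chart_source _ x)]

variable {V : Type*} [NormedAddCommGroup V] [NormedSpace ℝ V]

lemma dAt_congr {f g : M → V} {x : M} (h : f =ᶠ[nhds x] g) :
    dAt (n := n) f x = dAt g x := h.mfderiv_eq

lemma dAt_const (c : V) (x : M) : dAt (n := n) (fun _ : M => c) x = 0 := mfderiv_const

lemma dAt_eq_zero_of_notMem_tsupport {f : M → V} {x : M} (hx : x ∉ tsupport f) :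
    dAt (n := n) f x = 0 := by
  have : f =ᶠ[nhds x] fun _ => 0 := notMem_tsupport_iff_eventuallyEq.1 hx
  rw [dAt_congr this, dAt_const]

lemma differentiableAt_inChart_self {f : M → V} {x : M}
    (hf : MDifferentiableAt (𝓡 n) 𝓘(ℝ, V) f x) :
    DifferentiableAt ℝ (inChart (n := n) f x) (chartAt (EuclideanSpace ℝ (Fin n)) x x) := by
  have h := (mdifferentiableAt_iff _ _).1 hf
  have h2 := h.2
  simp only [mfld_simps, differentiableWithinAt_univ, writtenInExtChartAt] at h2
  exact h2

lemma dAt_add {f g : M → V} {x : M} (hf : MDifferentiableAt (𝓡 n) 𝓘(ℝ, V) f x)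
    (hg : MDifferentiableAt (𝓡 n) 𝓘(ℝ, V) g x) :
    dAt (n := n) (fun x => f x + g x) x = dAt f x + dAt g x := by
  have h1 : MDifferentiableAt (𝓡 n) 𝓘(ℝ, V) (fun x => f x + g x) x := hf.add hg
  rw [dAt_eq_fderiv h1, dAt_eq_fderiv hf, dAt_eq_fderiv hg]
  exact fderiv_add (differentiableAt_inChart_self hf) (differentiableAt_inChart_self hg)

lemma dAt_comp {V' : Type*} [NormedAddCommGroup V'] [NormedSpace ℝ V'] {f : M → V} {c : V → V'}
    {x : M} (hc : DifferentiableAt ℝ c (f x)) (hf : MDifferentiableAt (𝓡 n) 𝓘(ℝ, V) f x) :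
    dAt (n := n) (fun x => c (f x)) x = fderiv ℝ c (f x) ∘L dAt f x := by
  have h1 : MDifferentiableAt (𝓡 n) 𝓘(ℝ, V') (fun x => c (f x)) x :=
    MDifferentiableAt.comp x hc.mdifferentiableAt hf
  have h2 := inChart_self (n := n) f x
  rw [dAt_eq_fderiv h1, dAt_eq_fderiv hf]
  conv_rhs => rw [← h2]
  exact fderiv_comp _ (by rwa [h2]) (differentiableAt_inChart_self hf)

variable [IsManifold (𝓡 n) ∞ M]

lemma dAt_sum {ι : Type*} (s : Finset ι) {f : ι → M → V} {x : M}
    (hf : ∀ i ∈ s, MDifferentiableAt (𝓡 n) 𝓘(ℝ, V) (f i) x) :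
    dAt (n := n) (fun x => ∑ i ∈ s, f i x) x = ∑ i ∈ s, dAt (f i) x := by
  classical
  induction s using Finset.induction_on with
  | empty => simp [dAt_const]
  | insert a s ha ih =>
    have h1 := ih fun i hi => hf i (Finset.mem_insert_of_mem hi)
    have h2 : MDifferentiableAt (𝓡 n) 𝓘(ℝ, V) (fun x => ∑ i ∈ s, f i x) x := by
      refine mdifferentiableAt_of_inChart (p := x) (mem_chart_source _ x) ?_
      exact DifferentiableAt.fun_sum fun i hi =>
        differentiableAt_inChart_self (hf i (Finset.mem_insert_of_mem hi))
    simp only [Finset.sum_insert ha]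
    rw [dAt_add (hf a (Finset.mem_insert_self _ _)) h2, h1]

lemma dAt_smul {f : M → ℝ} {g : M → V} {x : M} (hf : MDifferentiableAt (𝓡 n) 𝓘(ℝ, ℝ) f x)
    (hg : MDifferentiableAt (𝓡 n) 𝓘(ℝ, V) g x) (v : EuclideanSpace ℝ (Fin n)) :
    dAt (n := n) (fun x => f x • g x) x v = f x • dAt g x v + dAt f x v • g x := by
  have hd := (differentiableAt_inChart_self hf).hasFDerivAt.smul
    (differentiableAt_inChart_self hg).hasFDerivAt
  have h1 : MDifferentiableAt (𝓡 n) 𝓘(ℝ, V) (fun x => f x • g x) x :=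
    mdifferentiableAt_of_inChart (p := x) (mem_chart_source _ x) hd.differentiableAt
  have h3 : fderiv ℝ (inChart (n := n) (fun x => f x • g x) x)
    (chartAt (EuclideanSpace ℝ (Fin n)) x x) = _ := hd.fderiv
  rw [dAt_eq_fderiv h1, dAt_eq_fderiv hf, dAt_eq_fderiv hg, h3, inChart_self, inChart_self]
  simp

end Calculus

/-! ### Localisation to chart domains. -/

section PartitionOfUnity

variable {n : ℕ} {M : Type*} [TopologicalSpace M] [T2Space M] [SecondCountableTopology M]
  [ChartedSpace (EuclideanSpace ℝ (Fin n)) M] [IsManifold (𝓡 n) ∞ M]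

/-- A finite smooth partition of unity near a compact set, subordinate to chart domains. -/
lemma exists_finite_partition {K : Set M} (hK : IsCompact K) :
    ∃ (s : Finset M) (χ : M → M → ℝ), (∀ p, ContMDiff (𝓡 n) 𝓘(ℝ, ℝ) ∞ (χ p)) ∧
      (∀ p, tsupport (χ p) ⊆ (chartAt (EuclideanSpace ℝ (Fin n)) p).source) ∧
      ∀ x ∈ K, ∑ p ∈ s, χ p x = 1 := by
  have : LocallyCompactSpace M := ChartedSpace.locallyCompactSpace (EuclideanSpace ℝ (Fin n)) M
  obtain ⟨ρ, hρ⟩ := SmoothPartitionOfUnity.exists_isSubordinate_chartAt_source (𝓡 n) M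
  have hfin := ρ.locallyFinite.finite_nonempty_inter_compact hK
  refine ⟨hfin.toFinset, fun p => ρ p, fun p => (ρ p).contMDiff, hρ, fun x hx => ?_⟩
  refine ρ.sum_finsupport' x (Set.mem_univ x) fun p hp => ?_
  rw [Set.Finite.mem_toFinset]
  exact ⟨x, (ρ.mem_finsupport x).1 hp, hx⟩

end PartitionOfUnity

/-! ### The first variation formula on the manifold. -/

section FirstVariation

variable {n : ℕ} {M : Type*} [TopologicalSpace M] [ChartedSpace (EuclideanSpace ℝ (Fin n)) M]
  {W : Type*} [NormedAddCommGroup W] [InnerProductSpace ℝ W]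
  {W' : Type*} [NormedAddCommGroup W'] [InnerProductSpace ℝ W']

lemma traceForm_eq_zero {F : M → W} {F₁ F₂ : M → W'} {x : M} (h : dAt (n := n) F₂ x = 0) :
    traceForm (n := n) F F₁ F₂ x = 0 := by
  refine Finset.sum_eq_zero fun i _ => Finset.sum_eq_zero fun j _ => ?_
  simp [shapeMatrix, h]

lemma support_traceForm_subset (F : M → W) (F₁ F₂ : M → W') :
    Function.support (traceForm (n := n) F F₁ F₂) ⊆ tsupport F₂ := by
  intro x hx
  by_contra h
  exact hx (traceForm_eq_zero (dAt_eq_zero_of_notMem_tsupport h))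

lemma hasCompactSupport_traceForm (F : M → W) (F₁ : M → W') {F₂ : M → W'}
    (h : HasCompactSupport F₂) : HasCompactSupport (traceForm (n := n) F F₁ F₂) :=
  h.mono' (support_traceForm_subset F F₁ F₂)

variable [IsManifold (𝓡 n) ∞ M]

lemma traceForm_sum {ι : Type*} (s : Finset ι) {F : M → W} {F₁ : M → W'} {f : ι → M → W'} {x : M}
    (hf : ∀ i ∈ s, MDifferentiableAt (𝓡 n) 𝓘(ℝ, W') (f i) x) :
    traceForm (n := n) F F₁ (fun x => ∑ i ∈ s, f i x) x
      = ∑ i ∈ s, traceForm (n := n) F F₁ (f i) x := by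
  have h : ∀ i j, shapeMatrix (dAt (n := n) F₁ x) (dAt (fun x => ∑ i ∈ s, f i x) x) i j
      = ∑ a ∈ s, shapeMatrix (dAt F₁ x) (dAt (f a) x) i j := fun i j => by
    rw [dAt_sum s hf]
    simp [shapeMatrix, inner_sum]
  unfold traceForm
  simp only [h, Finset.mul_sum]
  exact (Finset.sum_congr rfl fun i _ => Finset.sum_comm).trans Finset.sum_comm

variable [MeasurableSpace M] [BorelSpace M]

lemma integrable_of_hasCompactSupport [T2Space M] {F : M → W} (hF : IsSmoothImmersion n F)
    {f : M → ℝ} (hf : Continuous f) (hfc : HasCompactSupport f) :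
    Integrable f (volumeMeasure (inducedMetric n F)) := by
  have := isLocallyFiniteMeasure_volumeMeasure hF
  exact hf.integrable_of_hasCompactSupport hfc

lemma integral_traceForm_chart [FiniteDimensional ℝ W] (hW : Module.finrank ℝ W = n + 1)
    {F ν Z : M → W} (hF : IsSmoothImmersion n F) (hν : IsUnitNormal n F ν)
    (hmin : IsMinimal n F ν) {p : M} (hZ : ContMDiff (𝓡 n) 𝓘(ℝ, W) ∞ Z)
    (hZc : HasCompactSupport Z) (hZp : tsupport Z ⊆ (chartAt (EuclideanSpace ℝ (Fin n)) p).source) :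
    ∫ x, traceForm (n := n) F F Z x ∂(volumeMeasure (inducedMetric n F)) = 0 := by
  set φ := chartAt (EuclideanSpace ℝ (Fin n)) p with hφ
  have dF := hF.contMDiff.mdifferentiable (by simp)
  have dν := hν.contMDiff.mdifferentiable (by simp)
  have dZ := hZ.mdifferentiable (by simp)
  have hloc : ∀ {f : M → W}, MDifferentiable (𝓡 n) 𝓘(ℝ, W) f → ∀ y ∈ φ.target,
      traceForm (n := n) F F f (φ.symm y)
        = traceFormLoc (inChart F p) (inChart F p) (inChart f p) y := fun {f} hf y hy => by
    rw [traceForm_eq (φ.map_target hy) (dF _) (dF _) (hf _), ← hφ, φ.right_inv hy]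
  rw [integral_eq_chart hF p (contMDiff_traceForm hF hF.contMDiff hZ).continuous
    ((support_traceForm_subset _ _ _).trans hZp), ← hφ]
  have h1 : ∀ y ∈ φ.target, density (inChart F p) y * inChart (traceForm (n := n) F F Z) p y
      = density (inChart F p) y * traceFormLoc (inChart F p) (inChart F p) (inChart Z p) y :=
    fun y hy => by rw [← hloc dZ y hy]; rfl
  rw [setIntegral_congr_fun φ.open_target.measurableSet h1]
  refine integral_density_mul_traceFormLoc (ν := inChart ν p) (K := φ '' tsupport Z) hW
    φ.open_target (contDiffOn_inChart hF.contMDiff p) (injective_fderiv_inChart hF p)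
    (contDiffOn_inChart hν.contMDiff p) (fun z _ => hν.norm_eq_one _)
    (inner_fderiv_inChart_normal hF.contMDiff hν p) ?_ ?_ ?_ (contDiffOn_inChart hZ p) ?_
  · intro z hz
    rw [← hloc dν z hz, ← meanCurvature_eq hF.contMDiff hν]
    exact hmin _
  · exact hZc.isCompact.image_of_continuousOn (φ.continuousOn.mono hZp)
  · rintro _ ⟨x, hx, rfl⟩
    exact φ.map_source (hZp hx)
  · intro z hz hzK
    by_contra h
    refine hzK ⟨φ.symm z, subset_tsupport _ h, φ.right_inv hz⟩

/-- The first variation formula for a minimal immersion. -/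
lemma integral_traceForm_eq_zero [T2Space M] [SecondCountableTopology M] [FiniteDimensional ℝ W]
    (hW : Module.finrank ℝ W = n + 1)
    {F ν Z : M → W} (hF : IsSmoothImmersion n F) (hν : IsUnitNormal n F ν)
    (hmin : IsMinimal n F ν) (hZ : ContMDiff (𝓡 n) 𝓘(ℝ, W) ∞ Z) (hZc : HasCompactSupport Z) :
    ∫ x, traceForm (n := n) F F Z x ∂(volumeMeasure (inducedMetric n F)) = 0 := by
  obtain ⟨s, χ, hχ, hχp, hχ1⟩ := exists_finite_partition (n := n) hZc.isCompact
  -- The trace is linear in `Z`, so cutting `Z` into pieces supported in chart domains reduces the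
  -- formula to the local one.
  have h1 : Z = fun x => ∑ p ∈ s, χ p x • Z x := by
    ext1 x
    rw [← Finset.sum_smul]
    by_cases hx : x ∈ tsupport Z
    · rw [hχ1 x hx, one_smul]
    · rw [image_eq_zero_of_notMem_tsupport hx, smul_zero]
  have h2 : ∀ p, ContMDiff (𝓡 n) 𝓘(ℝ, W) ∞ (fun x => χ p x • Z x) := fun p => (hχ p).smul hZ
  have h3 : ∀ p, HasCompactSupport (fun x => χ p x • Z x) := fun p => hZc.smul_left
  have h4 : ∀ p, tsupport (fun x => χ p x • Z x)
      ⊆ (chartAt (EuclideanSpace ℝ (Fin n)) p).source := fun p =>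
    (closure_mono (Function.support_smul_subset_left (χ p) Z)).trans (hχp p)
  have h5 : ∀ x, traceForm (n := n) F F Z x
      = ∑ p ∈ s, traceForm (n := n) F F (fun x => χ p x • Z x) x := fun x => by
    conv_lhs => rw [h1]
    exact traceForm_sum s fun p _ => (h2 p).mdifferentiable (by simp) x
  simp only [h5]
  rw [integral_finsetSum]
  · exact Finset.sum_eq_zero fun p _ =>
      integral_traceForm_chart hW hF hν hmin (h2 p) (h3 p) (h4 p)
  · intro p _
    exact integrable_of_hasCompactSupport hF (contMDiff_traceForm hF hF.contMDiff (h2 p)).continuous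
      (hasCompactSupport_traceForm _ _ (h3 p))

end FirstVariation

/-! ### Traces in orthonormal frames and derivatives of powers of the radius. -/

section TestFunction

variable {n : ℕ} {M : Type*} [TopologicalSpace M] [ChartedSpace (EuclideanSpace ℝ (Fin n)) M]
  {W : Type*} [NormedAddCommGroup W] [InnerProductSpace ℝ W]

lemma traceForm_frame {W' : Type*} [NormedAddCommGroup W'] [InnerProductSpace ℝ W'] {F : M → W}
    {x : M} {e : Fin n → EuclideanSpace ℝ (Fin n)} (he : Orthonormal ℝ fun a => dAt F x (e a))
    (F₁ F₂ : M → W') :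
    traceForm (n := n) F F₁ F₂ x = ∑ a, inner ℝ (dAt F₁ x (e a)) (dAt F₂ x (e a)) := by
  have hE : (frameMatrix e).transpose * gramOf (dAt F x) * frameMatrix e = 1 := by
    ext a b
    rw [frameMatrix_conj, sum_gramOf, orthonormal_iff_ite.1 he, Matrix.one_apply]
  have hA : ∀ a b, ((frameMatrix e).transpose * shapeMatrix (dAt (n := n) F₁ x) (dAt F₂ x) *
      frameMatrix e) a b = inner ℝ (dAt F₁ x (e a)) (dAt F₂ x (e b)) := fun a b => by
    rw [frameMatrix_conj]
    exact sum_inner_clm _ _ _ _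
  rw [traceForm, ← sum_inv_conj _ _ _ (frameMatrix_isUnit hE), hE]
  simp [hA, Matrix.one_apply]

lemma exists_frame {F : M → W} {x : M} (hF : Function.Injective (dAt (n := n) F x)) :
    ∃ e : Fin n → EuclideanSpace ℝ (Fin n), Orthonormal ℝ fun a => dAt F x (e a) := by
  obtain ⟨e, -, he⟩ := exists_frame_extension hF ∅ (fun _ => 0) (by simp)
  exact ⟨e, he⟩

lemma hasFDerivAt_inv_norm_pow (k : ℕ) {w : W} (hw : w ≠ 0) :
    HasFDerivAt (fun w : W => (‖w‖ ^ k)⁻¹) ((-(k * (‖w‖ ^ (k + 2))⁻¹)) • innerSL ℝ w) w := by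
  have hn : ‖w‖ ≠ 0 := norm_ne_zero_iff.2 hw
  have h1 := ((hasDerivAt_pow k ‖w‖).inv (pow_ne_zero k hn)).comp_hasFDerivAt w
    (hasFDerivAt_norm hw)
  refine h1.congr_fderiv ?_
  rw [smul_smul]
  congr 1
  rcases k with _ | k
  · simp
  · simp only [Nat.add_sub_cancel]
    field_simp
    ring

lemma contDiffOn_inv_norm_pow (k : ℕ) :
    ContDiffOn ℝ ∞ (fun w : W => (‖w‖ ^ k)⁻¹) {w | w ≠ 0} := fun _ hw =>
  (((contDiffAt_norm ℝ hw).pow k).inv (pow_ne_zero k (norm_ne_zero_iff.2 hw))).contDiffWithinAt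

lemma contMDiff_comp_of_ne_zero {V : Type*} [NormedAddCommGroup V] [NormedSpace ℝ V] {F : M → W}
    (hF : ContMDiff (𝓡 n) 𝓘(ℝ, W) ∞ F) (h0 : ∀ x, F x ≠ 0) {c : W → V}
    (hc : ContDiffOn ℝ ∞ c {w | w ≠ 0}) : ContMDiff (𝓡 n) 𝓘(ℝ, V) ∞ (fun x => c (F x)) := by
  intro x
  have h1 : ContDiffAt ℝ ∞ c (F x) := hc.contDiffAt (isOpen_ne.mem_nhds (h0 x))
  exact h1.contMDiffAt.comp x (hF x)

lemma dAt_inv_norm_pow [IsManifold (𝓡 n) ∞ M] (k : ℕ) {F : M → W} {x : M}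
    (hF : MDifferentiableAt (𝓡 n) 𝓘(ℝ, W) F x) (h0 : F x ≠ 0) (v : EuclideanSpace ℝ (Fin n)) :
    dAt (n := n) (fun x => (‖F x‖ ^ k)⁻¹) x v
      = -(k * (‖F x‖ ^ (k + 2))⁻¹) * inner ℝ (F x) (dAt F x v) := by
  have h1 := hasFDerivAt_inv_norm_pow k h0
  rw [dAt_comp h1.differentiableAt hF, h1.fderiv]
  simp

end TestFunction

/-! ### The weighted stability inequality for smooth functions. -/

section SmoothInequality

variable {M : Type*} [TopologicalSpace M] [ChartedSpace (EuclideanSpace ℝ (Fin 4)) M]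
  [IsManifold (𝓡 4) ∞ M] {W : Type*} [NormedAddCommGroup W] [InnerProductSpace ℝ W]
  {F ν : M → W} {ψ : M → ℝ}

/-- The pointwise identity behind the substitution `φ = ψ / |F|` in the stability inequality. -/
lemma traceForm_div_norm [FiniteDimensional ℝ W] (hW : Module.finrank ℝ W = 5)
    (hF : IsSmoothImmersion 4 F) (hν : IsUnitNormal 4 F ν) (h0 : ∀ x, F x ≠ 0)
    (hψ : ContMDiff (𝓡 4) 𝓘(ℝ, ℝ) ∞ ψ) (x : M) :
    traceForm (n := 4) F (fun x => (‖F x‖ ^ 1)⁻¹ • ψ x) (fun x => (‖F x‖ ^ 1)⁻¹ • ψ x) x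
      = (‖F x‖ ^ 2)⁻¹ * traceForm (n := 4) F ψ ψ x
        - traceForm (n := 4) F F (fun x => ((‖F x‖ ^ 4)⁻¹ • ψ x ^ 2) • F x) x
        + ψ x ^ 2 * (‖F x‖ ^ 4)⁻¹ * (1 + 3 * inner ℝ (radial (F x)) (ν x) ^ 2) := by
  have hn : ‖F x‖ ≠ 0 := norm_ne_zero_iff.2 (h0 x)
  have dF := hF.contMDiff.mdifferentiable (by simp) x
  have dψ := hψ.mdifferentiable (by simp) x
  have dinv : ∀ k : ℕ, MDifferentiableAt (𝓡 4) 𝓘(ℝ, ℝ) (fun x => (‖F x‖ ^ k)⁻¹) x := fun k =>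
    (contMDiff_comp_of_ne_zero hF.contMDiff h0 (contDiffOn_inv_norm_pow k)).mdifferentiable
      (by simp) x
  have hsq : DifferentiableAt ℝ (fun t : ℝ => t ^ 2) (ψ x) := by fun_prop
  have dψ2 : MDifferentiableAt (𝓡 4) 𝓘(ℝ, ℝ) (fun x => ψ x ^ 2) x :=
    MDifferentiableAt.comp x hsq.mdifferentiableAt dψ
  have hψ2 : ∀ v, dAt (n := 4) (fun x => ψ x ^ 2) x v = 2 * ψ x * dAt ψ x v := fun v => by
    rw [dAt_comp (c := fun t : ℝ => t ^ 2) hsq dψ]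
    simp [mul_comm, mul_left_comm]
  have dcoef : MDifferentiableAt (𝓡 4) 𝓘(ℝ, ℝ) (fun x => (‖F x‖ ^ 4)⁻¹ • ψ x ^ 2) x :=
    (dinv 4).smul dψ2
  obtain ⟨e, he⟩ := exists_frame (n := 4) (hF.injective x)
  have hN : Orthonormal ℝ (fun _ : Unit => ν x) := by
    rw [orthonormal_iff_ite]
    simp [hν.norm_eq_one x]
  -- This splits `r² = |Fᵀ|² + r²σ²`. The identity produces `4r⁻⁴ψ² - 3r⁻⁶ψ²|Fᵀ|²`, where 4 is the
  -- dimension, and the splitting turns it into `(1 + 3σ²) r⁻⁴ψ²`.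
  have hpars := parseval (orthonormal_sum he hN fun a _ => hν.orthogonal x _) (by simp [hW])
    (F x) (F x)
  simp only [Fintype.sum_sum_type, Sum.elim_inl, Sum.elim_inr, Finset.univ_unique,
    Finset.sum_singleton] at hpars
  have hσ : inner ℝ (F x) (ν x) = ‖F x‖ * inner ℝ (radial (F x)) (ν x) := by
    rw [radial, real_inner_smul_left, mul_inv_cancel_left₀ hn]
  rw [real_inner_self_eq_norm_sq, hσ] at hpars
  rw [traceForm_frame he, traceForm_frame he, traceForm_frame he]
  have hee : ∀ a, inner ℝ (dAt (n := 4) F x (e a)) (dAt F x (e a)) = 1 := fun a => by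
    rw [real_inner_self_eq_norm_sq, he.1 a, one_pow]
  have e1 : ∀ a, dAt (n := 4) (fun x => (‖F x‖ ^ 1)⁻¹ • ψ x) x (e a)
      = (‖F x‖ ^ 1)⁻¹ * dAt ψ x (e a)
        - (‖F x‖ ^ 3)⁻¹ * inner ℝ (F x) (dAt F x (e a)) * ψ x := fun a => by
    rw [dAt_smul (dinv 1) dψ, dAt_inv_norm_pow 1 dF (h0 x)]
    simp only [smul_eq_mul]
    push_cast
    ring
  have e2 : ∀ a, inner ℝ (dAt (n := 4) F x (e a))
      (dAt (n := 4) (fun x => ((‖F x‖ ^ 4)⁻¹ • ψ x ^ 2) • F x) x (e a))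
      = (‖F x‖ ^ 4)⁻¹ * ψ x ^ 2 + ((‖F x‖ ^ 4)⁻¹ * (2 * ψ x * dAt ψ x (e a))
        - 4 * (‖F x‖ ^ 6)⁻¹ * inner ℝ (F x) (dAt F x (e a)) * ψ x ^ 2) *
          inner ℝ (F x) (dAt F x (e a)) := fun a => by
    rw [dAt_smul dcoef dF, dAt_smul (dinv 4) dψ2, dAt_inv_norm_pow 4 dF (h0 x), hψ2,
      inner_add_right, real_inner_smul_right, real_inner_smul_right, hee,
      real_inner_comm (F x)]
    simp only [smul_eq_mul]
    push_cast
    ring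
  have e3 : ∀ s t : ℝ, inner ℝ s t = s * t := fun s t => mul_comm _ _
  simp only [e1, e2, e3, Fin.sum_univ_four] at hpars ⊢
  generalize dAt ψ x (e 0) = p0 at *
  generalize dAt ψ x (e 1) = p1 at *
  generalize dAt ψ x (e 2) = p2 at *
  generalize dAt ψ x (e 3) = p3 at *
  generalize inner ℝ (F x) (dAt F x (e 0)) = t0 at *
  generalize inner ℝ (F x) (dAt F x (e 1)) = t1 at *
  generalize inner ℝ (F x) (dAt F x (e 2)) = t2 at *
  generalize inner ℝ (F x) (dAt F x (e 3)) = t3 at *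
  generalize inner ℝ (radial (F x)) (ν x) = s at *
  generalize ‖F x‖ = r at *
  generalize ψ x = u at *
  field_simp
  linear_combination (3 * u ^ 2) * hpars

/-- The potential in the weighted stability inequality. -/
def potential (F ν : M → W) (x : M) : ℝ :=
  ‖F x‖ ^ 2 * shapeNormSq (n := 4) F ν x - 1 - 3 * inner ℝ (radial (F x)) (ν x) ^ 2

lemma contMDiff_potential (hF : IsSmoothImmersion 4 F) (hν : ContMDiff (𝓡 4) 𝓘(ℝ, W) ∞ ν)
    (h0 : ∀ x, F x ≠ 0) : ContMDiff (𝓡 4) 𝓘(ℝ, ℝ) ∞ (potential F ν) := by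
  have h1 : ContMDiff (𝓡 4) 𝓘(ℝ, ℝ) ∞ (fun x => ‖F x‖ ^ 2) :=
    contMDiff_comp_of_ne_zero hF.contMDiff h0 (contDiff_norm_sq ℝ).contDiffOn
  have h2 : ContMDiff (𝓡 4) 𝓘(ℝ, W) ∞ (fun x => radial (F x)) :=
    contMDiff_comp_of_ne_zero hF.contMDiff h0 contDiffOn_radial
  have h3 : ContMDiff (𝓡 4) 𝓘(ℝ, ℝ) ∞ (fun x => inner ℝ (radial (F x)) (ν x)) := by
    have : ContDiff ℝ ∞ (fun q : W × W => inner ℝ q.1 q.2) := contDiff_inner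
    exact this.contMDiff.comp (h2.prodMk_space hν)
  exact ((h1.mul (contMDiff_shapeNormSq hF hν)).sub contMDiff_const).sub
    (contMDiff_const.mul (h3.pow 2))

/-- Arranged so that integration leaves the two sides of the stability inequality for `ψ/r`, the
weighted gradient term, and a divergence of integral zero. -/
lemma weighted_integrand [FiniteDimensional ℝ W] (hW : Module.finrank ℝ W = 5)
    (hF : IsSmoothImmersion 4 F) (hν : IsUnitNormal 4 F ν) (h0 : ∀ x, F x ≠ 0)
    (hψ : ContMDiff (𝓡 4) 𝓘(ℝ, ℝ) ∞ ψ) (x : M) :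
    (‖F x‖ ^ 4)⁻¹ * (potential F ν x * ψ x ^ 2)
      = normSqA 4 F ν x * ((‖F x‖ ^ 1)⁻¹ • ψ x) ^ 2
        + ((‖F x‖ ^ 2)⁻¹ * traceForm (n := 4) F ψ ψ x
          - traceForm (n := 4) F F (fun x => ((‖F x‖ ^ 4)⁻¹ • ψ x ^ 2) • F x) x
          - traceForm (n := 4) F (fun x => (‖F x‖ ^ 1)⁻¹ • ψ x)
            (fun x => (‖F x‖ ^ 1)⁻¹ • ψ x) x) := by
  have hn : ‖F x‖ ≠ 0 := norm_ne_zero_iff.2 (h0 x)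
  rw [traceForm_div_norm hW hF hν h0 hψ, normSqA_eq hF.contMDiff hν, potential, smul_eq_mul]
  field_simp
  ring

/-- The weighted stability inequality for smooth functions. -/
lemma weighted_stability [T2Space M] [SecondCountableTopology M] [MeasurableSpace M] [BorelSpace M]
    [FiniteDimensional ℝ W] (hW : Module.finrank ℝ W = 5)
    (hF : IsSmoothImmersion 4 F) (hν : IsUnitNormal 4 F ν) (hmin : IsMinimal 4 F ν)
    (hst : IsStable 4 F ν) (h0 : ∀ x, F x ≠ 0)
    (hψ : ContMDiff (𝓡 4) 𝓘(ℝ, ℝ) ∞ ψ) (hψc : HasCompactSupport ψ) :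
    ∫ x, (‖F x‖ ^ 4)⁻¹ * (potential F ν x * ψ x ^ 2) ∂(volumeMeasure (inducedMetric 4 F))
      ≤ ∫ x, (‖F x‖ ^ 2)⁻¹ * traceForm (n := 4) F ψ ψ x
          ∂(volumeMeasure (inducedMetric 4 F)) := by
  set μ := volumeMeasure (inducedMetric 4 F)
  have sinv : ∀ k : ℕ, ContMDiff (𝓡 4) 𝓘(ℝ, ℝ) ∞ (fun x => (‖F x‖ ^ k)⁻¹) := fun k =>
    contMDiff_comp_of_ne_zero hF.contMDiff h0 (contDiffOn_inv_norm_pow k)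
  have hφ : ContMDiff (𝓡 4) 𝓘(ℝ, ℝ) ∞ (fun x => (‖F x‖ ^ 1)⁻¹ • ψ x) := (sinv 1).smul hψ
  have hφc : HasCompactSupport (fun x => (‖F x‖ ^ 1)⁻¹ • ψ x) :=
    HasCompactSupport.smul_left (f := fun x => (‖F x‖ ^ 1)⁻¹) hψc
  have hZ : ContMDiff (𝓡 4) 𝓘(ℝ, W) ∞ (fun x => ((‖F x‖ ^ 4)⁻¹ • ψ x ^ 2) • F x) :=
    ((sinv 4).smul (hψ.pow 2)).smul hF.contMDiff
  have hψ2c : HasCompactSupport (fun x => ψ x ^ 2) := hψc.comp_left (g := fun t => t ^ 2) (by simp)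
  have hZc : HasCompactSupport (fun x => ((‖F x‖ ^ 4)⁻¹ • ψ x ^ 2) • F x) :=
    HasCompactSupport.smul_right (f := fun x => (‖F x‖ ^ 4)⁻¹ • ψ x ^ 2) (f' := F)
      (HasCompactSupport.smul_left (f := fun x => (‖F x‖ ^ 4)⁻¹) hψ2c)
  have hi1 : Integrable (fun x => (‖F x‖ ^ 2)⁻¹ * traceForm (n := 4) F ψ ψ x) μ :=
    integrable_of_hasCompactSupport hF
      ((sinv 2).continuous.mul (contMDiff_traceForm hF hψ hψ).continuous)
      ((hasCompactSupport_traceForm _ _ hψc).mul_left)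
  have hi2 : Integrable (traceForm (n := 4) F F
      (fun x => ((‖F x‖ ^ 4)⁻¹ • ψ x ^ 2) • F x)) μ :=
    integrable_of_hasCompactSupport hF (contMDiff_traceForm hF hF.contMDiff hZ).continuous
      (hasCompactSupport_traceForm _ _ hZc)
  have hi3 : Integrable (traceForm (n := 4) F (fun x => (‖F x‖ ^ 1)⁻¹ • ψ x)
      (fun x => (‖F x‖ ^ 1)⁻¹ • ψ x)) μ :=
    integrable_of_hasCompactSupport hF (contMDiff_traceForm hF hφ hφ).continuous
      (hasCompactSupport_traceForm _ _ hφc)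
  have hi4 : Integrable (fun x => normSqA 4 F ν x * ((‖F x‖ ^ 1)⁻¹ • ψ x) ^ 2) μ := by
    simp only [normSqA_eq hF.contMDiff hν]
    refine integrable_of_hasCompactSupport hF
      ((contMDiff_shapeNormSq hF hν.contMDiff).continuous.mul (hφ.continuous.pow 2)) ?_
    exact (hφc.comp_left (g := fun t => t ^ 2) (by simp)).mul_left
  have hs := hst _ hφ hφc
  simp only [gradNormSq_eq] at hs
  have hz := integral_traceForm_eq_zero hW hF hν hmin hZ hZc
  simp only [weighted_integrand hW hF hν h0 hψ]
  have e1 := integral_sub (hi1.sub hi2) hi3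
  have e2 := integral_sub hi1 hi2
  have e3 := integral_add hi4 ((hi1.sub hi2).sub hi3)
  simp only [Pi.sub_apply] at e1 e2 e3
  linarith

end SmoothInequality

/-! ### Restriction of the hypotheses to an open subset. -/

section OpenSubset

variable {n : ℕ} {M : Type*} [TopologicalSpace M] [ChartedSpace (EuclideanSpace ℝ (Fin n)) M]
  {W : Type*} [NormedAddCommGroup W] [InnerProductSpace ℝ W]
  {V : Type*} [NormedAddCommGroup V] [NormedSpace ℝ V] {N : TopologicalSpace.Opens M}

lemma chartAt_subtype_apply (p x : N) : chartAt (EuclideanSpace ℝ (Fin n)) p x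
    = chartAt (EuclideanSpace ℝ (Fin n)) p.1 x.1 := rfl

lemma chartAt_subtype_source (p : N) : (chartAt (EuclideanSpace ℝ (Fin n)) p).source
    = Subtype.val ⁻¹' (chartAt (EuclideanSpace ℝ (Fin n)) p.1).source :=
  OpenPartialHomeomorph.subtypeRestr_source _ _

lemma chartAt_subtype_target_subset (p : N) : (chartAt (EuclideanSpace ℝ (Fin n)) p).target
    ⊆ (chartAt (EuclideanSpace ℝ (Fin n)) p.1).target :=
  OpenPartialHomeomorph.subtypeRestr_target_subset _ _

lemma chartAt_subtype_symm_eqOn (p : N) :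
    Set.EqOn (chartAt (EuclideanSpace ℝ (Fin n)) p.1).symm
      (Subtype.val ∘ (chartAt (EuclideanSpace ℝ (Fin n)) p).symm)
      (chartAt (EuclideanSpace ℝ (Fin n)) p).target :=
  OpenPartialHomeomorph.subtypeRestr_symm_eqOn _ _

lemma inChart_subtype_eqOn {V : Type*} (f : M → V) (p : N) :
    Set.EqOn (inChart (n := n) (fun x : N => f x) p) (inChart f p.1)
      (chartAt (EuclideanSpace ℝ (Fin n)) p).target := fun y hy => by
  simp only [inChart, Function.comp_apply]
  rw [chartAt_subtype_symm_eqOn p hy]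
  rfl

lemma fderiv_inChart_subtype (f : M → V) (p : N) {y : EuclideanSpace ℝ (Fin n)}
    (hy : y ∈ (chartAt (EuclideanSpace ℝ (Fin n)) p).target) :
    fderiv ℝ (inChart (n := n) (fun x : N => f x) p) y = fderiv ℝ (inChart f p.1) y :=
  ((inChart_subtype_eqOn f p).eventuallyEq_of_mem
    ((chartAt (EuclideanSpace ℝ (Fin n)) p).open_target.mem_nhds hy)).fderiv_eq

lemma contMDiff_subtype {f : M → V} (hf : ContMDiff (𝓡 n) 𝓘(ℝ, V) ∞ f) :
    ContMDiff (𝓡 n) 𝓘(ℝ, V) ∞ (fun x : N => f x) := hf.comp contMDiff_subtype_val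

lemma dAt_subtype {f : M → V} (hf : ContMDiff (𝓡 n) 𝓘(ℝ, V) ∞ f) (x : N) :
    dAt (n := n) (fun x : N => f x) x = dAt f x.1 := by
  rw [dAt_eq_fderiv ((contMDiff_subtype hf).mdifferentiable (by simp) x),
    dAt_eq_fderiv (hf.mdifferentiable (by simp) x.1), fderiv_inChart_subtype]
  · rfl
  · exact (chartAt (EuclideanSpace ℝ (Fin n)) x).map_source (mem_chart_source _ x)

lemma IsSmoothImmersion.subtype {F : M → W} (hF : IsSmoothImmersion n F) :
    IsSmoothImmersion n (fun x : N => F x) where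
  contMDiff := contMDiff_subtype hF.contMDiff
  injective x := by
    have h : differential n (fun x : N => F x) x = dAt (n := n) (fun x : N => F x) x := rfl
    rw [h, dAt_subtype hF.contMDiff]
    exact hF.injective x.1

lemma IsUnitNormal.subtype {F ν : M → W} (hF : ContMDiff (𝓡 n) 𝓘(ℝ, W) ∞ F)
    (hν : IsUnitNormal n F ν) : IsUnitNormal n (fun x : N => F x) (fun x : N => ν x) where
  contMDiff := contMDiff_subtype hν.contMDiff
  norm_eq_one x := hν.norm_eq_one x.1
  orthogonal x v := by
    have h : differential n (fun x : N => F x) x v = dAt (n := n) (fun x : N => F x) x v := rfl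
    rw [h, dAt_subtype hF]
    exact hν.orthogonal x.1 v

lemma traceForm_subtype {W' : Type*} [NormedAddCommGroup W'] [InnerProductSpace ℝ W'] {F : M → W}
    {F₁ F₂ : M → W'} (hF : ContMDiff (𝓡 n) 𝓘(ℝ, W) ∞ F) (hF₁ : ContMDiff (𝓡 n) 𝓘(ℝ, W') ∞ F₁)
    (hF₂ : ContMDiff (𝓡 n) 𝓘(ℝ, W') ∞ F₂) (x : N) :
    traceForm (n := n) (fun x : N => F x) (fun x : N => F₁ x) (fun x : N => F₂ x) x
      = traceForm (n := n) F F₁ F₂ x.1 := by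
  rw [traceForm, traceForm, dAt_subtype hF, dAt_subtype hF₁, dAt_subtype hF₂]

lemma shapeNormSq_subtype {F ν : M → W} (hF : ContMDiff (𝓡 n) 𝓘(ℝ, W) ∞ F)
    (hν : ContMDiff (𝓡 n) 𝓘(ℝ, W) ∞ ν) (x : N) :
    shapeNormSq (n := n) (fun x : N => F x) (fun x : N => ν x) x = shapeNormSq (n := n) F ν x.1 := by
  rw [shapeNormSq, shapeNormSq, dAt_subtype hF, dAt_subtype hν]

variable [IsManifold (𝓡 n) ∞ M]

lemma IsMinimal.subtype {F ν : M → W} (hF : ContMDiff (𝓡 n) 𝓘(ℝ, W) ∞ F)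
    (hν : IsUnitNormal n F ν) (hmin : IsMinimal n F ν) :
    IsMinimal n (fun x : N => F x) (fun x : N => ν x) := fun x => by
  rw [meanCurvature_eq (contMDiff_subtype hF) (hν.subtype hF),
    traceForm_subtype hF hF hν.contMDiff, ← meanCurvature_eq hF hν]
  exact hmin x.1

variable [MeasurableSpace M] [BorelSpace M] [SecondCountableTopology M]

/-- The charts of the open subset are restrictions of those of `M`, with the same density. -/
lemma volumeMeasure_subtype {F : M → W} (hF : ContMDiff (𝓡 n) 𝓘(ℝ, W) ∞ F) :
    Measure.comap (Subtype.val : N → M) (volumeMeasure (inducedMetric n F))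
      = volumeMeasure (inducedMetric n fun x : N => F x) := by
  have hemb : MeasurableEmbedding (Subtype.val : N → M) :=
    MeasurableEmbedding.subtype_coe N.isOpen.measurableSet
  refine eq_volumeMeasure (contMDiff_subtype hF) fun p => ?_
  ext S hS
  have hsrc := (chartAt (EuclideanSpace ℝ (Fin n)) p).open_source.measurableSet
  rw [Measure.restrict_apply hS, hemb.comap_apply, chartVolume_apply (contMDiff_subtype hF) p hS,
    volumeMeasure_apply hF p.1 (hemb.measurableSet_image' (hS.inter hsrc)) ?_]
  · have hset : (chartAt (EuclideanSpace ℝ (Fin n)) p.1).target ∩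
        (chartAt (EuclideanSpace ℝ (Fin n)) p.1).symm ⁻¹'
          (Subtype.val '' (S ∩ (chartAt (EuclideanSpace ℝ (Fin n)) p).source))
        = (chartAt (EuclideanSpace ℝ (Fin n)) p).target ∩
          (chartAt (EuclideanSpace ℝ (Fin n)) p).symm ⁻¹' S := by
      ext y
      constructor
      · rintro ⟨hy, x, ⟨hxS, hx⟩, hxy⟩
        have h1 : chartAt (EuclideanSpace ℝ (Fin n)) p x = y := by
          rw [chartAt_subtype_apply, hxy]
          exact (chartAt (EuclideanSpace ℝ (Fin n)) p.1).right_inv hy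
        rw [← h1]
        refine ⟨(chartAt (EuclideanSpace ℝ (Fin n)) p).map_source hx, ?_⟩
        rwa [Set.mem_preimage, (chartAt (EuclideanSpace ℝ (Fin n)) p).left_inv hx]
      · rintro ⟨hy, hyS⟩
        refine ⟨chartAt_subtype_target_subset p hy, (chartAt (EuclideanSpace ℝ (Fin n)) p).symm y,
          ⟨hyS, (chartAt (EuclideanSpace ℝ (Fin n)) p).map_target hy⟩, ?_⟩
        exact (chartAt_subtype_symm_eqOn p hy).symm
    rw [hset]
    refine setLIntegral_congr_fun (measurableSet_target_inter_preimage _ hS) fun y hy => ?_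
    simp only [density]
    rw [fderiv_inChart_subtype F p hy.1]
  · rintro _ ⟨x, ⟨-, hx⟩, rfl⟩
    rwa [chartAt_subtype_source] at hx

lemma integral_subtype {F : M → W} (hF : ContMDiff (𝓡 n) 𝓘(ℝ, W) ∞ F) {f : M → ℝ}
    (hf : Function.support f ⊆ N) :
    ∫ x : N, f x ∂(volumeMeasure (inducedMetric n fun x : N => F x))
      = ∫ x, f x ∂(volumeMeasure (inducedMetric n F)) := by
  rw [← volumeMeasure_subtype hF]
  refine (integral_subtype_comap N.isOpen.measurableSet f).trans ?_
  exact setIntegral_eq_integral_of_forall_compl_eq_zero fun x hx => by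
    by_contra h
    exact hx (hf h)

/-- A test function with compact support in the open subset extends smoothly by zero, so stability
of the whole tests it too. -/
lemma IsStable.subtype [T2Space M] {F ν : M → W} (hF : ContMDiff (𝓡 n) 𝓘(ℝ, W) ∞ F)
    (hν : IsUnitNormal n F ν) (hst : IsStable n F ν) :
    IsStable n (fun x : N => F x) (fun x : N => ν x) := by
  intro φ hφ hφc
  set φ' : M → ℝ := Function.extend Subtype.val φ 0 with hφ'
  have he : φ = fun x : N => φ' x := by
    ext x
    exact (Subtype.val_injective.extend_apply φ 0 x).symm
  have hsm : ContMDiff (𝓡 n) 𝓘(ℝ, ℝ) ∞ φ' := hφ.extend_zero hφc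
  have hts : tsupport φ' ⊆ Subtype.val '' tsupport φ :=
    hφc.tsupport_extend_zero_subset continuous_subtype_val
  have hcs : HasCompactSupport φ' :=
    (hφc.isCompact.image continuous_subtype_val).of_isClosed_subset (isClosed_tsupport _) hts
  have hN : tsupport φ' ⊆ N := hts.trans (Subtype.coe_image_subset _ _)
  have h := hst φ' hsm hcs
  simp only [gradNormSq_eq, normSqA_eq hF hν] at h
  simp only [gradNormSq_eq, normSqA_eq (contMDiff_subtype hF) (hν.subtype hF)]
  rw [he]
  simp only [shapeNormSq_subtype hF hν.contMDiff, traceForm_subtype hF hsm hsm]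
  rw [integral_subtype hF (f := fun x => shapeNormSq (n := n) F ν x * φ' x ^ 2),
    integral_subtype hF (f := traceForm (n := n) F φ' φ')]
  · exact h
  · exact (support_traceForm_subset _ _ _).trans hN
  · intro x hx
    refine hN (subset_tsupport _ fun h0 => hx ?_)
    simp [h0]

end OpenSubset

/-! ### The conformal metric as the metric induced by the cylinder immersion. -/

section Conformal

variable {n : ℕ} {M : Type*} [TopologicalSpace M] [ChartedSpace (EuclideanSpace ℝ (Fin n)) M]
  {W : Type*} [NormedAddCommGroup W] [InnerProductSpace ℝ W] {F : M → W}

lemma gramOf_fderiv_cylinderMap {w : W} (hw : w ≠ 0) (D : EuclideanSpace ℝ (Fin n) →L[ℝ] W) :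
    gramOf (fderiv ℝ (cylinderMap : W → WithLp 2 (W × ℝ)) w ∘L D) = (‖w‖ ^ 2)⁻¹ • gramOf D := by
  ext i j
  rw [Matrix.smul_apply, gramOf_apply, gramOf_apply, smul_eq_mul, ← inner_fderiv_cylinderMap hw]
  rfl

lemma dAt_cylinderMap (hF : ContMDiff (𝓡 n) 𝓘(ℝ, W) ∞ F) (h0 : ∀ x, F x ≠ 0) (x : M) :
    dAt (n := n) (fun x => cylinderMap (F x)) x
      = fderiv ℝ (cylinderMap : W → WithLp 2 (W × ℝ)) (F x) ∘L dAt F x :=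
  dAt_comp (hasFDerivAt_cylinderMap (h0 x)).differentiableAt (hF.mdifferentiable (by simp) x)

/-- This makes every result about induced metrics (volume, gradient, approximation) available for
the conformal metric. -/
lemma conformalMetric_eq (hF : ContMDiff (𝓡 n) 𝓘(ℝ, W) ∞ F) (h0 : ∀ x, F x ≠ 0) :
    conformalMetric n F = inducedMetric n (fun x => cylinderMap (F x)) := by
  ext x v w
  have h : ∀ v : EuclideanSpace ℝ (Fin n), differential n (fun x => cylinderMap (F x)) x v
      = fderiv ℝ (cylinderMap : W → WithLp 2 (W × ℝ)) (F x) (dAt F x v) := fun v => by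
    change dAt (n := n) (fun x => cylinderMap (F x)) x v = _
    rw [dAt_cylinderMap hF h0]
    rfl
  refine (inner_fderiv_cylinderMap (h0 x) _ _).symm.trans ?_
  exact congrArg₂ (inner ℝ) (h v).symm (h w).symm

lemma IsSmoothImmersion.cylinderMap_comp (hF : IsSmoothImmersion n F) (h0 : ∀ x, F x ≠ 0) :
    IsSmoothImmersion n (fun x => cylinderMap (F x)) where
  contMDiff := contMDiff_comp_of_ne_zero hF.contMDiff h0 contDiffOn_cylinderMap
  injective x := by
    change Function.Injective (dAt (n := n) (fun x => cylinderMap (F x)) x)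
    rw [dAt_cylinderMap hF.contMDiff h0]
    exact (fderiv_cylinderMap_injective (h0 x)).comp (hF.injective x)

lemma traceForm_cylinderMap {W' : Type*} [NormedAddCommGroup W'] [InnerProductSpace ℝ W']
    (hF : IsSmoothImmersion n F) (h0 : ∀ x, F x ≠ 0) (F₁ F₂ : M → W') (x : M) :
    traceForm (n := n) (fun x => cylinderMap (F x)) F₁ F₂ x
      = ‖F x‖ ^ 2 * traceForm (n := n) F F₁ F₂ x := by
  have hn : ‖F x‖ ^ 2 ≠ 0 := pow_ne_zero 2 (norm_ne_zero_iff.2 (h0 x))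
  have hdet : IsUnit (gramOf (dAt (n := n) F x)).det :=
    (gramOf_det_pos (hF.injective x)).ne'.isUnit
  have h1 : (gramOf (dAt (n := n) (fun x => cylinderMap (F x)) x))⁻¹
      = ‖F x‖ ^ 2 • (gramOf (dAt (n := n) F x))⁻¹ := by
    rw [dAt_cylinderMap hF.contMDiff h0, gramOf_fderiv_cylinderMap (h0 x)]
    refine Matrix.inv_eq_left_inv ?_
    rw [Matrix.smul_mul, Matrix.mul_smul, smul_smul, mul_inv_cancel₀ hn, one_smul,
      Matrix.nonsing_inv_mul _ hdet]
  simp only [traceForm, h1, Matrix.smul_apply, smul_eq_mul, Finset.mul_sum, mul_assoc]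

variable [IsManifold (𝓡 n) ∞ M]

lemma fderiv_inChart_cylinderMap (hF : ContMDiff (𝓡 n) 𝓘(ℝ, W) ∞ F) (h0 : ∀ x, F x ≠ 0) (p : M)
    {y : EuclideanSpace ℝ (Fin n)} (hy : y ∈ (chartAt (EuclideanSpace ℝ (Fin n)) p).target) :
    fderiv ℝ (inChart (fun x => cylinderMap (F x)) p) y
      = fderiv ℝ (cylinderMap : W → WithLp 2 (W × ℝ)) (inChart F p y) ∘L
        fderiv ℝ (inChart F p) y :=
  fderiv_comp y (hasFDerivAt_cylinderMap (h0 _)).differentiableAt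
    (differentiableAt_of_contDiffOn (chartAt (EuclideanSpace ℝ (Fin n)) p).open_target
      (contDiffOn_inChart hF p) hy)

lemma chartGram_conformalMetric (hF : ContMDiff (𝓡 n) 𝓘(ℝ, W) ∞ F) (h0 : ∀ x, F x ≠ 0) (p : M)
    {y : EuclideanSpace ℝ (Fin n)} (hy : y ∈ (chartAt (EuclideanSpace ℝ (Fin n)) p).target) :
    chartGram (conformalMetric n F) p y
      = (‖inChart F p y‖ ^ 2)⁻¹ • gramOf (fderiv ℝ (inChart F p) y) := by
  rw [conformalMetric_eq hF h0, chartGram_inducedMetric hy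
    ((contMDiff_comp_of_ne_zero hF h0 contDiffOn_cylinderMap).mdifferentiable (by simp)),
    fderiv_inChart_cylinderMap hF h0 p hy, gramOf_fderiv_cylinderMap (w := inChart F p y) (h0 _)]

lemma density_cylinderMap (hF : ContMDiff (𝓡 n) 𝓘(ℝ, W) ∞ F) (h0 : ∀ x, F x ≠ 0) (p : M)
    {y : EuclideanSpace ℝ (Fin n)} (hy : y ∈ (chartAt (EuclideanSpace ℝ (Fin n)) p).target) :
    density (inChart (fun x => cylinderMap (F x)) p) y
      = (‖inChart F p y‖ ^ n)⁻¹ * density (inChart F p) y := by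
  rw [density, fderiv_inChart_cylinderMap hF h0 p hy, gramOf_fderiv_cylinderMap (w := inChart F p y) (h0 _),
    Matrix.det_smul, Fintype.card_fin, Real.sqrt_mul (by positivity), density]
  congr 1
  rw [inv_pow, Real.sqrt_inv, ← pow_mul, mul_comm, pow_mul, Real.sqrt_sq (by positivity)]

/-- Scaling the metric by `r⁻²` scales its determinant by `r⁻²ⁿ`, hence the density by `r⁻ⁿ`; this
is compared chart by chart. -/
lemma volumeMeasure_cylinderMap [MeasurableSpace M] [BorelSpace M] [SecondCountableTopology M]
    (hF : IsSmoothImmersion n F) (h0 : ∀ x, F x ≠ 0) :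
    (volumeMeasure (inducedMetric n F)).withDensity (fun x => ENNReal.ofReal (‖F x‖ ^ n)⁻¹)
      = volumeMeasure (inducedMetric n (fun x => cylinderMap (F x))) := by
  have hΦ := hF.cylinderMap_comp h0
  have hm : Measurable (fun x => ENNReal.ofReal (‖F x‖ ^ n)⁻¹) :=
    (contMDiff_comp_of_ne_zero hF.contMDiff h0
      (contDiffOn_inv_norm_pow n)).continuous.measurable.ennreal_ofReal
  refine eq_volumeMeasure hΦ.contMDiff fun p => ?_
  set φ := chartAt (EuclideanSpace ℝ (Fin n)) p with hφ
  rw [restrict_withDensity φ.open_source.measurableSet, volumeMeasure_restrict hF.contMDiff]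
  ext S hS
  rw [withDensity_apply _ hS, chartVolume_apply hΦ.contMDiff p hS, ← hφ,
    ← lintegral_indicator hS, chartVolume, lintegral_map' (hm.indicator hS).aemeasurable
      (aemeasurable_chart_symm _ _), ← hφ]
  have hd : (fun y => ENNReal.ofReal (Real.sqrt (chartGram (inducedMetric n F) p y).det))
      =ᵐ[volume.restrict φ.target] (fun y => ENNReal.ofReal (density (inChart F p) y)) :=
    (ae_restrict_iff' φ.open_target.measurableSet).2 (Filter.Eventually.of_forall fun y hy => by
      beta_reduce
      rw [chartGram_inducedMetric hy (hF.contMDiff.mdifferentiable (by simp))]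
      rfl)
  have hdm : AEMeasurable (fun y => ENNReal.ofReal (density (inChart F p) y))
      (volume.restrict φ.target) :=
    ((contDiffOn_density φ.open_target (contDiffOn_inChart hF.contMDiff p)
        (injective_fderiv_inChart hF p)).continuousOn.aemeasurable
          φ.open_target.measurableSet).ennreal_ofReal
  have hind : AEMeasurable (fun y => S.indicator (fun x => ENNReal.ofReal (‖F x‖ ^ n)⁻¹) (φ.symm y))
      (volume.restrict φ.target) :=
    (hm.indicator hS).comp_aemeasurable
      (φ.continuousOn_symm.aemeasurable φ.open_target.measurableSet)
  rw [withDensity_congr_ae hd, lintegral_withDensity_eq_lintegral_mul₀ hdm hind,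
    Set.inter_comm, ← setLIntegral_indicator₀ _ ?_]
  · refine setLIntegral_congr_fun φ.open_target.measurableSet fun y hy => ?_
    by_cases h : φ.symm y ∈ S
    · simp only [Pi.mul_apply]
      rw [Set.indicator_of_mem h, Set.indicator_of_mem (Set.mem_preimage.2 h),
        density_cylinderMap hF.contMDiff h0 p hy, mul_comm, ENNReal.ofReal_mul (by positivity)]
      rfl
    · simp only [Pi.mul_apply]
      rw [Set.indicator_of_notMem h, Set.indicator_of_notMem (fun h' => h (Set.mem_preimage.1 h')),
        mul_zero]
  · exact (φ.continuousOn_symm.aemeasurable φ.open_target.measurableSet).nullMeasurableSet_preimage hS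

end Conformal

/-! ### The conformal stability inequality and the curvature bound for the potential. -/

section Potential

variable {M : Type*} [TopologicalSpace M] [ChartedSpace (EuclideanSpace ℝ (Fin 4)) M]
  [IsManifold (𝓡 4) ∞ M] {W : Type*} [NormedAddCommGroup W] [InnerProductSpace ℝ W]
  {F ν : M → W} {ψ : M → ℝ} [FiniteDimensional ℝ W]

/-- The stability inequality for the conformal metric and smooth functions. -/
lemma conformal_stability [T2Space M] [SecondCountableTopology M] [MeasurableSpace M] [BorelSpace M]
    (hW : Module.finrank ℝ W = 5)
    (hF : IsSmoothImmersion 4 F) (hν : IsUnitNormal 4 F ν) (hmin : IsMinimal 4 F ν)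
    (hst : IsStable 4 F ν) (h0 : ∀ x, F x ≠ 0)
    (hψ : ContMDiff (𝓡 4) 𝓘(ℝ, ℝ) ∞ ψ) (hψc : HasCompactSupport ψ) :
    ∫ x, potential F ν x * ψ x ^ 2 ∂(volumeMeasure (inducedMetric 4 fun x => cylinderMap (F x)))
      ≤ ∫ x, traceForm (n := 4) (fun x => cylinderMap (F x)) ψ ψ x
          ∂(volumeMeasure (inducedMetric 4 fun x => cylinderMap (F x))) := by
  have hm : Measurable (fun x => ENNReal.ofReal (‖F x‖ ^ 4)⁻¹) :=
    (contMDiff_comp_of_ne_zero hF.contMDiff h0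
      (contDiffOn_inv_norm_pow 4)).continuous.measurable.ennreal_ofReal
  have hlt : ∀ᵐ x ∂(volumeMeasure (inducedMetric 4 F)), ENNReal.ofReal (‖F x‖ ^ 4)⁻¹ < ⊤ :=
    Filter.Eventually.of_forall fun _ => ENNReal.ofReal_lt_top
  rw [← volumeMeasure_cylinderMap hF h0, integral_withDensity_eq_integral_toReal_smul hm hlt,
    integral_withDensity_eq_integral_toReal_smul hm hlt]
  have h := weighted_stability hW hF hν hmin hst h0 hψ hψc
  -- In dimension four, the volume factor `r⁻⁴` and the gradient factor `r²` combine to the weight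
  -- `r⁻²` of the smooth inequality.
  convert h using 2
  · ext x
    rw [ENNReal.toReal_ofReal (by positivity), smul_eq_mul]
  · ext x
    have hn : ‖F x‖ ≠ 0 := norm_ne_zero_iff.2 (h0 x)
    rw [ENNReal.toReal_ofReal (by positivity), smul_eq_mul, traceForm_cylinderMap hF h0]
    field_simp

lemma one_sub_minBiRic_le (hW : Module.finrank ℝ W = 5)
    (hF : IsSmoothImmersion 4 F) (hν : IsUnitNormal 4 F ν) (hmin : IsMinimal 4 F ν)
    (h0 : ∀ x, F x ≠ 0) (x : M) :
    1 - minBiRic (conformalMetric 4 F) x ≤ potential F ν x := by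
  set φ := chartAt (EuclideanSpace ℝ (Fin 4)) x with hφ
  have hy : φ x ∈ φ.target := φ.map_source (mem_chart_source _ x)
  have dF := dAt_eq_fderiv (hF.contMDiff.mdifferentiable (by simp) x)
  have dν := dAt_eq_fderiv (hν.contMDiff.mdifferentiable (by simp) x)
  have hFx : inChart F x (φ x) = F x := inChart_self F x
  have hνx : inChart ν x (φ x) = ν x := inChart_self ν x
  rw [← hφ] at dF dν
  -- The curvature form pairs its chart coefficients with the metric read through `gram`; at the
  -- centre of the chart both readings of the metric agree.
  have hgram : gram (conformalMetric 4 F) x = chartGram (conformalMetric 4 F) x (φ x) := by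
    rw [chartGram_conformalMetric hF.contMDiff h0 x hy, ← dF, hFx]
    rfl
  suffices h : 1 - potential F ν x ≤ minBiRic (conformalMetric 4 F) x by linarith
  refine le_csInf ?_ ?_
  -- An orthonormal pair exists, so the infimum is over a nonempty set and is not the default value
  -- of `sInf`.
  · obtain ⟨e, he⟩ := exists_frame (n := 4) ((hF.cylinderMap_comp h0).injective x)
    rw [conformalMetric_eq hF.contMDiff h0]
    have he' := orthonormal_iff_ite.1 he
    refine ⟨_, e 0, e 1, ?_, ?_, ?_, rfl⟩
    · exact (he' 0 0).trans (if_pos rfl)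
    · exact (he' 1 1).trans (if_pos rfl)
    · exact (he' 0 1).trans (if_neg (by decide))
  · rintro t ⟨v, w, hv, hw, hvw, rfl⟩
    have hb := biRic_lower_bound (ν := inChart ν x) (h := chartGram (conformalMetric 4 F) x)
      hW φ.open_target (contDiffOn_inChart hF.contMDiff x) (fun _ _ => h0 _)
      (injective_fderiv_inChart hF x) (contDiffOn_inChart hν.contMDiff x)
      (by rw [hνx]; exact hν.norm_eq_one x) (inner_fderiv_inChart_normal hF.contMDiff hν x)
      (fun z hz => chartGram_conformalMetric hF.contMDiff h0 x hz) hy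
      (by
        rw [← dF, ← dν]
        exact (meanCurvature_eq hF.contMDiff hν x).symm.trans (hmin x)) v w
      (by rw [hFx, ← dF]; exact hv) (by rw [hFx, ← dF]; exact hw) (by rw [hFx, ← dF]; exact hvw)
    rw [hFx, hνx, ← dF, ← dν] at hb
    have hR : riemann (conformalMetric 4 F) x v w w v
        = riemannOf (chartGram (conformalMetric 4 F) x) (φ x) v w w v := by
      unfold riemann
      rw [hgram]
      rfl
    have hRic : ∀ v, ricci (conformalMetric 4 F) x v v
        = ricciOf (chartGram (conformalMetric 4 F) x) (φ x) v v := fun _ => rfl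
    rw [biRic, hR, hRic, hRic]
    refine le_trans (le_of_eq ?_) hb
    rw [potential, shapeNormSq]
    ring

end Potential

/-! ### Lipschitz functions for the Riemannian distance, in charts. -/

section Lipschitz

variable {n : ℕ} {M : Type*} [TopologicalSpace M] [ChartedSpace (EuclideanSpace ℝ (Fin n)) M]
  {W : Type*} [NormedAddCommGroup W] [InnerProductSpace ℝ W] [IsManifold (𝓡 n) ∞ M] {F : M → W}

/-- The distance of two points in a chart is bounded by the length of the coordinate segment. -/
lemma riemDist_le_of_segment (hF : ContMDiff (𝓡 n) 𝓘(ℝ, W) ∞ F) (p : M)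
    {y z : EuclideanSpace ℝ (Fin n)} {C : ℝ}
    (hseg : segment ℝ y z ⊆ (chartAt (EuclideanSpace ℝ (Fin n)) p).target)
    (hC : ∀ w ∈ segment ℝ y z, ‖fderiv ℝ (inChart F p) w‖ ≤ C) :
    riemDist (inducedMetric n F) ((chartAt (EuclideanSpace ℝ (Fin n)) p).symm y)
      ((chartAt (EuclideanSpace ℝ (Fin n)) p).symm z) ≤ ENNReal.ofReal (C * ‖z - y‖) := by
  set φ := chartAt (EuclideanSpace ℝ (Fin n)) p with hφ
  let _ : ∀ x : M, ENorm (TangentSpace (𝓡 n) x) := fun x =>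
    ⟨fun v => ENNReal.ofReal (Real.sqrt (inducedMetric n F x v v))⟩
  -- The length of a path for the induced metric is the length of its image under `F`, so a bound on
  -- the differential of `F` in the chart bounds it.
  have henorm : ∀ (x : M) (v : TangentSpace (𝓡 n) x), ‖v‖ₑ = ENNReal.ofReal ‖dAt F x v‖ :=
    fun x v => by
      change ENNReal.ofReal (Real.sqrt (inner ℝ (dAt F x v) (dAt F x v))) = _
      rw [real_inner_self_eq_norm_sq, Real.sqrt_sq (norm_nonneg _)]
  have _ : ∀ x : M, ENormSMulClass ℝ (TangentSpace (𝓡 n) x) := fun x => ⟨fun r v => by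
    rw [henorm, henorm]
    have : dAt F x (r • v) = r • dAt F x v := (dAt F x).map_smul r v
    rw [this, norm_smul, ENNReal.ofReal_mul (norm_nonneg _), ← ofReal_norm]⟩
  let ℓ : ℝ → EuclideanSpace ℝ (Fin n) := fun t => y + t • (z - y)
  have hℓ : ∀ t ∈ Set.Icc (0 : ℝ) 1, ℓ t ∈ segment ℝ y z := fun t ht => by
    rw [segment_eq_image']
    exact ⟨t, ht, rfl⟩
  have hℓd : ∀ t, HasFDerivAt ℓ ((ContinuousLinearMap.id ℝ ℝ).smulRight (z - y)) t := fun t =>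
    ((hasFDerivAt_id t).smul_const (z - y)).const_add y
  have hγ : ContMDiffOn 𝓘(ℝ, ℝ) (𝓡 n) 1 (φ.symm ∘ ℓ) (Set.Icc 0 1) := by
    have h1 : ContMDiffOn (𝓡 n) (𝓡 n) ∞ φ.symm φ.target := contMDiffOn_chart_symm
    have h2 : ContDiff ℝ 1 ℓ := by fun_prop
    exact (h1.of_le (by simp)).comp h2.contMDiff.contMDiffOn fun t ht => hseg (hℓ t ht)
  have hle := Manifold.riemannianEDist_le_pathELength (I := 𝓡 n) (x := φ.symm y) (y := φ.symm z)
    hγ (by simp [ℓ]) (by simp [ℓ]) zero_le_one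
  refine le_trans hle ?_
  rw [Manifold.pathELength_eq_lintegral_mfderiv_Icc]
  refine (setLIntegral_mono' (g := fun _ => ENNReal.ofReal (C * ‖z - y‖)) measurableSet_Icc
    fun t ht => ?_).trans (by rw [setLIntegral_const]; simp)
  rw [henorm]
  refine ENNReal.ofReal_le_ofReal ?_
  have hty : ℓ t ∈ φ.target := hseg (hℓ t ht)
  have h1 : IsManifold (𝓡 n) 1 M := IsManifold.of_le (n := ∞) (by simp)
  have h2 := mdifferentiableAt_atlas_symm (I := 𝓡 n)
    (chart_mem_atlas (EuclideanSpace ℝ (Fin n)) p) hty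
  have h3 : mfderiv 𝓘(ℝ, ℝ) (𝓡 n) (φ.symm ∘ ℓ) t
      = (mfderiv (𝓡 n) (𝓡 n) φ.symm (ℓ t)).comp (mfderiv 𝓘(ℝ, ℝ) (𝓡 n) ℓ t) :=
    mfderiv_comp t h2 (hℓd t).differentiableAt.mdifferentiableAt
  have h4 : mfderiv 𝓘(ℝ, ℝ) (𝓡 n) (φ.symm ∘ ℓ) t (1 : ℝ) = dChartSymm p (ℓ t) (z - y) := by
    rw [h3]
    have h5 : mfderiv 𝓘(ℝ, ℝ) (𝓡 n) ℓ t = (ContinuousLinearMap.id ℝ ℝ).smulRight (z - y) :=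
      mfderiv_eq_fderiv.trans (hℓd t).fderiv
    change mfderiv (𝓡 n) (𝓡 n) φ.symm (ℓ t) (mfderiv 𝓘(ℝ, ℝ) (𝓡 n) ℓ t (1 : ℝ)) = _
    rw [h5]
    change mfderiv (𝓡 n) (𝓡 n) φ.symm (ℓ t) ((1 : ℝ) • (z - y)) = _
    rw [one_smul]
    rfl
  have h6 := dAt_comp_dChartSymm (f := F) hty (hF.mdifferentiable (by simp) _) (z - y)
  have h7 : ‖fderiv ℝ (inChart F p) (ℓ t) (z - y)‖ ≤ C * ‖z - y‖ :=
    (ContinuousLinearMap.le_opNorm _ _).trans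
      (mul_le_mul_of_nonneg_right (hC _ (hℓ t ht)) (norm_nonneg _))
  rw [← h6, ← h4] at h7
  exact h7

/-- A function that is Lipschitz for the distance of the metric is locally Lipschitz in charts. -/
lemma IsLipschitz.locallyLipschitzOn_inChart (hF : ContMDiff (𝓡 n) 𝓘(ℝ, W) ∞ F) {ψ : M → ℝ}
    (hψ : IsLipschitz (inducedMetric n F) ψ) (p : M) {y : EuclideanSpace ℝ (Fin n)}
    (hy : y ∈ (chartAt (EuclideanSpace ℝ (Fin n)) p).target) :
    ∃ K, ∃ t ∈ nhds y, LipschitzOnWith K (inChart ψ p) t := by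
  set φ := chartAt (EuclideanSpace ℝ (Fin n)) p with hφ
  obtain ⟨K, hK⟩ := hψ
  obtain ⟨ε, hε, hball⟩ := Metric.nhds_basis_closedBall.mem_iff.1 (φ.open_target.mem_nhds hy)
  obtain ⟨C, hC⟩ := (isCompact_closedBall y ε).exists_bound_of_continuousOn
    ((contDiffOn_fderiv φ.open_target (contDiffOn_inChart hF p)).continuousOn.mono hball)
  refine ⟨K * C.toNNReal, _, Metric.closedBall_mem_nhds y hε, fun a ha b hb => ?_⟩
  have hs : segment ℝ a b ⊆ Metric.closedBall y ε := (convex_closedBall y ε).segment_subset ha hb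
  have h := riemDist_le_of_segment hF p (hs.trans hball) fun w hw => hC w (hs hw)
  refine (hK _ _).trans ?_
  rw [ENNReal.coe_mul, mul_assoc]
  gcongr
  refine h.trans ?_
  rw [ENNReal.ofReal_mul' (norm_nonneg _), edist_comm, edist_dist, dist_eq_norm]
  rfl

end Lipschitz

/-! ### Local and global Lipschitz functions. -/

section EuclideanLipschitz

variable {E : Type*} [NormedAddCommGroup E]

lemma exists_lipschitzOnWith_mul {f g : E → ℝ} {y : E}
    (hf : ∃ K, ∃ t ∈ nhds y, LipschitzOnWith K f t)
    (hg : ∃ K, ∃ t ∈ nhds y, LipschitzOnWith K g t) :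
    ∃ K, ∃ t ∈ nhds y, LipschitzOnWith K (fun z => f z * g z) t := by
  obtain ⟨K₁, t₁, ht₁, h₁⟩ := hf
  obtain ⟨K₂, t₂, ht₂, h₂⟩ := hg
  have hmul : ContDiffAt ℝ 1 (fun q : ℝ × ℝ => q.1 * q.2) (f y, g y) := by fun_prop
  obtain ⟨K, t, ht, hK⟩ := hmul.exists_lipschitzOnWith
  have hc : ContinuousAt (fun z => (f z, g z)) y :=
    (h₁.continuousOn.continuousAt ht₁).prodMk (h₂.continuousOn.continuousAt ht₂)
  refine ⟨K * max K₁ K₂, (t₁ ∩ t₂) ∩ (fun z => (f z, g z)) ⁻¹' t,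
    Filter.inter_mem (Filter.inter_mem ht₁ ht₂) (hc.preimage_mem_nhds ht), ?_⟩
  exact hK.comp ((h₁.mono fun z hz => hz.1.1).prodMk (h₂.mono fun z hz => hz.1.2))
    fun z hz => hz.2

/-- Let the support lie in the ball of radius `R`. Inside the ball of radius `R + 1`, compactness
gives one constant; from a point of the smaller ball to a point outside the larger one the distance
is at least 1, so a bound on `|f|` serves as constant. -/
lemma exists_lipschitzWith_of_hasCompactSupport [ProperSpace E] {f : E → ℝ} (hf : LocallyLipschitz f)
    (hc : HasCompactSupport f) : ∃ K, LipschitzWith K f := by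
  obtain ⟨R, hR⟩ := hc.isCompact.isBounded.subset_closedBall (0 : E)
  obtain ⟨K, hK⟩ := hf.locallyLipschitzOn.exists_lipschitzOnWith_of_compact
    (isCompact_closedBall (0 : E) (R + 1))
  obtain ⟨B, hB⟩ := hc.exists_bound_of_continuous hf.continuous
  have h0 : ∀ z, z ∉ Metric.closedBall (0 : E) R → f z = 0 := fun z hz =>
    image_eq_zero_of_notMem_tsupport fun h => hz (hR h)
  have key : ∀ x y, x ∈ Metric.closedBall (0 : E) (R + 1) →
      dist (f x) (f y) ≤ max (K : ℝ) B * dist x y := fun x y hx => by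
    by_cases hy : y ∈ Metric.closedBall (0 : E) (R + 1)
    · exact (hK.dist_le_mul x hx y hy).trans
        (mul_le_mul_of_nonneg_right (le_max_left _ _) dist_nonneg)
    · have hm : 0 ≤ max (K : ℝ) B := K.coe_nonneg.trans (le_max_left _ _)
      have hy0 : f y = 0 := h0 y fun h => hy (Metric.closedBall_subset_closedBall (by linarith) h)
      by_cases hxR : x ∈ Metric.closedBall (0 : E) R
      · have hd : 1 ≤ dist x y := by
          simp only [Metric.mem_closedBall, dist_zero_right, not_le] at hxR hy
          have := norm_sub_norm_le y x
          rw [dist_comm, dist_eq_norm]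
          linarith
        have h1 : dist (f x) (f y) ≤ max (K : ℝ) B := by
          rw [hy0, dist_zero_right]
          exact (hB x).trans (le_max_right _ _)
        nlinarith
      · rw [h0 x hxR, hy0, dist_self]
        positivity
  refine ⟨(max (K : ℝ) B).toNNReal, LipschitzWith.of_dist_le_mul fun x y => ?_⟩
  rw [Real.coe_toNNReal _ (K.coe_nonneg.trans (le_max_left _ _))]
  by_cases hx : x ∈ Metric.closedBall (0 : E) (R + 1)
  · exact key x y hx
  · by_cases hy : y ∈ Metric.closedBall (0 : E) (R + 1)
    · rw [dist_comm, dist_comm x]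
      exact key y x hy
    · have hsub := Metric.closedBall_subset_closedBall (x := (0 : E)) (by linarith : R ≤ R + 1)
      rw [h0 x fun h => hx (hsub h), h0 y fun h => hy (hsub h), dist_self]
      have hm : 0 ≤ max (K : ℝ) B := K.coe_nonneg.trans (le_max_left _ _)
      positivity

end EuclideanLipschitz

/-! ### Mollification of compactly supported Lipschitz functions. -/

section Mollification

open scoped Convolution

variable {E : Type*} [NormedAddCommGroup E] [NormedSpace ℝ E] [FiniteDimensional ℝ E]
  [MeasurableSpace E] [BorelSpace E] {f : E → ℝ} {C : ℝ≥0}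

/-- The derivative falls on `f` rather than on the kernel, so the gradients of the mollifications
are averages of the gradient of `f`: they keep its bound and converge almost everywhere. -/
lemma hasFDerivAt_mollification (μ : Measure E) [μ.IsAddHaarMeasure] (hf : LipschitzWith C f)
    (β : ContDiffBump (0 : E)) (x : E) :
    HasFDerivAt (β.normed μ ⋆[ContinuousLinearMap.lsmul ℝ ℝ, μ] f : E → ℝ)
      ((β.normed μ ⋆[ContinuousLinearMap.lsmul ℝ ℝ, μ] (fderiv ℝ f) : E → E →L[ℝ] ℝ) x) x := by
  have hcont : ∀ x, Continuous (fun t => β.normed μ t • f (x - t)) := fun x =>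
    β.continuous_normed.smul (hf.continuous.comp (continuous_const.sub continuous_id))
  -- Rademacher's theorem; the reflection `t ↦ x - t` pulls null sets back to null sets.
  have hd : ∀ᵐ t ∂μ, DifferentiableAt ℝ f (x - t) := by
    have h1 : ∀ᵐ z ∂μ, DifferentiableAt ℝ f z := hf.ae_differentiableAt
    exact (quasiMeasurePreserving_sub_left_of_right_invariant μ x).ae h1
  refine (hasFDerivAt_integral_of_dominated_loc_of_lip (s := Set.univ)
    (F := fun z t => β.normed μ t • f (z - t)) (F' := fun t => β.normed μ t • fderiv ℝ f (x - t))
    (bound := fun t => β.normed μ t * C) Filter.univ_mem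
    (Filter.Eventually.of_forall fun z => (hcont z).aestronglyMeasurable) ?_ ?_ ?_ ?_ ?_).2
  · refine (hcont x).integrable_of_hasCompactSupport ?_
    exact β.hasCompactSupport_normed.smul_right
  · refine AEStronglyMeasurable.smul β.continuous_normed.aestronglyMeasurable ?_
    exact ((measurable_fderiv ℝ f).comp (measurable_const.sub measurable_id)).aestronglyMeasurable
  · refine Filter.Eventually.of_forall fun t => LipschitzOnWith.of_dist_le_mul fun a _ b _ => ?_
    have hnn : 0 ≤ β.normed μ t := β.nonneg_normed t
    have h1 := hf.dist_le_mul (a - t) (b - t)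
    rw [dist_sub_right] at h1
    rw [dist_smul₀, Real.norm_of_nonneg hnn, Real.coe_nnabs,
      abs_of_nonneg (mul_nonneg hnn C.coe_nonneg), mul_assoc]
    exact mul_le_mul_of_nonneg_left h1 hnn
  · exact β.integrable_normed.mul_const _
  · filter_upwards [hd] with t ht
    have h1 : HasFDerivAt (fun z => f (z - t)) (fderiv ℝ f (x - t)) x :=
      (hasFDerivAt_comp_sub _).2 ht.hasFDerivAt
    exact h1.fun_const_smul _

lemma norm_mollification_le (μ : Measure E) [μ.IsAddHaarMeasure] {V : Type*} [NormedAddCommGroup V]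
    [NormedSpace ℝ V] {g : E → V} {D : ℝ} (hg : ∀ z, ‖g z‖ ≤ D) (β : ContDiffBump (0 : E)) (x : E) :
    ‖(β.normed μ ⋆[ContinuousLinearMap.lsmul ℝ ℝ, μ] g : E → V) x‖ ≤ D := by
  rw [convolution_lsmul]
  have h1 : ∀ t, ‖β.normed μ t • g (x - t)‖ ≤ β.normed μ t * D := fun t => by
    rw [norm_smul, Real.norm_of_nonneg (β.nonneg_normed t)]
    exact mul_le_mul_of_nonneg_left (hg _) (β.nonneg_normed t)
  refine (norm_integral_le_of_norm_le (β.integrable_normed.mul_const D)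
    (Filter.Eventually.of_forall h1)).trans (le_of_eq ?_)
  rw [integral_mul_const, β.integral_normed, one_mul]

/-- Smooth approximations of a compactly supported Lipschitz function. -/
lemma exists_mollification (μ : Measure E) [μ.IsAddHaarMeasure] (hf : LipschitzWith C f)
    (hfc : HasCompactSupport f) {U : Set E} (hU : IsOpen U) (hfU : tsupport f ⊆ U) :
    ∃ (K : Set E) (B : ℝ) (u : ℕ → E → ℝ), IsCompact K ∧ K ⊆ U ∧ (∀ k, ContDiff ℝ ∞ (u k)) ∧
      (∀ k, ∀ x ∉ K, u k x = 0) ∧ (∀ k x, |u k x| ≤ B) ∧ (∀ k x, ‖fderiv ℝ (u k) x‖ ≤ C) ∧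
      (∀ x, Filter.Tendsto (fun k => u k x) Filter.atTop (nhds (f x))) ∧
      ∀ᵐ x ∂μ, DifferentiableAt ℝ f x ∧
        Filter.Tendsto (fun k => fderiv ℝ (u k) x) Filter.atTop (nhds (fderiv ℝ f x)) := by
  obtain ⟨δ, hδ, hδU⟩ := hfc.isCompact.exists_cthickening_subset_open hU hfU
  obtain ⟨B, hB⟩ := hfc.exists_bound_of_continuous hf.continuous
  let β : ℕ → ContDiffBump (0 : E) := fun k =>
    ⟨δ / (k + 1) / 2, δ / (k + 1), by positivity, by
      have : 0 < δ / (k + 1) := by positivity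
      linarith⟩
  have hr : Filter.Tendsto (fun k => (β k).rOut) Filter.atTop (nhds 0) :=
    ((tendsto_const_div_atTop_nhds_zero_nat δ).comp (Filter.tendsto_add_atTop_nat 1)).congr
      fun k => by simp [β]
  -- A bounded ratio of the two radii is required for convergence at almost every point for a merely
  -- locally integrable function, here the gradient.
  have hr' : ∀ k, (β k).rOut ≤ 2 * (β k).rIn := fun k => by
    change δ / (k + 1) ≤ 2 * (δ / (k + 1) / 2)
    linarith
  have hrδ : ∀ k, (β k).rOut ≤ δ := fun k => div_le_self hδ.le (by simp)
  have hbound : ∀ x, ‖fderiv ℝ f x‖ ≤ C := fun x => norm_fderiv_le_of_lipschitz ℝ hf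
  have hli : LocallyIntegrable (fderiv ℝ f) μ := by
    refine (locallyIntegrable_const (C : ℝ)).mono (measurable_fderiv ℝ f).aestronglyMeasurable ?_
    exact Filter.Eventually.of_forall fun x => by simpa using hbound x
  refine ⟨Metric.cthickening δ (tsupport f), B,
    fun k => (β k).normed μ ⋆[ContinuousLinearMap.lsmul ℝ ℝ, μ] f, hfc.isCompact.cthickening, hδU,
    fun k => ?_, fun k x hx => ?_, fun k x => ?_, fun k x => ?_, fun x => ?_, ?_⟩
  · exact (β k).hasCompactSupport_normed.contDiff_convolution_left _
      ((β k).contDiff_normed (n := ⊤)) hf.continuous.locallyIntegrable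
  · by_contra h
    obtain ⟨a, ha, b, hb, rfl⟩ := support_convolution_subset _ h
    refine hx (Metric.mem_cthickening_of_dist_le (a + b) b δ _ (subset_tsupport _ hb) ?_)
    rw [(β k).support_normed_eq, mem_ball_zero_iff] at ha
    rw [dist_eq_norm, add_sub_cancel_right]
    exact ha.le.trans (hrδ k)
  · exact norm_mollification_le μ hB (β k) x
  · rw [(hasFDerivAt_mollification μ hf (β k) x).fderiv]
    exact norm_mollification_le μ hbound (β k) x
  · exact ContDiffBump.convolution_tendsto_right_of_continuous hr hf.continuous x
  · have h1 : ∀ᵐ z ∂μ, DifferentiableAt ℝ f z := hf.ae_differentiableAt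
    filter_upwards [h1, ContDiffBump.ae_convolution_tendsto_right_of_locallyIntegrable hr
      (Filter.Eventually.of_forall hr') hli] with x hx hx'
    refine ⟨hx, ?_⟩
    simpa only [(hasFDerivAt_mollification μ hf (β _) x).fderiv] using hx'

end Mollification

/-! ### Smooth approximation on the manifold and passage to Lipschitz functions. -/

section Approximation

variable {n : ℕ} {M : Type*} [TopologicalSpace M] [ChartedSpace (EuclideanSpace ℝ (Fin n)) M]
  {W : Type*} [NormedAddCommGroup W] [InnerProductSpace ℝ W]

lemma traceForm_self_nonneg {F : M → W} (hF : IsSmoothImmersion n F) (u : M → ℝ) (x : M) :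
    0 ≤ traceForm (n := n) F u u x := by
  obtain ⟨e, he⟩ := exists_frame (hF.injective x)
  rw [traceForm_frame he]
  exact Finset.sum_nonneg fun a _ => real_inner_self_nonneg

lemma traceForm_add_le {F : M → W} (hF : IsSmoothImmersion n F) {u v : M → ℝ} {x : M}
    (hu : MDifferentiableAt (𝓡 n) 𝓘(ℝ, ℝ) u x) (hv : MDifferentiableAt (𝓡 n) 𝓘(ℝ, ℝ) v x) :
    traceForm (n := n) F (fun x => u x + v x) (fun x => u x + v x) x
      ≤ 2 * (traceForm (n := n) F u u x + traceForm (n := n) F v v x) := by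
  obtain ⟨e, he⟩ := exists_frame (hF.injective x)
  rw [traceForm_frame he, traceForm_frame he, traceForm_frame he, ← Finset.sum_add_distrib,
    Finset.mul_sum, dAt_add hu hv]
  refine Finset.sum_le_sum fun a _ => ?_
  simp only [real_inner_self_eq_norm_sq, Real.norm_eq_abs, sq_abs, add_apply]
  nlinarith [sq_nonneg (dAt u x (e a) - dAt v x (e a))]

/-- The functions `u k` are smooth, supported in the compact set `K`, bounded by `C` together with
the squares of their gradients, and converge to `ψ` with almost everywhere convergent
differentials. -/
structure SmoothApprox [MeasurableSpace M] (F : M → W) (ψ : M → ℝ) (u : ℕ → M → ℝ) (K : Set M)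
    (C : ℝ) : Prop where
  isCompact : IsCompact K
  contMDiff : ∀ k, ContMDiff (𝓡 n) 𝓘(ℝ, ℝ) ∞ (u k)
  tsupport_subset : ∀ k, tsupport (u k) ⊆ K
  abs_le : ∀ k x, |u k x| ≤ C
  traceForm_le : ∀ k x, traceForm (n := n) F (u k) (u k) x ≤ C
  tendsto : ∀ x, Filter.Tendsto (fun k => u k x) Filter.atTop (nhds (ψ x))
  ae_tendsto : ∀ᵐ x ∂(volumeMeasure (inducedMetric n F)),
    MDifferentiableAt (𝓡 n) 𝓘(ℝ, ℝ) ψ x ∧ ∀ v : EuclideanSpace ℝ (Fin n),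
      Filter.Tendsto (fun k => dAt (u k) x v) Filter.atTop (nhds (dAt ψ x v))

variable [MeasurableSpace M] {F : M → W}

lemma SmoothApprox.zero : SmoothApprox (n := n) F (fun _ => 0) (fun _ _ => 0) ∅ 0 where
  isCompact := isCompact_empty
  contMDiff _ := contMDiff_const
  tsupport_subset _ := by simp [tsupport]
  abs_le _ _ := by simp
  traceForm_le _ x := (traceForm_eq_zero (dAt_const _ x)).le
  tendsto _ := tendsto_const_nhds
  ae_tendsto := Filter.Eventually.of_forall fun _ => ⟨mdifferentiableAt_const, fun _ =>
    tendsto_const_nhds⟩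

/-- The factor 2 in the constant comes from `(a + b)² ≤ 2(a² + b²)` for the gradients. -/
lemma SmoothApprox.add (hF : IsSmoothImmersion n F) {ψ₁ ψ₂ : M → ℝ} {u₁ u₂ : ℕ → M → ℝ}
    {K₁ K₂ : Set M} {C₁ C₂ : ℝ} (h₁ : SmoothApprox (n := n) F ψ₁ u₁ K₁ C₁)
    (h₂ : SmoothApprox (n := n) F ψ₂ u₂ K₂ C₂) :
    SmoothApprox (n := n) F (fun x => ψ₁ x + ψ₂ x) (fun k x => u₁ k x + u₂ k x) (K₁ ∪ K₂)
      (2 * (C₁ + C₂)) where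
  isCompact := h₁.isCompact.union h₂.isCompact
  contMDiff k := (h₁.contMDiff k).add (h₂.contMDiff k)
  tsupport_subset k :=
    (tsupport_add (u₁ k) (u₂ k)).trans
      (Set.union_subset_union (h₁.tsupport_subset k) (h₂.tsupport_subset k))
  abs_le k x := by
    have h := abs_add_le (u₁ k x) (u₂ k x)
    have h1 := h₁.abs_le k x
    have h2 := h₂.abs_le k x
    have h3 := abs_nonneg (u₁ k x)
    have h4 := abs_nonneg (u₂ k x)
    linarith
  traceForm_le k x := by
    refine (traceForm_add_le hF ((h₁.contMDiff k).mdifferentiable (by simp) x)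
      ((h₂.contMDiff k).mdifferentiable (by simp) x)).trans ?_
    have h1 := h₁.traceForm_le k x
    have h2 := h₂.traceForm_le k x
    linarith
  tendsto x := (h₁.tendsto x).add (h₂.tendsto x)
  ae_tendsto := by
    filter_upwards [h₁.ae_tendsto, h₂.ae_tendsto] with x hx₁ hx₂
    refine ⟨hx₁.1.add hx₂.1, fun v => ?_⟩
    rw [dAt_add hx₁.1 hx₂.1]
    refine ((hx₁.2 v).add (hx₂.2 v)).congr fun k => ?_
    rw [dAt_add ((h₁.contMDiff k).mdifferentiable (by simp) x)
      ((h₂.contMDiff k).mdifferentiable (by simp) x)]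
    rfl

lemma exists_smoothApprox_sum (hF : IsSmoothImmersion n F) {ι : Type*} (s : Finset ι)
    {ψ : ι → M → ℝ} (h : ∀ i ∈ s, ∃ u K C, SmoothApprox (n := n) F (ψ i) u K C) :
    ∃ u K C, SmoothApprox (n := n) F (fun x => ∑ i ∈ s, ψ i x) u K C := by
  classical
  induction s using Finset.induction_on with
  | empty => exact ⟨_, _, _, by simpa using SmoothApprox.zero⟩
  | insert a s ha ih =>
    obtain ⟨u, K, C, h₁⟩ := h a (Finset.mem_insert_self _ _)
    obtain ⟨u', K', C', h₂⟩ := ih fun i hi => h i (Finset.mem_insert_of_mem hi)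
    simp only [Finset.sum_insert ha]
    exact ⟨_, _, _, h₁.add hF h₂⟩

variable [T2Space M] [BorelSpace M] [IsManifold (𝓡 n) ∞ M]

lemma exists_smoothApprox_chart (hF : IsSmoothImmersion n F) {p : M} {ψ : M → ℝ}
    (hψc : HasCompactSupport ψ) (hψp : tsupport ψ ⊆ (chartAt (EuclideanSpace ℝ (Fin n)) p).source)
    (hψ : ∀ y ∈ (chartAt (EuclideanSpace ℝ (Fin n)) p).target,
      ∃ K, ∃ t ∈ nhds y, LipschitzOnWith K (inChart ψ p) t) :
    ∃ u K C, SmoothApprox (n := n) F ψ u K C := by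
  set φ := chartAt (EuclideanSpace ℝ (Fin n)) p with hφ
  set f := φ.target.indicator (inChart ψ p) with hf
  set L := φ '' tsupport ψ with hL
  have hLc : IsCompact L := hψc.isCompact.image_of_continuousOn (φ.continuousOn.mono hψp)
  have hLt : L ⊆ φ.target := by
    rintro _ ⟨x, hx, rfl⟩
    exact φ.map_source (hψp hx)
  have hψ0 : ∀ z ∈ φ.target, z ∉ L → inChart ψ p z = 0 := fun z hz hzL => by
    by_contra h
    exact hzL ⟨φ.symm z, subset_tsupport _ h, φ.right_inv hz⟩
  have hf0 : ∀ z, z ∉ L → f z = 0 := fun z hz =>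
    (indicator_eventuallyEq_zero hLc.isClosed hψ0 hz).self_of_nhds
  have hfL : tsupport f ⊆ L := closure_minimal (fun z hz => by
    by_contra h
    exact hz (hf0 z h)) hLc.isClosed
  have hfc : HasCompactSupport f := HasCompactSupport.intro hLc hf0
  have hloc : LocallyLipschitz f := fun z => by
    by_cases hz : z ∈ L
    · obtain ⟨K, t, ht, hK⟩ := hψ z (hLt hz)
      refine ⟨K, t ∩ φ.target, Filter.inter_mem ht (φ.open_target.mem_nhds (hLt hz)),
        fun a ha b hb => ?_⟩
      rw [hf, Set.indicator_of_mem ha.2, Set.indicator_of_mem hb.2]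
      exact hK ha.1 hb.1
    · refine ⟨0, Lᶜ, hLc.isClosed.isOpen_compl.mem_nhds hz, fun a ha b hb => ?_⟩
      rw [hf0 a ha, hf0 b hb]
      simp
  obtain ⟨C, hC⟩ := exists_lipschitzWith_of_hasCompactSupport hloc hfc
  obtain ⟨K, B, v, hKc, hKt, hvs, hv0, hvB, hvC, hvt, hvae⟩ :=
    exists_mollification volume hC hfc φ.open_target (hfL.trans hLt)
  set u : ℕ → M → ℝ := fun k => φ.source.indicator fun x => v k (φ x) with hu
  have hus : ∀ k x, x ∈ φ.source → u k x = v k (φ x) := fun k x hx => Set.indicator_of_mem hx _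
  have huc : ∀ k, Set.EqOn (inChart (u k) p) (v k) φ.target := fun k y hy => by
    change u k (φ.symm y) = v k y
    rw [hus k _ (φ.map_target hy), φ.right_inv hy]
  have hKM : IsCompact (φ.symm '' K) :=
    hKc.image_of_continuousOn (φ.continuousOn_symm.mono hKt)
  have hKs : φ.symm '' K ⊆ φ.source := by
    rintro _ ⟨y, hy, rfl⟩
    exact φ.map_target (hKt hy)
  have hut : ∀ k, tsupport (u k) ⊆ φ.symm '' K := fun k => closure_minimal (fun x hx => by
    have hxs : x ∈ φ.source := Set.mem_of_indicator_ne_zero hx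
    refine ⟨φ x, ?_, φ.left_inv hxs⟩
    by_contra h
    exact hx ((hus k x hxs).trans (hv0 k _ h))) hKM.isClosed
  have husm : ∀ k, ContMDiff (𝓡 n) 𝓘(ℝ, ℝ) ∞ (u k) := fun k =>
    contMDiff_of_tsupport fun x hx => contMDiffAt_of_inChart (p := p) (hKs (hut k hx))
      ((hvs k).contDiffOn.congr (huc k))
  have hB0 : 0 ≤ B := (abs_nonneg _).trans (hvB 0 0)
  have hginv : ∀ i j, ∃ D, ∀ y ∈ K, ‖(gramOf (fderiv ℝ (inChart F p) y))⁻¹ i j‖ ≤ D := fun i j =>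
    hKc.exists_bound_of_continuousOn ((contDiffOn_inv
      (contDiffOn_gramOf φ.open_target (contDiffOn_inChart hF.contMDiff p))
      (fun z hz => (gramOf_det_pos (injective_fderiv_inChart hF p z hz)).ne') i j).continuousOn.mono
        hKt)
  choose D hD using hginv
  -- Bounds the gradient square on `K`: `D` bounds the inverse metric there and `C` the partial
  -- derivatives of the mollifications.
  set T : ℝ := ∑ i, ∑ j, |D i j| * (C * C) with hT
  have hT0 : 0 ≤ T := by positivity
  refine ⟨u, φ.symm '' K, B + T, hKM, husm, hut, fun k x => ?_, fun k x => ?_, fun x => ?_, ?_⟩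
  · by_cases hx : x ∈ φ.source
    · rw [hus k x hx]
      exact (hvB k _).trans (by linarith)
    · rw [hu]
      beta_reduce
      rw [Set.indicator_of_notMem hx, abs_zero]
      linarith
  · by_cases hx : x ∈ φ.symm '' K
    · have hxs := hKs hx
      have hxK : φ x ∈ K := by
        obtain ⟨y, hy, rfl⟩ := hx
        rwa [φ.right_inv (hKt hy)]
      have d := (husm k).mdifferentiable (by simp) x
      rw [traceForm_eq hxs (hF.contMDiff.mdifferentiable (by simp) x) d d, traceFormLoc]
      refine le_trans ?_ (by linarith : T ≤ B + T)
      refine Finset.sum_le_sum fun i _ => Finset.sum_le_sum fun j _ => ?_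
      have hfd : fderiv ℝ (inChart (u k) p) (φ x) = fderiv ℝ (v k) (φ x) :=
        ((huc k).eventuallyEq_of_mem (φ.open_target.mem_nhds (hKt hxK))).fderiv_eq
      have hb : ∀ i, ‖fderiv ℝ (v k) (φ x) (stdVec i)‖ ≤ C := fun i =>
        (ContinuousLinearMap.le_of_opNorm_le _ (hvC k _) _).trans (by simp [stdVec])
      rw [← hφ, hfd]
      refine (le_abs_self _).trans ?_
      rw [abs_mul]
      refine mul_le_mul ((hD i j _ hxK).trans (le_abs_self _)) ?_ (abs_nonneg _) (abs_nonneg _)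
      exact (abs_real_inner_le_norm _ _).trans
        (mul_le_mul (hb i) (hb j) (norm_nonneg _) C.coe_nonneg)
    · rw [traceForm_eq_zero (dAt_eq_zero_of_notMem_tsupport fun h => hx (hut k h))]
      linarith
  · by_cases hx : x ∈ φ.source
    · have h := hvt (φ x)
      have hfx : f (φ x) = ψ x := by
        rw [hf, Set.indicator_of_mem (φ.map_source hx)]
        change ψ (φ.symm (φ x)) = ψ x
        rw [φ.left_inv hx]
      rw [hfx] at h
      exact h.congr fun k => (hus k x hx).symm
    · rw [image_eq_zero_of_notMem_tsupport fun h => hx (hψp h)]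
      refine tendsto_const_nhds.congr fun k => ?_
      exact (Set.indicator_of_notMem hx _).symm
  · have hch := ae_of_ae_chart hF.contMDiff p
      (P := fun x => MDifferentiableAt (𝓡 n) 𝓘(ℝ, ℝ) ψ x ∧ ∀ v : EuclideanSpace ℝ (Fin n),
        Filter.Tendsto (fun k => dAt (u k) x v) Filter.atTop (nhds (dAt ψ x v))) (by
      filter_upwards [hvae] with y hy hyt
      rw [← hφ] at hyt ⊢
      have he : f =ᶠ[nhds y] inChart ψ p := indicator_eventuallyEq φ.open_target hyt
      have hdiff : MDifferentiableAt (𝓡 n) 𝓘(ℝ, ℝ) ψ (φ.symm y) := by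
        refine mdifferentiableAt_of_inChart (p := p) (φ.map_target hyt) ?_
        rw [← hφ, φ.right_inv hyt]
        exact hy.1.congr_of_eventuallyEq he.symm
      refine ⟨hdiff, fun w => ?_⟩
      -- Every tangent vector comes from the fixed chart, where the mollified differentials are
      -- known to converge.
      obtain ⟨w', rfl⟩ := (dChartSymm_bijective hyt).surjective w
      rw [dAt_comp_dChartSymm hyt hdiff, ← he.fderiv_eq]
      refine (((ContinuousLinearMap.apply ℝ ℝ w').continuous.tendsto _).comp hy.2).congr
        fun k => ?_
      have hfd : fderiv ℝ (inChart (u k) p) y = fderiv ℝ (v k) y :=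
        ((huc k).eventuallyEq_of_mem (φ.open_target.mem_nhds hyt)).fderiv_eq
      rw [dAt_comp_dChartSymm hyt ((husm k).mdifferentiable (by simp) _), hfd]
      rfl)
    filter_upwards [hch] with x hx
    by_cases hxs : x ∈ φ.source
    · exact hx hxs
    · have hxψ : x ∉ tsupport ψ := fun h => hxs (hψp h)
      have h0 : ψ =ᶠ[nhds x] fun _ => 0 := notMem_tsupport_iff_eventuallyEq.1 hxψ
      refine ⟨mdifferentiableAt_const.congr_of_eventuallyEq h0, fun w => ?_⟩
      rw [dAt_eq_zero_of_notMem_tsupport hxψ]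
      refine tendsto_const_nhds.congr fun k => ?_
      rw [dAt_eq_zero_of_notMem_tsupport fun h => hxs (hKs (hut k h))]

variable [SecondCountableTopology M]

/-- The pieces `χ p * ψ` are only locally Lipschitz in their charts, which suffices because their
supports are compact. -/
lemma exists_smoothApprox (hF : IsSmoothImmersion n F) {ψ : M → ℝ} (hψc : HasCompactSupport ψ)
    (hψ : IsLipschitz (inducedMetric n F) ψ) : ∃ u K C, SmoothApprox (n := n) F ψ u K C := by
  obtain ⟨s, χ, hχ, hχp, hχ1⟩ := exists_finite_partition (n := n) hψc.isCompact
  have h1 : ψ = fun x => ∑ p ∈ s, χ p x * ψ x := by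
    ext1 x
    rw [← Finset.sum_mul]
    by_cases hx : x ∈ tsupport ψ
    · rw [hχ1 x hx, one_mul]
    · rw [image_eq_zero_of_notMem_tsupport hx, mul_zero]
  rw [h1]
  refine exists_smoothApprox_sum hF s fun p _ => exists_smoothApprox_chart hF (p := p) ?_ ?_ ?_
  · exact hψc.mul_left
  · exact (closure_mono (Function.support_mul_subset_left (χ p) ψ)).trans (hχp p)
  · intro y hy
    have hc : ContDiffAt ℝ 1 (inChart (χ p) p) y :=
      ((contDiffOn_inChart (hχ p) p).contDiffAt
        ((chartAt (EuclideanSpace ℝ (Fin n)) p).open_target.mem_nhds hy)).of_le (by simp)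
    exact exists_lipschitzOnWith_mul hc.exists_lipschitzOnWith
      (hψ.locallyLipschitzOn_inChart hF.contMDiff p hy)

/-- An inequality between integrals passes from smooth to Lipschitz functions. -/
lemma integral_le_of_isLipschitz (hF : IsSmoothImmersion n F) {V : M → ℝ} (hV : Continuous V)
    (hsm : ∀ u : M → ℝ, ContMDiff (𝓡 n) 𝓘(ℝ, ℝ) ∞ u → HasCompactSupport u →
      ∫ x, V x * u x ^ 2 ∂(volumeMeasure (inducedMetric n F))
        ≤ ∫ x, traceForm (n := n) F u u x ∂(volumeMeasure (inducedMetric n F)))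
    {ψ : M → ℝ} (hψc : HasCompactSupport ψ) (hψ : IsLipschitz (inducedMetric n F) ψ) :
    Integrable (traceForm (n := n) F ψ ψ) (volumeMeasure (inducedMetric n F)) ∧
      Integrable (fun x => V x * ψ x ^ 2) (volumeMeasure (inducedMetric n F)) ∧
      ∫ x, V x * ψ x ^ 2 ∂(volumeMeasure (inducedMetric n F))
        ≤ ∫ x, traceForm (n := n) F ψ ψ x ∂(volumeMeasure (inducedMetric n F)) := by
  obtain ⟨u, K, C, h⟩ := exists_smoothApprox hF hψc hψ
  have := isLocallyFiniteMeasure_volumeMeasure hF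
  set μ := volumeMeasure (inducedMetric n F)
  have hu0 : ∀ k x, x ∉ K → u k x = 0 := fun k x hx =>
    image_eq_zero_of_notMem_tsupport fun h' => hx (h.tsupport_subset k h')
  have hcs : ∀ k, HasCompactSupport (u k) := fun k => HasCompactSupport.intro h.isCompact (hu0 k)
  have hKm : MeasurableSet K := h.isCompact.measurableSet
  have hb1 : Integrable (K.indicator fun x => |V x| * C ^ 2) μ :=
    (integrable_indicator_iff hKm).2
      ((hV.abs.mul continuous_const).continuousOn.integrableOn_compact h.isCompact)
  have hb2 : Integrable (K.indicator fun _ => C) μ :=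
    (integrable_indicator_iff hKm).2 (continuousOn_const.integrableOn_compact h.isCompact)
  have hle1 : ∀ k x, ‖V x * u k x ^ 2‖ ≤ K.indicator (fun x => |V x| * C ^ 2) x := fun k x => by
    by_cases hx : x ∈ K
    · rw [Set.indicator_of_mem hx, norm_mul, Real.norm_eq_abs, norm_pow, Real.norm_eq_abs]
      gcongr
      exact h.abs_le k x
    · rw [Set.indicator_of_notMem hx, hu0 k x hx]
      simp
  have hle2 : ∀ k x, ‖traceForm (n := n) F (u k) (u k) x‖ ≤ K.indicator (fun _ => C) x :=
    fun k x => by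
      by_cases hx : x ∈ K
      · rw [Set.indicator_of_mem hx, Real.norm_of_nonneg (traceForm_self_nonneg hF _ _)]
        exact h.traceForm_le k x
      · rw [Set.indicator_of_notMem hx, traceForm_eq_zero
          (dAt_eq_zero_of_notMem_tsupport fun h' => hx (h.tsupport_subset k h')), norm_zero]
  have hm1 : ∀ k, AEStronglyMeasurable (fun x => V x * u k x ^ 2) μ := fun k =>
    (hV.mul ((h.contMDiff k).continuous.pow 2)).aestronglyMeasurable
  have hm2 : ∀ k, AEStronglyMeasurable (traceForm (n := n) F (u k) (u k)) μ := fun k =>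
    (contMDiff_traceForm hF (h.contMDiff k) (h.contMDiff k)).continuous.aestronglyMeasurable
  have ht1 : ∀ᵐ x ∂μ, Filter.Tendsto (fun k => V x * u k x ^ 2) Filter.atTop
      (nhds (V x * ψ x ^ 2)) := Filter.Eventually.of_forall fun x =>
    ((h.tendsto x).pow 2).const_mul _
  -- Where `ψ` is not differentiable its differential is zero by convention; these points form a
  -- null set and do not affect the limit.
  have ht2 : ∀ᵐ x ∂μ, Filter.Tendsto (fun k => traceForm (n := n) F (u k) (u k) x) Filter.atTop
      (nhds (traceForm (n := n) F ψ ψ x)) := by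
    filter_upwards [h.ae_tendsto] with x hx
    exact tendsto_finsetSum _ fun i _ => tendsto_finsetSum _ fun j _ =>
      ((hx.2 (stdVec i)).inner (hx.2 (stdVec j))).const_mul _
  have hlim1 := tendsto_integral_of_dominated_convergence _ hm1 hb1
    (fun k => Filter.Eventually.of_forall (hle1 k)) ht1
  have hlim2 := tendsto_integral_of_dominated_convergence _ hm2 hb2
    (fun k => Filter.Eventually.of_forall (hle2 k)) ht2
  refine ⟨?_, ?_, le_of_tendsto_of_tendsto' hlim1 hlim2 fun k => hsm _ (h.contMDiff k) (hcs k)⟩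
  · refine hb2.mono' (aestronglyMeasurable_of_tendsto_ae _ hm2 ht2) ?_
    filter_upwards [ht2] with x hx
    exact le_of_tendsto' hx.norm fun k => hle2 k x
  · refine hb1.mono' (aestronglyMeasurable_of_tendsto_ae _ hm1 ht1) ?_
    filter_upwards [ht1] with x hx
    exact le_of_tendsto' hx.norm fun k => hle1 k x

end Approximation

end StableMinimal

end

theorem mainTheorem6 {M : Type*} [TopologicalSpace M] [T2Space M] [SecondCountableTopology M]
    [ChartedSpace (EuclideanSpace ℝ (Fin 4)) M] [IsManifold (𝓡 4) ∞ M]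
    [MeasurableSpace M] [BorelSpace M]
    (F : M → EuclideanSpace ℝ (Fin 5)) (hF : StableMinimal.IsSmoothImmersion 4 F)
    (hcomplete : StableMinimal.IsCompleteMetric (StableMinimal.inducedMetric 4 F))
    (ν : M → EuclideanSpace ℝ (Fin 5)) (hν : StableMinimal.IsUnitNormal 4 F ν)
    (hminimal : StableMinimal.IsMinimal 4 F ν) (hstable : StableMinimal.IsStable 4 F ν)
    (N : TopologicalSpace.Opens M)
    (hN : N = StableMinimal.awayFromZero F hF.contMDiff.continuous)
    (g : StableMinimal.TensorField 4 N)
    (hg : g = StableMinimal.conformalMetric 4 (fun x : N => F x)) :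
    ∃ V : N → ℝ, ContMDiff (𝓡 4) 𝓘(ℝ, ℝ) ∞ V ∧
      (∀ x, 1 - StableMinimal.minBiRic g x ≤ V x) ∧
      ∀ ψ : N → ℝ, HasCompactSupport ψ → StableMinimal.IsLipschitz g ψ →
        Integrable (StableMinimal.gradNormSq g ψ) (StableMinimal.volumeMeasure g) ∧
        Integrable (fun x => V x * ψ x ^ 2) (StableMinimal.volumeMeasure g) ∧
        ∫ x, V x * ψ x ^ 2 ∂(StableMinimal.volumeMeasure g) ≤
          ∫ x, StableMinimal.gradNormSq g ψ x ∂(StableMinimal.volumeMeasure g) := by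
  open StableMinimal in
  subst hN hg
  set N := awayFromZero F hF.contMDiff.continuous
  have h0 : ∀ x : N, F x ≠ 0 := fun x => x.2
  have hW : Module.finrank ℝ (EuclideanSpace ℝ (Fin 5)) = 5 := by simp
  have hF' : IsSmoothImmersion 4 (fun x : N => F x) := hF.subtype
  have hν' : IsUnitNormal 4 (fun x : N => F x) (fun x : N => ν x) := hν.subtype hF.contMDiff
  have hmin' : IsMinimal 4 (fun x : N => F x) (fun x : N => ν x) :=
    hminimal.subtype hF.contMDiff hν
  have hst' : IsStable 4 (fun x : N => F x) (fun x : N => ν x) := hstable.subtype hF.contMDiff hν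
  have hV := contMDiff_potential hF' hν'.contMDiff h0
  refine ⟨_, hV, one_sub_minBiRic_le hW hF' hν' hmin' h0, fun ψ hψc hψ => ?_⟩
  -- From here on the conformal metric is the one induced by the cylinder immersion, so the
  -- approximation argument applies to it as it stands.
  rw [conformalMetric_eq hF'.contMDiff h0] at hψ ⊢
  rw [funext (gradNormSq_eq (fun x : N => cylinderMap (F x)) ψ)]
  exact integral_le_of_isLipschitz (hF'.cylinderMap_comp h0) hV.continuous
    (fun u hu huc => conformal_stability hW hF' hν' hmin' hst' h0 hu huc) hψc hψ
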